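/- Let $\mathfrak B_n$ be the braid group on $n\ge 0$ strands with Artin generators $\sigma_1,\dots,\sigma_{n-1}$, and for $\sigma\in\mathfrak B_n$ let the band rank $\mathrm{rk}_n(\sigma)$ be the least $c\in\mathbb Z_{\ge 0}$ such that $\sigma=\prod_{j=1}^{c}\omega_j\sigma_{i_j}^{\pm1}\omega_j^{-1}$ for some $\omega_j\in\mathfrak B_n$ and indices $i_j$ and signs. For a word representing $\sigma$, take the standard diagram, in an annulus, of its closure $\widehat\sigma$, with all strands oriented counterclockwise and with the letters $\sigma_i$ as positive crossings. Let $(\mathcal C,\partial^{Lee})$ be its Lee complex over $\mathbb C$ (Frobenius algebra $\mathbb C\langle v_+,v_-\rangle$ with unit $v_+$, $v_-^2=v_+$, $\Delta v_+=v_+\otimes v_-+v_-\otimes v_+$, $\Delta v_-=v_-\otimes v_-+v_+\otimes v_+$), with its basis of complete resolutions whose circles are labelled $v_\pm$. For such a generator $x$ let $j(x)$ be the quantum degree, that is, $\#v_+-\#v_-$ plus the number of $1$-resolutions plus $n_+-2n_-$, where $n_\pm$ are the numbers of positive and negative crossings. Let $k(x)$ be the number of $v_+$ minus the number of $v_-$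 among the labels of the nontrivial circles (those that are essential in the annulus), and put $j_t=j-t\,k$. Let $\mathfrak s_{o_\uparrow}$ be Lee's canonical cycle of the braid-like orientation: it lies in the oriented resolution, whose circles are $n$ concentric essential circles, labelled alternately $\mathbf b=v_--v_+$ and $\mathbf a=v_-+v_+$ from the outermost ($\mathbf b$) to the innermost. For $t\in[0,2]$ define $$d_t(\widehat\sigma)=\mathrm{gr}_{j_t}([\mathfrak s_{o_\uparrow}])=\max_{[z]=[\mathfrak s_{o_\uparrow}]}\ \min\{\,j_t(x): x\text{ a generator with nonzero coefficient in } z\,\},$$ the outer maximum being over the cycles $z$ homologous to $\mathfrak s_{o_\uparrow}$ in $(\mathcal C,\partial^{Lee})$. **Corollary.** Let $\sigma\in\mathfrak B_n$. For every $t\in[0,2]$ the maximum that defines $d_t(\widehat\sigma)$ exists, and its value does not depend on the word chosen for $\sigma$. The closure of the trivial braid, with its crossingless diagram, has $d_t(\widehat{\mathbb 1}_n)=-|n(1-t)|$ for all $t\in[0,2]$. Moreover the following maxima exist and satisfy $$\max_{t\in[0,2]}\bigl|d_t(\widehat\sigma)-d_t(\widehat{\mathbb 1}_n)\bigr|\le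 \mathrm{rk}_n(\sigma),\qquad\text{that is,}\qquad \max_{t\in[0,2]}\bigl|d_t(\widehat\sigma)+|n(1-t)|\bigr|\le \mathrm{rk}_n(\sigma).$$ -/

import Mathlib

noncomputable section

open scoped Classical

namespace AnnularLee

/-- Artin's relators on the generators `σ_0, …, σ_{n-2}`: far commutation and the braid relation. -/
def braidRels (n : ℕ) : Set (FreeGroup (Fin (n - 1))) :=
  {r | ∃ i j : Fin (n - 1), (i : ℕ) + 2 ≤ j ∧
      r = FreeGroup.of i * FreeGroup.of j * (FreeGroup.of i)⁻¹ * (FreeGroup.of j)⁻¹} ∪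
  {r | ∃ i j : Fin (n - 1), (i : ℕ) + 1 = j ∧
      r = FreeGroup.of i * FreeGroup.of j * FreeGroup.of i *
        (FreeGroup.of j * FreeGroup.of i * FreeGroup.of j)⁻¹}

/-- The braid group on `n` strands, by Artin's presentation. -/
abbrev BraidGroup (n : ℕ) : Type := PresentedGroup (braidRels n)

/-- The `i`-th elementary Artin generator (indices start at `0`); it crosses the strands in
positions `i` and `i + 1`. -/
def artinGen {n : ℕ} (i : Fin (n - 1)) : BraidGroup n := PresentedGroup.of i

/-- A conjugate of an Artin generator or of its inverse. -/
def IsBand {n : ℕ} (β : BraidGroup n) : Prop :=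
  ∃ (ω : BraidGroup n) (i : Fin (n - 1)),
    β = ω * artinGen i * ω⁻¹ ∨ β = ω * (artinGen i)⁻¹ * ω⁻¹

/-- The band rank: the least `c` such that `σ` is a product of `c` bands. (Such a `c` exists since
the Artin generators generate the group.) -/
def bandRank {n : ℕ} (σ : BraidGroup n) : ℕ :=
  sInf {c : ℕ | ∃ b : Fin c → BraidGroup n, (∀ j, IsBand (b j)) ∧ σ = (List.ofFn b).prod}

/-- A braid word: the letter `(i, true)` is `σ_i`, the letter `(i, false)` is `σ_i⁻¹`. -/
abbrev BraidWord (n : ℕ) : Type := List (Fin (n - 1) × Bool)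

/-- The braid that a word represents. -/
def toBraid {n : ℕ} (w : BraidWord n) : BraidGroup n :=
  (w.map fun l => if l.2 then artinGen l.1 else (artinGen l.1)⁻¹).prod

/-- The two positions `i` and `i + 1` that the letter `(i, ±)` involves. -/
def leftPos {n : ℕ} (i : Fin (n - 1)) : Fin n := ⟨i, by omega⟩

/-- See `leftPos`. -/
def rightPos {n : ℕ} (i : Fin (n - 1)) : Fin n := ⟨i + 1, by omega⟩

variable {n : ℕ} (w : BraidWord n)

/-! ### The closed braid diagram and its Kauffman states

The standard annular diagram of the closure of the braid word `w`: the `n` strand positions are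
cut at heights `0, …, w.length`; the `l`-th letter gives the crossing between heights `l` and
`l + 1`; and for each position `p` a closing arc joins the point at `(w.length, p)` to the point at
`(0, p)`. All strands run counterclockwise around the inner basepoint, position `0` is the outermost
one, and the letter `σ_i` is a positive crossing. A fixed arc `γ` from the inner to the outer
basepoint meets each of the `n` closing arcs exactly once and nothing else. -/

/-- The marked points of the diagram: (height, position). -/
abbrev Pt : Type := Fin (w.length + 1) × Fin n

/-- A vertex of the cube of resolutions: for each crossing, `false` is the `0`-resolution and `true`
is the `1`-resolution. -/
abbrev Vertex : Type := Fin w.length → Bool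

/-- Whether the state `S` resolves the crossing `l` in the oriented (braid-like) way. This is the
`0`-resolution of a positive crossing and the `1`-resolution of a negative one. -/
def IsBraidlike (S : Vertex w) (l : Fin w.length) : Prop := S l = !(w.get l).2

/-- Marked points joined by an arc of the complete resolution `S`. -/
inductive Joined (S : Vertex w) : Pt w → Pt w → Prop
  | strand (l : Fin w.length) (p : Fin n) (hl : p ≠ leftPos (w.get l).1)
      (hr : p ≠ rightPos (w.get l).1) : Joined S (l.castSucc, p) (l.succ, p)
  | left (l : Fin w.length) (h : IsBraidlike w S l) :
      Joined S (l.castSucc, leftPos (w.get l).1) (l.succ, leftPos (w.get l).1)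
  | right (l : Fin w.length) (h : IsBraidlike w S l) :
      Joined S (l.castSucc, rightPos (w.get l).1) (l.succ, rightPos (w.get l).1)
  | lower (l : Fin w.length) (h : ¬ IsBraidlike w S l) :
      Joined S (l.castSucc, leftPos (w.get l).1) (l.castSucc, rightPos (w.get l).1)
  | upper (l : Fin w.length) (h : ¬ IsBraidlike w S l) :
      Joined S (l.succ, leftPos (w.get l).1) (l.succ, rightPos (w.get l).1)
  | closing (p : Fin n) : Joined S (Fin.last w.length, p) (0, p)

/-- The circles of the complete resolution `S`: classes of marked points under the equivalence
relation generated by `Joined`. -/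
abbrev Circle (S : Vertex w) : Type := Quot (Joined w S)

/-- The circle through a marked point. -/
def circleAt (S : Vertex w) (x : Pt w) : Circle w S := Quot.mk _ x

/-- A circle is nontrivial if it meets the arc `γ` an odd number of times. -/
def IsNontrivial (S : Vertex w) (c : Circle w S) : Prop :=
  Odd (Nat.card {p : Fin n // circleAt w S (0, p) = c})

/-- The distinguished generators of the complex: a complete resolution with a label on each of its
circles, where `true` stands for `v₊` and `false` for `v₋`. -/
abbrev Gen : Type := Σ S : Vertex w, (Circle w S → Bool)

instance instFiniteGen : Finite (Gen w) :=
  have (S : Vertex w) : Finite (Circle w S) := Quot.finite _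
  inferInstance

instance instFintypeGen : Fintype (Gen w) := Fintype.ofFinite _

/-- The vector space underlying the annular Khovanov-Lee complex. -/
abbrev Chain : Type := Gen w → ℂ

/-! ### Gradings -/

/-- The degree `+1` of `v₊` and `-1` of `v₋`. -/
def labelDeg (b : Bool) : ℤ := if b then 1 else -1

/-- The number of positive crossings. -/
def posCrossings : ℕ := w.countP fun l => l.2

/-- The number of negative crossings. -/
def negCrossings : ℕ := w.countP fun l => !l.2

/-- The number of `1`-resolutions in a state. -/
def height (S : Vertex w) : ℕ := Nat.card {l : Fin w.length // S l = true}

/-- The quantum grading `j`. -/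
def jGrading (e : Gen w) : ℤ :=
  (∑ᶠ c : Circle w e.1, labelDeg (e.2 c)) + height w e.1 + posCrossings w - 2 * negCrossings w

/-- The annular grading `k`: the algebraic intersection number with `γ`, where `v₊` orients a circle
counterclockwise and `v₋` clockwise. A trivial circle contributes `0` and a nontrivial one `±1`. -/
def kGrading (e : Gen w) : ℤ :=
  ∑ᶠ c : Circle w e.1, if IsNontrivial w e.1 c then labelDeg (e.2 c) else 0

/-- The grading `j_t = j - t k`. -/
def jtGrading (t : ℝ) (e : Gen w) : ℝ := jGrading w e - t * kGrading w e

/-- The step `s` of the descending `ℝ`-filtration that the grading `j_t` induces: the span of the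
generators with `j_t ≥ s`. -/
def filtration (t s : ℝ) : Submodule ℂ (Chain w) where
  carrier := {f | ∀ e, f e ≠ 0 → s ≤ jtGrading w t e}
  zero_mem' := fun e h => absurd rfl h
  add_mem' := fun {f g} hf hg e h => by
    by_cases hfe : f e = 0
    · exact hg e fun hge => h (by simp [hfe, hge])
    · exact hf e hfe
  smul_mem' := fun c f hf e h => hf e fun hfe => h (by simp [hfe])

/-! ### The Lee differential -/

/-- The coefficient of `r` in Lee's product `p * q`:
`v₊v₊ = v₊`, `v₊v₋ = v₋v₊ = v₋`, `v₋v₋ = v₊`. -/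
def mergeCoeff : Bool → Bool → Bool → ℂ
  | true, true, true => 1
  | true, false, false => 1
  | false, true, false => 1
  | false, false, true => 1
  | _, _, _ => 0

/-- The coefficient of `q ⊗ r` in Lee's coproduct of `p`:
`v₊ ↦ v₊ ⊗ v₋ + v₋ ⊗ v₊`, `v₋ ↦ v₋ ⊗ v₋ + v₊ ⊗ v₊`. -/
def splitCoeff : Bool → Bool → Bool → ℂ
  | true, true, false => 1
  | true, false, true => 1
  | false, false, false => 1
  | false, true, true => 1
  | _, _, _ => 0

/-- Two opposite corners of the crossing `l`. In either resolution of `l` they lie on the two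
different local arcs. -/
def cornerA (l : Fin w.length) : Pt w := (l.castSucc, leftPos (w.get l).1)

/-- See `cornerA`. -/
def cornerB (l : Fin w.length) : Pt w := (l.succ, rightPos (w.get l).1)

/-- `e'` is obtained from `e` by changing the crossing `l` from its `0`- to its `1`-resolution,
with the labels of all circles that do not meet this crossing unchanged. -/
def IsEdge (l : Fin w.length) (e e' : Gen w) : Prop :=
  e.1 l = false ∧ e'.1 = Function.update e.1 l true ∧
    ∀ x : Pt w, circleAt w e.1 x ≠ circleAt w e.1 (cornerA w l) →
      circleAt w e.1 x ≠ circleAt w e.1 (cornerB w l) →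
      e'.2 (circleAt w e'.1 x) = e.2 (circleAt w e.1 x)

/-- The usual sign of an edge of the cube: `-1` to the number of earlier `1`-resolutions. -/
def edgeSign (S : Vertex w) (l : Fin w.length) : ℂ :=
  (-1) ^ Nat.card {k : Fin w.length // k < l ∧ S k = true}

/-- The coefficient on the circles that meet the crossing `l`: the product if two circles merge
into one, the coproduct if one circle splits into two. -/
def localCoeff (l : Fin w.length) (e e' : Gen w) : ℂ :=
  if circleAt w e.1 (cornerA w l) ≠ circleAt w e.1 (cornerB w l) then
    mergeCoeff (e.2 (circleAt w e.1 (cornerA w l))) (e.2 (circleAt w e.1 (cornerB w l)))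
      (e'.2 (circleAt w e'.1 (cornerA w l)))
  else
    splitCoeff (e.2 (circleAt w e.1 (cornerA w l))) (e'.2 (circleAt w e'.1 (cornerA w l)))
      (e'.2 (circleAt w e'.1 (cornerB w l)))

/-- The matrix of the Lee differential: row `e'`, column `e`. -/
def leeMatrix : Matrix (Gen w) (Gen w) ℂ := fun e' e =>
  ∑ l : Fin w.length, if IsEdge w l e e' then edgeSign w e.1 l * localCoeff w l e e' else 0

/-- The Lee differential. -/
def leeDifferential : Chain w →ₗ[ℂ] Chain w := (leeMatrix w).mulVecLin

/-! ### The canonical cycle and the annular Rasmussen invariant -/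

/-- The resolution that is braid-like at every crossing; its circles are `n` concentric nontrivial
circles, one for each position. -/
def braidlikeVertex : Vertex w := fun l => !(w.get l).2

/-- Lee's canonical cycle of the braid-like orientation: in the braid-like resolution the outermost
circle (position `0`) carries `b = v₋ - v₊`, and from there on inwards the circles alternately
carry `a = v₋ + v₊` and `b`. -/
def canonicalCycle : Chain w := fun e =>
  if e.1 = braidlikeVertex w then
    ∏ p : Fin n, if e.2 (circleAt w e.1 (0, p)) = true ∧ Even (p : ℕ) then -1 else 1
  else 0

/-- The filtration levels reached by the cycles that represent the Lee homology class of the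
canonical cycle. -/
def levels (t : ℝ) : Set ℝ :=
  {s | ∃ y : Chain w, canonicalCycle w + leeDifferential w y ∈ filtration w t s}

/-- The annular Rasmussen invariant `d_t` of the closure of the braid word `w` with its braid-like
orientation: the `j_t`-grading of the Lee homology class of the canonical cycle, i.e. the largest
filtration level of a representing cycle. -/
def annularRasmussen (t : ℝ) : ℝ := sSup (levels w t)

end AnnularLee

end

noncomputable section

open scoped Classical

set_option linter.unusedSectionVars false

namespace AnnularLee

open Equiv (Perm swap)

section Permutations

variable {P : Type*}

/-- A colouring of the points that is constant along the cycles of `π`. -/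
def Inv (π : Perm P) (ε : P → Bool) : Prop := ∀ p, ε (π p) = ε p

theorem Inv.sameCycle {π : Perm P} {ε : P → Bool} (h : Inv π ε) {p q : P}
    (hpq : π.SameCycle p q) : ε p = ε q := by
  obtain ⟨i, rfl⟩ := hpq
  have key : ∀ p, ε ((π⁻¹) p) = ε p := fun p => by
    have := h (π⁻¹ p)
    simpa using this.symm
  induction i using Int.induction_on with
  | zero => simp
  | succ i ih =>
    rw [ih, add_comm, zpow_add, Equiv.Perm.mul_apply, zpow_one, h]
  | pred i ih =>
    rw [ih, sub_eq_add_neg, add_comm, zpow_add, Equiv.Perm.mul_apply, zpow_neg_one, key]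

theorem inv_sameCycle (π : Perm P) (p : P) : Inv π fun q => decide (π.SameCycle p q) := fun q => by
  simp

theorem sameCycle_iff {π : Perm P} {p q : P} :
    π.SameCycle p q ↔ ∀ ε, Inv π ε → ε p = ε q := by
  refine ⟨fun h ε hε => hε.sameCycle h, fun h => ?_⟩
  have := h _ (inv_sameCycle π p)
  simpa [Equiv.Perm.SameCycle.refl] using this

variable [DecidableEq P]

theorem Inv.mul_swap {π : Perm P} {ε : P → Bool} {x y : P} (h : Inv π ε) (hxy : ε x = ε y) :
    Inv (π * swap x y) ε := fun p => by
  rw [Equiv.Perm.mul_apply, h]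
  by_cases hx : p = x
  · subst hx; simp [hxy]
  by_cases hy : p = y
  · subst hy; simp [hxy]
  rw [Equiv.swap_apply_of_ne_of_ne hx hy]

theorem mul_swap_mul_swap (π : Perm P) (x y : P) : π * swap x y * swap x y = π := by
  rw [mul_assoc, Equiv.swap_mul_self, mul_one]

theorem Inv.of_mul_swap {π : Perm P} {ε : P → Bool} {x y : P} (h : Inv (π * swap x y) ε)
    (hxy : ε x = ε y) : Inv π ε := by
  simpa [mul_swap_mul_swap] using h.mul_swap hxy

variable [Finite P]

theorem sameCycle_mul_swap {π : Perm P} {x y : P} (h : ¬ π.SameCycle x y) :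
    (π * swap x y).SameCycle x y := by
  have hper : ∃ k, 0 < k ∧ (π ^ k) y = y :=
    ⟨orderOf π, orderOf_pos π, by simp [pow_orderOf_eq_one]⟩
  obtain ⟨hk, hky⟩ := Nat.find_spec hper
  set k := Nat.find hper
  have hmin : ∀ j, 0 < j → j < k → (π ^ j) y ≠ y := fun j hj hjk he =>
    Nat.find_min hper hjk ⟨hj, he⟩
  have hne : ∀ j : ℕ, (π ^ j) y ≠ x := fun j he => h (Equiv.Perm.SameCycle.symm ⟨j, by simpa using he⟩)
  have claim : ∀ j, j + 1 ≤ k → ((π * swap x y) ^ (j + 1)) x = (π ^ (j + 1)) y := by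
    intro j
    induction j with
    | zero => intro _; simp
    | succ j ih =>
      intro hj
      rw [pow_succ', Equiv.Perm.mul_apply, ih (by omega), Equiv.Perm.mul_apply,
        Equiv.swap_apply_of_ne_of_ne (hne _) (hmin _ (by omega) (by omega)), pow_succ' π (j + 1),
        Equiv.Perm.mul_apply]
  obtain ⟨j, hj⟩ : ∃ j, k = j + 1 := ⟨k - 1, by omega⟩
  refine ⟨(k : ℤ), ?_⟩
  rw [zpow_natCast, hj, claim j hj.ge, ← hj, hky]

theorem not_sameCycle_mul_swap {π : Perm P} {x y : P} (h : π.SameCycle x y) (hxy : x ≠ y) :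
    ¬ (π * swap x y).SameCycle x y := by
  have hex : ∃ k, 0 < k ∧ (π ^ k) x = y := by
    obtain ⟨i, hi⟩ := h.exists_nat_pow_eq
    rcases Nat.eq_zero_or_pos i with rfl | hpos
    · exact absurd (by simpa using hi) hxy
    · exact ⟨i, hpos, hi⟩
  obtain ⟨hk, hky⟩ := Nat.find_spec hex
  set k := Nat.find hex
  have hmin : ∀ j, 0 < j → j < k → (π ^ j) x ≠ y := fun j hj hjk he =>
    Nat.find_min hex hjk ⟨hj, he⟩
  have hne : ∀ j, 0 < j → j < k → (π ^ j) x ≠ x := fun j hj hjk he => by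
    refine hmin (k - j) (by omega) (by omega) ?_
    have : (π ^ (k - j)) ((π ^ j) x) = y := by
      rw [← Equiv.Perm.mul_apply, ← pow_add, Nat.sub_add_cancel hjk.le, hky]
    rwa [he] at this
  have claim : ∀ j, j + 1 ≤ k → ((π * swap x y) ^ (j + 1)) y = (π ^ (j + 1)) x := by
    intro j
    induction j with
    | zero => intro _; simp
    | succ j ih =>
      intro hj
      rw [pow_succ', Equiv.Perm.mul_apply, ih (by omega), Equiv.Perm.mul_apply,
        Equiv.swap_apply_of_ne_of_ne (hne _ (by omega) (by omega)) (hmin _ (by omega) (by omega)),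
        pow_succ' π (j + 1), Equiv.Perm.mul_apply]
  obtain ⟨j, hj⟩ : ∃ j, k = j + 1 := ⟨k - 1, by omega⟩
  have hfix : ((π * swap x y) ^ k) y = y := by rw [hj, claim j hj.ge, ← hj, hky]
  intro hc
  obtain ⟨m, hm⟩ := hc.symm.exists_nat_pow_eq
  have hmod : ((π * swap x y) ^ (m % k)) y = x := by
    rw [← Nat.mod_add_div m k, pow_add, Equiv.Perm.mul_apply, pow_mul] at hm
    rwa [Function.IsFixedPt.eq (f := (((π * swap x y) ^ k) ^ (m / k))) ?_] at hm
    exact Equiv.Perm.pow_apply_eq_self_of_apply_eq_self hfix _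
  rcases Nat.eq_zero_or_pos (m % k) with h0 | hpos
  · rw [h0] at hmod; exact hxy (by simpa using hmod.symm)
  · have hlt := Nat.mod_lt m hk
    obtain ⟨i, hi⟩ : ∃ i, m % k = i + 1 := ⟨m % k - 1, by omega⟩
    rw [hi, claim i (by omega)] at hmod
    exact hne (i + 1) (by omega) (by omega) hmod

end Permutations

section Orbits

variable {P : Type*} [DecidableEq P] [Fintype P]

/-- The cycle of `π` through `p`, fixed points included. -/
def orb (π : Perm P) (p : P) : Finset P := Finset.univ.filter fun q => π.SameCycle p q

/-- The cycles of `π`. -/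
def orbs (π : Perm P) : Finset (Finset P) := Finset.univ.image (orb π)

@[simp] theorem mem_orb {π : Perm P} {p q : P} : q ∈ orb π p ↔ π.SameCycle p q := by simp [orb]

theorem orb_mem_orbs (π : Perm P) (p : P) : orb π p ∈ orbs π :=
  Finset.mem_image_of_mem _ (Finset.mem_univ _)

theorem orb_eq_iff {π : Perm P} {p q : P} : orb π p = orb π q ↔ π.SameCycle p q := by
  refine ⟨fun h => ?_, fun h => ?_⟩
  · have : q ∈ orb π q := by simp [Equiv.Perm.SameCycle.refl]
    rw [← h] at this
    simpa using this
  · ext r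
    simp only [mem_orb]
    exact ⟨fun hr => h.symm.trans hr, fun hr => h.trans hr⟩

theorem mem_orbs {π : Perm P} {c : Finset P} : c ∈ orbs π ↔ ∃ p, orb π p = c := by
  simp [orbs]

theorem eq_orb_of_mem {π : Perm P} {c : Finset P} (hc : c ∈ orbs π) {p : P} (hp : p ∈ c) :
    c = orb π p := by
  obtain ⟨q, rfl⟩ := mem_orbs.1 hc
  exact orb_eq_iff.2 (by simpa using hp)

theorem sameCycle_mul_swap_iff {π : Perm P} {x y : P} (h : ¬ π.SameCycle x y) {p q : P} :
    (π * swap x y).SameCycle p q ↔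
      π.SameCycle p q ∨ (p ∈ orb π x ∪ orb π y ∧ q ∈ orb π x ∪ orb π y) := by
  have hxy := sameCycle_mul_swap h
  have mono : ∀ {a b}, π.SameCycle a b → (π * swap x y).SameCycle a b := fun {a b} hab =>
    sameCycle_iff.2 fun ε hε => (hε.of_mul_swap (hε.sameCycle hxy)).sameCycle hab
  constructor
  · intro hpq
    by_contra hcon
    push Not at hcon
    obtain ⟨h1, h2⟩ := hcon
    by_cases hp : p ∈ orb π x ∪ orb π y
    · have hI : Inv (π * swap x y) fun r => decide (r ∈ orb π x ∪ orb π y) := by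
        apply Inv.mul_swap
        · intro r; simp
        · simp [Equiv.Perm.SameCycle.refl]
      have := hI.sameCycle hpq
      simp only [hp, decide_true] at this
      exact h2 hp (by simpa using this.symm)
    · have hI : Inv (π * swap x y) fun r => decide (π.SameCycle p r) := by
        refine Inv.mul_swap (fun r => by simp) ?_
        simp only [Finset.mem_union, mem_orb, not_or] at hp
        have h3 : ¬ π.SameCycle p x := fun h' => hp.1 h'.symm
        have h4 : ¬ π.SameCycle p y := fun h' => hp.2 h'.symm
        simp [h3, h4]
      have := hI.sameCycle hpq
      simp only [Equiv.Perm.SameCycle.refl, decide_true] at this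
      exact h1 (by simpa using this.symm)
  · have key : ∀ {r}, r ∈ orb π x ∪ orb π y → (π * swap x y).SameCycle x r := fun {r} hr => by
      rcases Finset.mem_union.1 hr with hr | hr
      · exact mono (by simpa using hr)
      · exact hxy.trans (mono (by simpa using hr))
    rintro (hpq | ⟨hp, hq⟩)
    · exact mono hpq
    · exact (key hp).symm.trans (key hq)

theorem disjoint_orb {π : Perm P} {x y : P} (h : ¬ π.SameCycle x y) :
    Disjoint (orb π x) (orb π y) := by
  rw [Finset.disjoint_left]
  intro r hx hy
  simp only [mem_orb] at hx hy
  exact h (hx.trans hy.symm)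

theorem orb_mul_swap_of_mem {π : Perm P} {x y : P} (h : ¬ π.SameCycle x y) {p : P}
    (hp : p ∈ orb π x ∪ orb π y) : orb (π * swap x y) p = orb π x ∪ orb π y := by
  ext q
  rw [mem_orb, sameCycle_mul_swap_iff h]
  refine ⟨?_, fun hq => Or.inr ⟨hp, hq⟩⟩
  rintro (hpq | hpq)
  · simp only [Finset.mem_union, mem_orb] at hp ⊢
    exact hp.imp (·.trans hpq) (·.trans hpq)
  · exact hpq.2

theorem orb_mul_swap_of_not_mem {π : Perm P} {x y : P} (h : ¬ π.SameCycle x y) {p : P}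
    (hp : p ∉ orb π x ∪ orb π y) : orb (π * swap x y) p = orb π p := by
  ext q
  rw [mem_orb, sameCycle_mul_swap_iff h, mem_orb]
  simp [hp]

theorem orbs_mul_swap {π : Perm P} {x y : P} (h : ¬ π.SameCycle x y) :
    orbs (π * swap x y) =
      insert (orb π x ∪ orb π y) (((orbs π).erase (orb π x)).erase (orb π y)) := by
  ext c
  simp only [Finset.mem_insert, Finset.mem_erase, mem_orbs]
  constructor
  · rintro ⟨p, rfl⟩
    by_cases hp : p ∈ orb π x ∪ orb π y
    · exact Or.inl (orb_mul_swap_of_mem h hp)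
    · right
      rw [orb_mul_swap_of_not_mem h hp]
      simp only [Finset.mem_union, mem_orb, not_or] at hp
      exact ⟨fun he => hp.2 (orb_eq_iff.1 he).symm, fun he => hp.1 (orb_eq_iff.1 he).symm, p, rfl⟩
  · rintro (rfl | ⟨h1, h2, p, rfl⟩)
    · exact ⟨x, orb_mul_swap_of_mem h (by simp [Equiv.Perm.SameCycle.refl])⟩
    · refine ⟨p, orb_mul_swap_of_not_mem h ?_⟩
      simp only [Finset.mem_union, mem_orb, not_or]
      exact ⟨fun he => h2 (orb_eq_iff.2 he.symm), fun he => h1 (orb_eq_iff.2 he.symm)⟩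

@[to_additive sum_orbs_mul_swap]
theorem prod_orbs_mul_swap {R : Type*} [CommMonoid R] {π : Perm P} {x y : P}
    (h : ¬ π.SameCycle x y) (F : Finset P → R) :
    ∃ r, (∏ c ∈ orbs π, F c = F (orb π x) * F (orb π y) * r) ∧
      (∏ c ∈ orbs (π * swap x y), F c = F (orb π x ∪ orb π y) * r) ∧
      (r = ∏ c ∈ ((orbs π).erase (orb π x)).erase (orb π y), F c) := by
  refine ⟨_, ?_, ?_, rfl⟩
  · rw [mul_assoc, Finset.mul_prod_erase, Finset.mul_prod_erase _ _ (orb_mem_orbs π x)]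
    refine Finset.mem_erase.2 ⟨fun he => h (orb_eq_iff.1 he).symm, orb_mem_orbs π y⟩
  · rw [orbs_mul_swap h, Finset.prod_insert]
    simp only [Finset.mem_erase, not_and]
    intro _ h2 h3
    obtain ⟨p, hp⟩ := mem_orbs.1 h3
    refine h2 ?_
    have hx : x ∈ orb π p := by rw [hp]; simp [Equiv.Perm.SameCycle.refl]
    rw [← hp, orb_eq_iff]
    simpa using hx

end Orbits

/-- The value `±1` of a colour. -/
def sg (b : Bool) : ℂ := if b then 1 else -1

/-- A square root of `2 sg b`. -/
def nu (b : Bool) : ℂ := if b then (Real.sqrt 2 : ℂ) else (Real.sqrt 2 : ℂ) * Complex.I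

theorem sg_mul_self (b : Bool) : sg b * sg b = 1 := by cases b <;> simp [sg]

theorem sg_ne_zero (b : Bool) : sg b ≠ 0 := by cases b <;> simp [sg]

theorem sg_pow_of_even (b : Bool) {k : ℕ} (h : Even k) : sg b ^ k = 1 := by
  cases b <;> simp [sg, h.neg_one_pow]

theorem sg_pow_of_odd (b : Bool) {k : ℕ} (h : Odd k) : sg b ^ k = sg b := by
  cases b <;> simp [sg, h.neg_one_pow]

theorem nu_mul_self (b : Bool) : nu b * nu b = 2 * sg b := by
  have h : (Real.sqrt 2 : ℂ) * (Real.sqrt 2 : ℂ) = 2 := by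
    rw [← Complex.ofReal_mul, Real.mul_self_sqrt (by norm_num)]; simp
  cases b
  · simp only [nu, sg, Bool.false_eq_true, if_false]
    linear_combination (Complex.I * Complex.I) * h + 2 * Complex.I_mul_I
  · simp [nu, sg, h]

theorem nu_ne_zero (b : Bool) : nu b ≠ 0 := fun h => by
  have := nu_mul_self b
  rw [h, zero_mul] at this
  exact mul_ne_zero two_ne_zero (sg_ne_zero b) this.symm

section Filtration

variable {P : Type*} [DecidableEq P] [Fintype P]

/-- The contribution of the circle `c` to the grading `j - t k`, for the marked points `M` (those on
the arc `γ`) and the label given by the parity of the exponents `τ` on `c`. -/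
def degOn (M : Finset P) (t : ℝ) (τ : P → ℕ) (c : Finset P) : ℝ :=
  (-1) ^ (∑ p ∈ c, τ p) * (if Odd (M ∩ c).card then 1 - t else 1)

/-- The sum of the contributions of all circles. -/
def wt (M : Finset P) (t : ℝ) (π : Perm P) (τ : P → ℕ) : ℝ := ∑ c ∈ orbs π, degOn M t τ c

/-- The colour of a monochromatic set. -/
def colOf (c : Finset P) (ε : P → Bool) : Bool := decide (∃ p ∈ c, ε p = true)

/-- The normalisation that makes merges and splits local. -/
def nrm (π : Perm P) (ε : P → Bool) : ℂ := ∏ c ∈ orbs π, (nu (colOf c ε))⁻¹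

/-- The normalised monomial with exponents `τ`, as a function of colourings. -/
def mono (π : Perm P) (τ : P → ℕ) (ε : P → Bool) : ℂ := (∏ p, sg (ε p) ^ τ p) * nrm π ε

/-- The functions that agree on the `π`-invariant colourings with a combination of monomials of
weight at least `a`. -/
def Fil (M : Finset P) (t : ℝ) (π : Perm P) (a : ℝ) : Submodule ℂ ((P → Bool) → ℂ) :=
  Submodule.span ℂ {f | ∃ (c : ℂ) (τ : P → ℕ), (c ≠ 0 → a ≤ wt M t π τ) ∧
    ∀ ε, Inv π ε → f ε = c * mono π τ ε}

theorem nrm_ne_zero (π : Perm P) (ε : P → Bool) : nrm π ε ≠ 0 :=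
  Finset.prod_ne_zero_iff.2 fun _ _ => inv_ne_zero (nu_ne_zero _)

theorem colOf_eq {c : Finset P} {ε : P → Bool} {p : P} (hp : p ∈ c)
    (h : ∀ q ∈ c, ε q = ε p) : colOf c ε = ε p := by
  unfold colOf
  cases he : ε p
  · simp only [decide_eq_false_iff_not, not_exists, not_and]
    intro q hq
    rw [h q hq, he]; simp
  · simp only [decide_eq_true_eq]
    exact ⟨p, hp, he⟩

theorem colOf_orb {π : Perm P} {ε : P → Bool} (h : Inv π ε) (p : P) : colOf (orb π p) ε = ε p :=
  colOf_eq (by simp [Equiv.Perm.SameCycle.refl]) fun q hq => (h.sameCycle (by simpa using hq)).symm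

theorem mem_Fil_of {M : Finset P} {t a : ℝ} {π : Perm P} {f : (P → Bool) → ℂ} (c : ℂ) (τ : P → ℕ)
    (h : c ≠ 0 → a ≤ wt M t π τ) (hf : ∀ ε, Inv π ε → f ε = c * mono π τ ε) : f ∈ Fil M t π a :=
  Submodule.subset_span ⟨c, τ, h, hf⟩

theorem Fil_congr {M : Finset P} {t a : ℝ} {π : Perm P} {f g : (P → Bool) → ℂ}
    (hf : f ∈ Fil M t π a) (h : ∀ ε, Inv π ε → g ε = f ε) : g ∈ Fil M t π a := by
  have : g - f ∈ Fil M t π a := mem_Fil_of 0 0 (fun h => absurd rfl h) fun ε hε => by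
    simp [h ε hε]
  simpa using add_mem this hf

/-- A linear map that sends each monomial into a step of the filtration. -/
theorem map_mem_Fil {Q : Type*} [DecidableEq Q] [Fintype Q] {M : Finset P} {t a : ℝ} {π : Perm P}
    {M' : Finset Q} {a' : ℝ} {π' : Perm Q}
    (A : ((P → Bool) → ℂ) →ₗ[ℂ] ((Q → Bool) → ℂ))
    (hA : ∀ f g : (P → Bool) → ℂ, (∀ ε, Inv π ε → f ε = g ε) → ∀ ε, Inv π' ε → A f ε = A g ε)
    (h : ∀ τ, a ≤ wt M t π τ → A (mono π τ) ∈ Fil M' t π' a')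
    {f : (P → Bool) → ℂ} (hf : f ∈ Fil M t π a) : A f ∈ Fil M' t π' a' := by
  induction hf using Submodule.span_induction with
  | mem f hf =>
    obtain ⟨c, τ, hc, hf⟩ := hf
    by_cases h0 : c = 0
    · subst h0
      refine Fil_congr (zero_mem _) fun ε hε => ?_
      rw [hA f 0 (fun ε hε => by simp [hf ε hε]) ε hε, map_zero]
    · refine Fil_congr ((Fil M' t π' a').smul_mem c (h τ (hc h0))) fun ε hε => ?_
      rw [hA f (c • mono π τ) (fun ε hε => by simp [hf ε hε]) ε hε, map_smul]
  | zero => simp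
  | add f g _ _ hf hg => rw [map_add]; exact add_mem hf hg
  | smul c f _ hf => rw [map_smul]; exact Submodule.smul_mem _ _ hf

/-- Substitute in the colouring and multiply by a function of it. -/
def wop {Q : Type*} (k : (Q → Bool) → ℂ) (ρ : (Q → Bool) → (P → Bool)) :
    ((P → Bool) → ℂ) →ₗ[ℂ] ((Q → Bool) → ℂ) where
  toFun f ε := k ε * f (ρ ε)
  map_add' f g := by ext; simp [mul_add]
  map_smul' c f := by ext; simp [mul_left_comm]

@[simp] theorem wop_apply {Q : Type*} (k : (Q → Bool) → ℂ) (ρ : (Q → Bool) → (P → Bool))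
    (f : (P → Bool) → ℂ) (ε : Q → Bool) : wop k ρ f ε = k ε * f (ρ ε) := rfl

/-- The sign and the type of a union of two circles. -/
theorem degOn_union (M : Finset P) (t : ℝ) (τ : P → ℕ) {c d : Finset P} (h : Disjoint c d) :
    degOn M t τ (c ∪ d) = (-1) ^ (∑ p ∈ c, τ p) * (-1) ^ (∑ p ∈ d, τ p) *
      (if (Odd (M ∩ c).card ↔ Odd (M ∩ d).card) then 1 else 1 - t) := by
  unfold degOn
  rw [Finset.sum_union h, Finset.inter_union_distrib_left, Finset.card_union_of_disjoint
    (h.mono Finset.inter_subset_right Finset.inter_subset_right), pow_add]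
  congr 1
  simp only [Nat.odd_add, ← Nat.not_odd_iff_even]
  by_cases h1 : Odd (M ∩ c).card <;> by_cases h2 : Odd (M ∩ d).card <;>
    simp [h1, h2]

theorem degOn_merge (M : Finset P) {t : ℝ} (ht : t ∈ Set.Icc (0 : ℝ) 2) (τ : P → ℕ)
    {c d : Finset P} (h : Disjoint c d) :
    degOn M t τ c + degOn M t τ d - 1 ≤ degOn M t τ (c ∪ d) := by
  obtain ⟨h0, h2⟩ := ht
  rw [degOn_union M t τ h]
  unfold degOn
  rcases neg_one_pow_eq_or ℝ (∑ p ∈ c, τ p) with e1 | e1 <;>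
  rcases neg_one_pow_eq_or ℝ (∑ p ∈ d, τ p) with e2 | e2 <;>
  by_cases h1 : Odd (M ∩ c).card <;> by_cases h2 : Odd (M ∩ d).card <;>
    simp [h1, h2, e1, e2] <;> linarith

theorem degOn_split (M : Finset P) {t : ℝ} (ht : t ∈ Set.Icc (0 : ℝ) 2) (τ τ' : P → ℕ)
    {c d : Finset P} (h : Disjoint c d)
    (hs : (-1 : ℝ) ^ (∑ p ∈ c, τ' p) * (-1) ^ (∑ p ∈ d, τ' p) =
      - ((-1) ^ (∑ p ∈ c, τ p) * (-1) ^ (∑ p ∈ d, τ p))) :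
    degOn M t τ (c ∪ d) - 1 ≤ degOn M t τ' c + degOn M t τ' d := by
  obtain ⟨h0, h2⟩ := ht
  rw [degOn_union M t τ h, ← neg_eq_iff_eq_neg.2 hs]
  unfold degOn
  rcases neg_one_pow_eq_or ℝ (∑ p ∈ c, τ' p) with e1 | e1 <;>
  rcases neg_one_pow_eq_or ℝ (∑ p ∈ d, τ' p) with e2 | e2 <;>
  by_cases h1 : Odd (M ∩ c).card <;> by_cases h2 : Odd (M ∩ d).card <;>
    simp [h1, h2, e1, e2] <;> linarith

theorem degOn_congr (M : Finset P) (t : ℝ) {τ τ' : P → ℕ} {c : Finset P}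
    (h : ∀ p ∈ c, τ p = τ' p) : degOn M t τ c = degOn M t τ' c := by
  unfold degOn
  rw [Finset.sum_congr rfl h]

theorem not_mem_of_mem_orbs {π : Perm P} {x : P} {c : Finset P} (hc : c ∈ orbs π)
    (hx : c ≠ orb π x) : x ∉ c := fun h => hx (eq_orb_of_mem hc h)

theorem wt_merge {M : Finset P} {t : ℝ} (ht : t ∈ Set.Icc (0 : ℝ) 2) {π : Perm P} {x y : P}
    (h : ¬ π.SameCycle x y) (τ : P → ℕ) :
    wt M t π τ - 1 ≤ wt M t (π * swap x y) τ := by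
  obtain ⟨r, h1, h2, -⟩ := sum_orbs_mul_swap h (degOn M t τ)
  unfold wt
  rw [h1, h2]
  linarith [degOn_merge M ht τ (disjoint_orb h)]

theorem wt_split {M : Finset P} {t : ℝ} (ht : t ∈ Set.Icc (0 : ℝ) 2) {π : Perm P} {x y z : P}
    (h : ¬ π.SameCycle x y) (hz : z = x ∨ z = y) (τ : P → ℕ) :
    wt M t (π * swap x y) τ - 1 ≤ wt M t π (τ + Pi.single z 1) := by
  obtain ⟨r, h1, h2, hr⟩ := sum_orbs_mul_swap h (degOn M t τ)
  obtain ⟨r', h1', h2', hr'⟩ := sum_orbs_mul_swap h (degOn M t (τ + Pi.single z 1))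
  have hz' : z ∈ orb π x ∪ orb π y := by
    rcases hz with rfl | rfl <;> simp [Equiv.Perm.SameCycle.refl]
  have hrr : r = r' := by
    rw [hr, hr']
    refine Finset.sum_congr rfl fun c hc => degOn_congr _ _ fun p hp => ?_
    simp only [Finset.mem_erase] at hc
    have : p ≠ z := by
      rintro rfl
      rcases hz with rfl | rfl
      · exact not_mem_of_mem_orbs hc.2.2 hc.2.1 hp
      · exact not_mem_of_mem_orbs hc.2.2 hc.1 hp
    simp [this]
  unfold wt
  rw [h2, h1', hrr]
  have := degOn_split M ht τ (τ + Pi.single z 1) (disjoint_orb h) (by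
    rw [← pow_add, ← pow_add, ← Finset.sum_union (disjoint_orb h),
      ← Finset.sum_union (disjoint_orb h)]
    simp only [Pi.add_apply, Finset.sum_add_distrib]
    rw [Finset.sum_pi_single', if_pos hz', pow_succ]
    ring)
  linarith

theorem nrm_mul_swap {π : Perm P} {x y : P} (h : ¬ π.SameCycle x y) {ε : P → Bool}
    (hε : Inv π ε) (hxy : ε x = ε y) : nrm (π * swap x y) ε = nu (ε x) * nrm π ε := by
  obtain ⟨r, h1, h2, -⟩ := prod_orbs_mul_swap h fun c => (nu (colOf c ε))⁻¹
  unfold nrm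
  rw [h1, h2, colOf_orb hε, colOf_orb hε, ← hxy]
  have : colOf (orb π x ∪ orb π y) ε = ε x := by
    refine colOf_eq (by simp [Equiv.Perm.SameCycle.refl]) fun q hq => ?_
    rcases Finset.mem_union.1 hq with hq | hq
    · exact (hε.sameCycle (by simpa using hq)).symm
    · rw [hxy]; exact (hε.sameCycle (by simpa using hq)).symm
  rw [this]
  field_simp [nu_ne_zero]

theorem mono_mul_swap_of_not {π : Perm P} {x y : P} (h : ¬ π.SameCycle x y) (τ : P → ℕ)
    {ε : P → Bool} (hε : Inv (π * swap x y) ε) :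
    nu (ε x) * mono π τ ε = mono (π * swap x y) τ ε := by
  have hxy := hε.sameCycle (sameCycle_mul_swap h)
  unfold mono
  rw [nrm_mul_swap h (hε.of_mul_swap hxy) hxy]
  ring

theorem prod_sg_single (τ : P → ℕ) (z : P) (k : ℕ) (ε : P → Bool) :
    ∏ p, sg (ε p) ^ (τ + Pi.single z k : P → ℕ) p = sg (ε z) ^ k * ∏ p, sg (ε p) ^ τ p := by
  simp only [Pi.add_apply, pow_add, Finset.prod_mul_distrib]
  rw [mul_comm]
  congr 1
  rw [Finset.prod_eq_single z] <;> simp +contextual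

theorem mono_mul_swap_of_sameCycle {π : Perm P} {x y : P} (hne : x ≠ y) (h : π.SameCycle x y)
    (τ : P → ℕ) {ε : P → Bool} (hε : Inv (π * swap x y) ε) :
    (if ε x = ε y then nu (ε x) else 0) * mono π τ ε =
      mono (π * swap x y) (τ + Pi.single x 1) ε + mono (π * swap x y) (τ + Pi.single y 1) ε := by
  unfold mono
  rw [prod_sg_single, prod_sg_single, pow_one, pow_one]
  split_ifs with hxy
  · have := nrm_mul_swap (not_sameCycle_mul_swap h hne) hε hxy
    rw [mul_swap_mul_swap] at this
    rw [this, ← hxy]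
    linear_combination ((∏ p, sg (ε p) ^ τ p) * nrm (π * swap x y) ε) * nu_mul_self (ε x)
  · have : sg (ε x) + sg (ε y) = 0 := by
      cases hx : ε x <;> cases hy : ε y <;> simp_all [sg]
    linear_combination (-(∏ p, sg (ε p) ^ τ p) * nrm (π * swap x y) ε) * this

/-- A saddle is filtered of degree `-1`. -/
theorem saddle_mem_Fil {M : Finset P} {t a : ℝ} (ht : t ∈ Set.Icc (0 : ℝ) 2) {π : Perm P}
    {x y : P} (hne : x ≠ y) {f : (P → Bool) → ℂ} (hf : f ∈ Fil M t π a) :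
    wop (fun ε => if ε x = ε y then nu (ε x) else 0) id f ∈ Fil M t (π * swap x y) (a - 1) := by
  refine map_mem_Fil _ (fun f g hfg ε hε => ?_) (fun τ hτ => ?_) hf
  · simp only [wop_apply, id]
    split_ifs with hxy
    · rw [hfg ε (hε.of_mul_swap hxy)]
    · simp
  · by_cases h : π.SameCycle x y
    · have hns := not_sameCycle_mul_swap h hne
      have hw : ∀ z, z = x ∨ z = y → a - 1 ≤ wt M t (π * swap x y) (τ + Pi.single z 1) :=
        fun z hz => by
          have := wt_split (M := M) ht hns hz τ
          rw [mul_swap_mul_swap] at this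
          linarith
      refine Fil_congr (add_mem
        (mem_Fil_of 1 (τ + Pi.single x 1) (fun _ => hw x (Or.inl rfl)) fun ε _ => rfl)
        (mem_Fil_of 1 (τ + Pi.single y 1) (fun _ => hw y (Or.inr rfl)) fun ε _ => rfl)) ?_
      intro ε hε
      simp only [wop_apply, id, Pi.add_apply, one_mul]
      exact mono_mul_swap_of_sameCycle hne h τ hε
    · refine mem_Fil_of 1 τ (fun _ => ?_) fun ε hε => ?_
      · linarith [wt_merge (M := M) ht h τ]
      · rw [wop_apply, id, if_pos (hε.sameCycle (sameCycle_mul_swap h)), one_mul,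
          mono_mul_swap_of_not h τ hε]

end Filtration

section Bubble

variable {P : Type*} [DecidableEq P] [Fintype P]

theorem nrm_recolour {π : Perm P} {x y : P} (h : ¬ π.SameCycle x y) {o : Bool} {ε ε' : P → Bool}
    (hε : Inv (π * swap x y) ε) (hε' : ∀ p, ε' p = if p ∈ orb π x then o else ε p) :
    nrm π ε' = (nu o)⁻¹ * nrm (π * swap x y) ε := by
  obtain ⟨r, h1, -, hr⟩ := prod_orbs_mul_swap h fun c => (nu (colOf c ε'))⁻¹
  obtain ⟨r', -, h2', hr'⟩ := prod_orbs_mul_swap h fun c => (nu (colOf c ε))⁻¹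
  have hxy := hε.sameCycle (sameCycle_mul_swap h)
  have hπ := hε.of_mul_swap hxy
  have hdis := disjoint_orb h
  have hrr : r = r' := by
    rw [hr, hr']
    refine Finset.prod_congr rfl fun c hc => ?_
    simp only [Finset.mem_erase] at hc
    unfold colOf
    congr 3
    refine propext (exists_congr fun p => and_congr_right fun hp => ?_)
    rw [hε' p, if_neg]
    intro hpx
    exact hc.2.1 ((eq_orb_of_mem hc.2.2 hp).trans (orb_eq_iff.2 (by simpa using hpx)).symm)
  have e1 : colOf (orb π x) ε' = o := by
    have hx : x ∈ orb π x := by simp [Equiv.Perm.SameCycle.refl]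
    rw [colOf_eq hx fun q hq => by rw [hε' q, hε' x, if_pos hq, if_pos hx], hε' x, if_pos hx]
  have hy : y ∈ orb π y := by simp [Equiv.Perm.SameCycle.refl]
  have e2 : colOf (orb π y) ε' = ε y := by
    have hoff : ∀ q ∈ orb π y, ε' q = ε q := fun q hq => by
      rw [hε' q, if_neg (Finset.disjoint_right.1 hdis hq)]
    rw [colOf_eq hy fun q hq => ?_, hoff y hy]
    rw [hoff q hq, hoff y hy]
    exact (hπ.sameCycle (by simpa using hq)).symm
  have e3 : colOf (orb π x ∪ orb π y) ε = ε y := by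
    refine colOf_eq (Finset.mem_union_right _ hy) fun q hq => ?_
    rcases Finset.mem_union.1 hq with hq | hq
    · rw [← hxy]; exact (hπ.sameCycle (by simpa using hq)).symm
    · exact (hπ.sameCycle (by simpa using hq)).symm
  unfold nrm
  rw [h1, h2', e1, e2, e3, hrr]
  ring

theorem prod_sg_recolour (τ : P → ℕ) (O : Finset P) {o : Bool} {ε ε' : P → Bool}
    (hε' : ∀ p, ε' p = if p ∈ O then o else ε p) :
    ∏ p, sg (ε' p) ^ τ p =
      sg o ^ (∑ p ∈ O, τ p) * ∏ p, sg (ε p) ^ (if p ∈ O then 0 else τ p) := by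
  have e : ∏ p ∈ O, sg o ^ τ p = ∏ p, if p ∈ O then sg o ^ τ p else 1 := by
    rw [Finset.prod_ite_mem, Finset.univ_inter]
  rw [← Finset.prod_pow_eq_pow_sum, e, ← Finset.prod_mul_distrib]
  refine Finset.prod_congr rfl fun p _ => ?_
  rw [hε' p]
  split_ifs <;> simp

/-- Introducing a circle labelled `v₊` is filtered of degree `1`. -/
theorem birth_mem_Fil {M : Finset P} {t a : ℝ} {π : Perm P} {x y : P} (h : ¬ π.SameCycle x y)
    (hM : Disjoint M (orb π x)) {ρ : (P → Bool) → (P → Bool)}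
    (hρ : ∀ ε, Inv π ε → ∀ p, ρ ε p = if p ∈ orb π x then ε y else ε p)
    {f : (P → Bool) → ℂ} (hf : f ∈ Fil M t (π * swap x y) a) :
    wop (fun ε => (nu (ε x))⁻¹) ρ f ∈ Fil M t π (a + 1) := by
  have hx : x ∈ orb π x := by simp [Equiv.Perm.SameCycle.refl]
  have hy : y ∉ orb π x := by simpa using h
  have hρI : ∀ ε, Inv π ε → Inv (π * swap x y) (ρ ε) := fun ε hε => by
    refine Inv.mul_swap (fun p => ?_) ?_
    · rw [hρ ε hε, hρ ε hε, hε]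
      simp
    · rw [hρ ε hε, hρ ε hε, if_pos hx, if_neg hy]
  refine map_mem_Fil _ (fun f g hfg ε hε => ?_) (fun τ hτ => ?_) hf
  · simp only [wop_apply]
    rw [hfg _ (hρI ε hε)]
  · set k := ∑ p ∈ orb π x, τ p
    set τ₀ : P → ℕ := fun p => if p ∈ orb π x then 0 else τ p
    refine mem_Fil_of 1 (τ₀ + Pi.single y k) (fun _ => ?_) fun ε hε => ?_
    · obtain ⟨r, -, h2, hr⟩ := sum_orbs_mul_swap h (degOn M t τ)
      obtain ⟨r', h1', -, hr'⟩ := sum_orbs_mul_swap h (degOn M t (τ₀ + Pi.single y k))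
      have hrr : r = r' := by
        rw [hr, hr']
        refine Finset.sum_congr rfl fun c hc => degOn_congr _ _ fun p hp => ?_
        simp only [Finset.mem_erase] at hc
        have h1 : p ≠ y := by
          rintro rfl
          exact not_mem_of_mem_orbs hc.2.2 hc.1 hp
        have h2 : p ∉ orb π x := fun hpx =>
          hc.2.1 ((eq_orb_of_mem hc.2.2 hp).trans (orb_eq_iff.2 (by simpa using hpx)).symm)
        simp only [Pi.add_apply, τ₀, if_neg h2, Pi.single_apply, if_neg h1, add_zero]
      have e1 : degOn M t (τ₀ + Pi.single y k) (orb π x) = 1 := by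
        unfold degOn
        rw [Finset.disjoint_iff_inter_eq_empty.1 hM, Finset.sum_eq_zero]
        · simp
        · intro p hp
          have : p ≠ y := by rintro rfl; exact hy hp
          simp only [Pi.add_apply, τ₀, if_pos hp, Pi.single_apply, if_neg this, add_zero]
      have e2 : degOn M t (τ₀ + Pi.single y k) (orb π y) = degOn M t τ (orb π x ∪ orb π y) := by
        unfold degOn
        have hs : ∑ p ∈ orb π y, (τ₀ + Pi.single y k : P → ℕ) p =
            ∑ p ∈ orb π x ∪ orb π y, τ p := by
          simp only [Pi.add_apply, Finset.sum_add_distrib]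
          rw [Finset.sum_pi_single', if_pos (by simp [Equiv.Perm.SameCycle.refl]),
            Finset.sum_union (disjoint_orb h), add_comm]
          congr 1
          refine Finset.sum_congr rfl fun p hp => ?_
          simp only [τ₀]
          rw [if_neg (Finset.disjoint_right.1 (disjoint_orb h) hp)]
        rw [hs, Finset.inter_union_distrib_left, Finset.disjoint_iff_inter_eq_empty.1 hM,
          Finset.empty_union]
      unfold wt at hτ ⊢
      rw [h1', e1, e2, ← hrr]
      rw [h2] at hτ
      linarith
    · rw [wop_apply, one_mul]
      unfold mono
      rw [prod_sg_single, prod_sg_recolour τ (orb π x) (hρ ε hε)]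
      have := nrm_recolour h (hρI ε hε) (o := ε x) (ε' := ε) fun p => by
        rw [hρ ε hε]
        split_ifs with hp
        · exact (hε.sameCycle (by simpa using hp)).symm
        · rfl
      rw [this]
      ring

/-- Removing a circle is filtered of degree `1`; it kills `v₊`. -/
theorem death_mem_Fil {M : Finset P} {t a : ℝ} {π : Perm P} {x y : P} (h : ¬ π.SameCycle x y)
    (hM : Disjoint M (orb π x)) {ρ : Bool → (P → Bool) → (P → Bool)}
    (hρ : ∀ ε, Inv (π * swap x y) ε → ∀ o p, ρ o ε p = if p ∈ orb π x then o else ε p)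
    {f : (P → Bool) → ℂ} (hf : f ∈ Fil M t π a) :
    (wop (fun _ => (nu true)⁻¹) (ρ true) + wop (fun _ => (nu false)⁻¹) (ρ false)) f ∈
      Fil M t (π * swap x y) (a + 1) := by
  have hy : y ∉ orb π x := by simpa using h
  have hρI : ∀ ε, Inv (π * swap x y) ε → ∀ o, Inv π (ρ o ε) := fun ε hε o p => by
    rw [hρ ε hε, hρ ε hε, hε.of_mul_swap (hε.sameCycle (sameCycle_mul_swap h)) p]
    simp
  refine map_mem_Fil _ (fun f g hfg ε hε => ?_) (fun τ hτ => ?_) hf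
  · simp only [wop_apply, LinearMap.add_apply, Pi.add_apply]
    rw [hfg _ (hρI ε hε true), hfg _ (hρI ε hε false)]
  · set k := ∑ p ∈ orb π x, τ p with hk
    set τ₀ : P → ℕ := fun p => if p ∈ orb π x then 0 else τ p
    refine mem_Fil_of (if Odd k then 1 else 0) τ₀ (fun hne => ?_) fun ε hε => ?_
    · have hodd : Odd k := by by_contra hk; exact hne (if_neg hk)
      obtain ⟨r, h1, -, hr⟩ := sum_orbs_mul_swap h (degOn M t τ)
      obtain ⟨r', -, h2', hr'⟩ := sum_orbs_mul_swap h (degOn M t τ₀)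
      have hrr : r = r' := by
        rw [hr, hr']
        refine Finset.sum_congr rfl fun c hc => degOn_congr _ _ fun p hp => ?_
        simp only [Finset.mem_erase] at hc
        have h2 : p ∉ orb π x := fun hpx =>
          hc.2.1 ((eq_orb_of_mem hc.2.2 hp).trans (orb_eq_iff.2 (by simpa using hpx)).symm)
        simp only [τ₀, if_neg h2]
      have e1 : degOn M t τ (orb π x) = -1 := by
        unfold degOn
        rw [Finset.disjoint_iff_inter_eq_empty.1 hM, ← hk, hodd.neg_one_pow]
        simp
      have e2 : degOn M t τ₀ (orb π x ∪ orb π y) = degOn M t τ (orb π y) := by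
        unfold degOn
        have hs : ∑ p ∈ orb π x ∪ orb π y, τ₀ p = ∑ p ∈ orb π y, τ p := by
          rw [Finset.sum_union (disjoint_orb h), Finset.sum_eq_zero, zero_add]
          · refine Finset.sum_congr rfl fun p hp => ?_
            simp only [τ₀]
            rw [if_neg (Finset.disjoint_right.1 (disjoint_orb h) hp)]
          · intro p hp
            simp only [τ₀, if_pos hp]
        rw [hs, Finset.inter_union_distrib_left, Finset.disjoint_iff_inter_eq_empty.1 hM,
          Finset.empty_union]
      unfold wt at hτ ⊢
      rw [h2', e2, ← hrr]
      rw [h1, e1] at hτ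
      linarith
    · simp only [wop_apply, LinearMap.add_apply, Pi.add_apply]
      unfold mono
      rw [nrm_recolour h hε (hρ ε hε true), nrm_recolour h hε (hρ ε hε false),
        prod_sg_recolour τ (orb π x) (hρ ε hε true), prod_sg_recolour τ (orb π x) (hρ ε hε false),
        ← hk]
      have key : (nu true)⁻¹ * (sg true ^ k * (nu true)⁻¹) + (nu false)⁻¹ * (sg false ^ k * (nu false)⁻¹)
          = if Odd k then 1 else 0 := by
        have e : ∀ b, (nu b)⁻¹ * (sg b ^ k * (nu b)⁻¹) = sg b ^ k * sg b / 2 := fun b => by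
          have h1 := nu_mul_self b
          have h2 := sg_mul_self b
          have h3 := nu_ne_zero b
          have h4 := sg_ne_zero b
          field_simp
          rw [sq, h1]
          linear_combination (-2) * h2
        rw [e, e]
        split_ifs with hodd
        · norm_num [sg, hodd.neg_one_pow]
        · norm_num [sg, (Nat.not_odd_iff_even.1 hodd).neg_one_pow]
      rw [← key]
      ring

end Bubble

section Reindex

variable {P Q : Type*} [DecidableEq P] [Fintype P] [DecidableEq Q] [Fintype Q]

/-- Maps between the marked points of two diagrams that induce mutually inverse maps between the
circles and are bijective on the points of `γ`. -/
structure Isotopy (M : Finset P) (π : Perm P) (M' : Finset Q) (π' : Perm Q) (F : P → Q)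
    (G : Q → P) : Prop where
  inv_comp_F : ∀ ε, Inv π' ε → Inv π (ε ∘ F)
  inv_comp_G : ∀ ε, Inv π ε → Inv π' (ε ∘ G)
  GF : ∀ ε, Inv π ε → ∀ p, ε (G (F p)) = ε p
  FG : ∀ ε, Inv π' ε → ∀ q, ε (F (G q)) = ε q
  bijOn : Set.BijOn F M M'

variable {M : Finset P} {π : Perm P} {M' : Finset Q} {π' : Perm Q} {F : P → Q} {G : Q → P}

/-- The preimage of a set of points. -/
def pre (F : P → Q) (c : Finset Q) : Finset P := Finset.univ.filter fun p => F p ∈ c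

@[simp] theorem mem_pre {c : Finset Q} {p : P} : p ∈ pre F c ↔ F p ∈ c := by simp [pre]

theorem Isotopy.sameCycle_F (h : Isotopy M π M' π' F G) {p q : P} (hpq : π.SameCycle p q) :
    π'.SameCycle (F p) (F q) :=
  sameCycle_iff.2 fun ε hε => (h.inv_comp_F ε hε).sameCycle hpq

theorem Isotopy.sameCycle_G (h : Isotopy M π M' π' F G) {p q : Q} (hpq : π'.SameCycle p q) :
    π.SameCycle (G p) (G q) :=
  sameCycle_iff.2 fun ε hε => (h.inv_comp_G ε hε).sameCycle hpq

theorem Isotopy.sameCycle_GF (h : Isotopy M π M' π' F G) (p : P) : π.SameCycle (G (F p)) p :=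
  sameCycle_iff.2 fun ε hε => h.GF ε hε p

theorem Isotopy.sameCycle_FG (h : Isotopy M π M' π' F G) (q : Q) : π'.SameCycle (F (G q)) q :=
  sameCycle_iff.2 fun ε hε => h.FG ε hε q

theorem Isotopy.pre_orb (h : Isotopy M π M' π' F G) (q : Q) :
    pre F (orb π' q) = orb π (G q) := by
  ext p
  simp only [mem_pre, mem_orb]
  exact ⟨fun hq => (h.sameCycle_G hq).trans (h.sameCycle_GF p),
    fun hp => (h.sameCycle_FG q).symm.trans (h.sameCycle_F hp)⟩

theorem Isotopy.orb_F (h : Isotopy M π M' π' F G) (p : P) :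
    pre F (orb π' (F p)) = orb π p := by
  rw [h.pre_orb, orb_eq_iff]
  exact h.sameCycle_GF p

@[to_additive]
theorem Isotopy.prod_orbs {R : Type*} [CommMonoid R] (h : Isotopy M π M' π' F G)
    (A : Finset P → R) : ∏ c ∈ orbs π, A c = ∏ c ∈ orbs π', A (pre F c) := by
  symm
  refine Finset.prod_bij (fun c _ => pre F c) (fun c hc => ?_) (fun c hc d hd hcd => ?_)
    (fun c hc => ?_) fun c hc => rfl
  · obtain ⟨q, rfl⟩ := mem_orbs.1 hc
    rw [h.pre_orb]
    exact orb_mem_orbs _ _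
  · obtain ⟨q, rfl⟩ := mem_orbs.1 hc
    obtain ⟨r, rfl⟩ := mem_orbs.1 hd
    rw [h.pre_orb, h.pre_orb, orb_eq_iff] at hcd
    rw [orb_eq_iff]
    exact (h.sameCycle_FG q).symm.trans ((h.sameCycle_F hcd).trans (h.sameCycle_FG r))
  · obtain ⟨p, rfl⟩ := mem_orbs.1 hc
    exact ⟨orb π' (F p), orb_mem_orbs _ _, h.orb_F p⟩

/-- An isotopy is filtered of degree `0`. -/
theorem Isotopy.mem_Fil (h : Isotopy M π M' π' F G) {t a : ℝ} {f : (P → Bool) → ℂ}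
    (hf : f ∈ Fil M t π a) : wop (fun _ => 1) (fun ε => ε ∘ F) f ∈ Fil M' t π' a := by
  refine map_mem_Fil _ (fun f g hfg ε hε => ?_) (fun τ hτ => ?_) hf
  · simp only [wop_apply]
    rw [hfg _ (h.inv_comp_F ε hε)]
  · have hsum : ∀ c : Finset Q, ∑ q ∈ c, (∑ p with F p = q, τ p) = ∑ p ∈ pre F c, τ p := fun c => by
      rw [← Finset.sum_fiberwise_of_maps_to (s := pre F c) (t := c) (g := F) (fun p hp => by
        simpa using hp)]
      refine Finset.sum_congr rfl fun q hq => Finset.sum_congr ?_ fun _ _ => rfl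
      ext p
      simp only [Finset.mem_filter, Finset.mem_univ, true_and, mem_pre]
      exact ⟨fun hp => ⟨hp ▸ hq, hp⟩, fun hp => hp.2⟩
    refine mem_Fil_of 1 (fun q => ∑ p with F p = q, τ p) (fun _ => ?_) fun ε hε => ?_
    · refine hτ.trans (le_of_eq ?_)
      unfold wt
      rw [h.sum_orbs]
      refine Finset.sum_congr rfl fun c _ => ?_
      unfold degOn
      rw [hsum]
      have : (M ∩ pre F c).card = (M' ∩ c).card := by
        refine Finset.card_bij (fun p _ => F p) (fun p hp => ?_) (fun p hp q hq hpq => ?_)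
          fun q hq => ?_
        · simp only [Finset.mem_inter, mem_pre] at hp ⊢
          exact ⟨h.bijOn.mapsTo hp.1, hp.2⟩
        · exact h.bijOn.injOn (Finset.mem_inter.1 hp).1 (Finset.mem_inter.1 hq).1 hpq
        · obtain ⟨hq1, hq2⟩ := Finset.mem_inter.1 hq
          obtain ⟨p, hp, rfl⟩ := h.bijOn.surjOn hq1
          exact ⟨p, by simpa using ⟨hp, hq2⟩, rfl⟩
      rw [this]
    · rw [wop_apply, one_mul, one_mul]
      unfold mono
      congr 1
      · simp only [← Finset.prod_pow_eq_pow_sum]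
        rw [← Finset.prod_fiberwise (s := Finset.univ) F]
        refine Finset.prod_congr rfl fun q _ => Finset.prod_congr rfl fun p hp => ?_
        rw [Function.comp_apply, (Finset.mem_filter.1 hp).2]
      · unfold nrm
        rw [h.prod_orbs]
        refine Finset.prod_congr rfl fun c hc => ?_
        obtain ⟨q, rfl⟩ := mem_orbs.1 hc
        rw [colOf_orb hε, h.pre_orb, colOf_orb (h.inv_comp_F ε hε), Function.comp_apply,
          h.FG ε hε]

end Reindex

section Multiplication

variable {P : Type*} [DecidableEq P] [Fintype P]

theorem wt_single {M : Finset P} {t : ℝ} (ht : t ∈ Set.Icc (0 : ℝ) 2) (π : Perm P) (z : P)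
    (τ : P → ℕ) : wt M t π τ - 2 ≤ wt M t π (τ + Pi.single z 1) := by
  obtain ⟨h0, h2⟩ := ht
  unfold wt
  rw [← Finset.add_sum_erase _ _ (orb_mem_orbs π z), ← Finset.add_sum_erase _ _ (orb_mem_orbs π z)]
  have h1 : ∑ c ∈ (orbs π).erase (orb π z), degOn M t (τ + Pi.single z 1) c =
      ∑ c ∈ (orbs π).erase (orb π z), degOn M t τ c := by
    refine Finset.sum_congr rfl fun c hc => degOn_congr _ _ fun p hp => ?_
    rw [Finset.mem_erase] at hc
    have : p ≠ z := by
      rintro rfl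
      exact not_mem_of_mem_orbs hc.2 hc.1 hp
    simp [this]
  have h3 : degOn M t τ (orb π z) - 2 ≤ degOn M t (τ + Pi.single z 1) (orb π z) := by
    have hs : ∑ p ∈ orb π z, (τ + Pi.single z 1 : P → ℕ) p = ∑ p ∈ orb π z, τ p + 1 := by
      simp only [Pi.add_apply, Finset.sum_add_distrib]
      rw [Finset.sum_pi_single', if_pos (mem_orb.2 (Equiv.Perm.SameCycle.refl π z))]
    unfold degOn
    rw [hs, pow_succ]
    rcases neg_one_pow_eq_or ℝ (∑ p ∈ orb π z, τ p) with e | e <;> rw [e] <;> split_ifs <;> linarith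
  rw [h1]
  linarith

/-- Multiplication by `v₋` at a point is filtered of degree `-2`. -/
theorem mul_sg_mem_Fil {M : Finset P} {t a : ℝ} (ht : t ∈ Set.Icc (0 : ℝ) 2) {π : Perm P} (z : P)
    {f : (P → Bool) → ℂ} (hf : f ∈ Fil M t π a) :
    wop (fun ε => sg (ε z)) id f ∈ Fil M t π (a - 2) := by
  refine map_mem_Fil _ (fun f g hfg ε hε => ?_) (fun τ hτ => ?_) hf
  · simp only [wop_apply, id]
    rw [hfg ε hε]
  · refine mem_Fil_of 1 (τ + Pi.single z 1) (fun _ => ?_) fun ε hε => ?_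
    · linarith [wt_single (M := M) ht π z τ]
    · rw [wop_apply, id, one_mul]
      unfold mono
      rw [prod_sg_single, pow_one, mul_assoc]

end Multiplication

section Shapes

variable {N n : ℕ}

/-- The marked points of a diagram with `N` layers: (height, position). -/
abbrev Point (N n : ℕ) : Type := Fin (N + 1) × Fin n

/-- A flat diagram: each layer is the identity or a cup and a cap. -/
abbrev Shape (N n : ℕ) : Type := Fin N → Option (Fin (n - 1))

/-- The colours at one height. -/
abbrev Row (n : ℕ) : Type := Fin n → Bool

/-- The colours at height `h`. -/
def row (ε : Point N n → Bool) (h : Fin (N + 1)) : Row n := fun p => ε (h, p)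

/-- The colours below and above a layer are compatible with it. -/
def LayerOK : Option (Fin (n - 1)) → Row n → Row n → Prop
  | none, X, Y => X = Y
  | some i, X, Y => X (leftPos i) = X (rightPos i) ∧ Y (leftPos i) = Y (rightPos i) ∧
      ∀ p, p ≠ leftPos i → p ≠ rightPos i → X p = Y p

/-- The colouring is constant on the circles of the closure of `u`. -/
def Col (u : Shape N n) (ε : Point N n → Bool) : Prop :=
  (∀ l : Fin N, LayerOK (u l) (row ε l.castSucc) (row ε l.succ)) ∧ row ε (Fin.last N) = row ε 0

theorem leftPos_ne_rightPos (i : Fin (n - 1)) : leftPos i ≠ rightPos i := by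
  simp [leftPos, rightPos]

theorem even_rightPos (i : Fin (n - 1)) :
    Even (rightPos i : ℕ) ↔ ¬ Even (leftPos i : ℕ) := by
  simp [leftPos, rightPos, Nat.even_add_one]

/-- The exchange of positions in a layer. -/
def layerSwap (o : Option (Fin (n - 1))) : Perm (Fin n) :=
  o.elim 1 fun i => swap (leftPos i) (rightPos i)

/-- Points by the layer in which the circles leave them, when even positions are oriented upwards
and odd positions downwards; the last layer closes the diagram. -/
def outPt (N n : ℕ) : Perm (Point N n) where
  toFun q := (if Even (q.2 : ℕ) then q.1 else finRotate (N + 1) q.1, q.2)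
  invFun q := (if Even (q.2 : ℕ) then q.1 else (finRotate (N + 1)).symm q.1, q.2)
  left_inv q := by by_cases h : Even (q.2 : ℕ) <;> simp [h]
  right_inv q := by by_cases h : Even (q.2 : ℕ) <;> simp [h]

/-- Points by the layer through which the circles reach them. -/
def inPt (N n : ℕ) : Perm (Point N n) where
  toFun q := (if Even (q.2 : ℕ) then finRotate (N + 1) q.1 else q.1, q.2)
  invFun q := (if Even (q.2 : ℕ) then (finRotate (N + 1)).symm q.1 else q.1, q.2)
  left_inv q := by by_cases h : Even (q.2 : ℕ) <;> simp [h]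
  right_inv q := by by_cases h : Even (q.2 : ℕ) <;> simp [h]

/-- The shape with the closing layer added. -/
def closeUp (u : Shape N n) (l : Fin (N + 1)) : Option (Fin (n - 1)) :=
  Fin.lastCases (motive := fun _ => Option (Fin (n - 1))) none u l

/-- The exchange of positions in all layers. -/
def layerPerm (u : Shape N n) : Perm (Point N n) where
  toFun q := (q.1, layerSwap (closeUp u q.1) q.2)
  invFun q := (q.1, (layerSwap (closeUp u q.1)).symm q.2)
  left_inv q := by simp
  right_inv q := by simp

/-- The permutation of the marked points whose cycles are the circles of the closure of `u`. -/
def circPerm (u : Shape N n) : Perm (Point N n) := inPt N n * layerPerm u * (outPt N n)⁻¹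

@[simp] theorem layerSwap_none : layerSwap (none : Option (Fin (n - 1))) = 1 := rfl

@[simp] theorem layerSwap_some (i : Fin (n - 1)) :
    layerSwap (some i) = swap (leftPos i) (rightPos i) := rfl

/-- The colour in one row at even positions, and in another one at odd positions. -/
def pick (X Y : Row n) (p : Fin n) : Bool := if Even (p : ℕ) then X p else Y p

theorem pick_eq_iff {X Y : Row n} {p : Fin n} : pick Y X p = pick X Y p ↔ X p = Y p := by
  unfold pick
  split_ifs
  · exact eq_comm
  · rfl

theorem layerOK_iff (o : Option (Fin (n - 1))) (X Y : Row n) :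
    LayerOK o X Y ↔ ∀ p, pick Y X (layerSwap o p) = pick X Y p := by
  cases o with
  | none =>
    simp only [LayerOK, layerSwap_none, Perm.coe_one, id, pick_eq_iff]
    exact funext_iff
  | some i =>
    simp only [LayerOK, layerSwap_some]
    have hl := even_rightPos i
    constructor
    · rintro ⟨h1, h2, h3⟩ p
      by_cases hpl : p = leftPos i
      · subst hpl
        by_cases he : Even (leftPos i : ℕ) <;> simp [pick, he, hl, h1, h2]
      by_cases hpr : p = rightPos i
      · subst hpr
        by_cases he : Even (leftPos i : ℕ) <;> simp [pick, he, hl, h1, h2]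
      rw [Equiv.swap_apply_of_ne_of_ne hpl hpr, pick_eq_iff, h3 p hpl hpr]
    · intro h
      have h1 := h (leftPos i)
      have h2 := h (rightPos i)
      rw [Equiv.swap_apply_left] at h1
      rw [Equiv.swap_apply_right] at h2
      unfold pick at h1 h2
      simp only [hl] at h1 h2
      refine ⟨?_, ?_, fun p hpl hpr => ?_⟩
      · by_cases he : Even (leftPos i : ℕ) <;> simp_all
      · by_cases he : Even (leftPos i : ℕ) <;> simp_all
      · have h3 := h p
        rwa [Equiv.swap_apply_of_ne_of_ne hpl hpr, pick_eq_iff] at h3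

theorem inv_circPerm_iff (u : Shape N n) (ε : Point N n → Bool) :
    Inv (circPerm u) ε ↔ Col u ε := by
  have h1 : Inv (circPerm u) ε ↔ ∀ q : Point N n,
      ε (inPt N n (layerPerm u q)) = ε (outPt N n q) := by
    constructor
    · intro h q
      simpa [circPerm] using h (outPt N n q)
    · intro h q
      simpa [circPerm] using h ((outPt N n)⁻¹ q)
  have h2 : ∀ (l : Fin (N + 1)), (∀ p, ε (inPt N n (layerPerm u (l, p))) = ε (outPt N n (l, p))) ↔
      LayerOK (closeUp u l) (row ε l) (row ε (finRotate (N + 1) l)) := fun l => by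
    rw [layerOK_iff]
    refine forall_congr' fun p => ?_
    simp only [inPt, outPt, layerPerm, Equiv.coe_fn_mk, row, pick]
    split_ifs <;> rfl
  rw [h1, Prod.forall]
  simp only [h2]
  rw [Fin.forall_fin_succ']
  unfold Col
  refine and_congr (forall_congr' fun l => ?_) ?_
  · have : finRotate (N + 1) l.castSucc = l.succ := by simp [finRotate_apply]
    rw [this]
    simp [closeUp]
  · rw [finRotate_last]
    simp [closeUp, LayerOK]

/-- The two points at which the circles enter the cup and the cap of a layer. -/
def outCorners (l : Fin N) (i : Fin (n - 1)) : Point N n × Point N n :=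
  (outPt N n (l.castSucc, leftPos i), outPt N n (l.castSucc, rightPos i))

theorem outCorners_eq (l : Fin N) (i : Fin (n - 1)) :
    outCorners l i = ((l.castSucc, leftPos i), (l.succ, rightPos i)) ∨
      outCorners l i = ((l.succ, leftPos i), (l.castSucc, rightPos i)) := by
  have h : finRotate (N + 1) l.castSucc = l.succ := by simp [finRotate_apply]
  unfold outCorners outPt
  simp only [Equiv.coe_fn_mk, h, even_rightPos]
  by_cases he : Even (leftPos i : ℕ) <;> simp [he]

theorem outCorners_ne (l : Fin N) (i : Fin (n - 1)) : (outCorners l i).1 ≠ (outCorners l i).2 := by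
  unfold outCorners
  intro h
  have := (outPt N n).injective h
  simp [leftPos_ne_rightPos] at this

theorem circPerm_update (u : Shape N n) (l : Fin N) (i : Fin (n - 1)) :
    circPerm (Function.update u l (some i)) =
      circPerm (Function.update u l none) * swap (outCorners l i).1 (outCorners l i).2 := by
  have hT : layerPerm (Function.update u l (some i)) = layerPerm (Function.update u l none) *
      swap (l.castSucc, leftPos i) (l.castSucc, rightPos i) := by
    ext1 ⟨h, p⟩
    rw [Equiv.Perm.mul_apply]
    by_cases hh : h = l.castSucc
    · subst hh
      have e : swap (l.castSucc, leftPos i) (l.castSucc, rightPos i) (l.castSucc, p) =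
          ((l.castSucc, swap (leftPos i) (rightPos i) p) : Point N n) := by
        simp only [Equiv.swap_apply_def, Prod.mk.injEq, true_and]
        split_ifs <;> rfl
      rw [e]
      simp [layerPerm, closeUp, layerSwap]
    · rw [Equiv.swap_apply_of_ne_of_ne (by simp [hh]) (by simp [hh])]
      simp only [layerPerm, Equiv.coe_fn_mk]
      congr 3
      induction h using Fin.lastCases with
      | last => simp [closeUp]
      | cast h =>
        have : h ≠ l := fun e => hh (by rw [e])
        simp [closeUp, this]
  unfold circPerm outCorners
  rw [hT]
  simp only [mul_assoc]
  rw [Equiv.swap_apply_apply]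
  simp [mul_assoc]

/-- The local factor of the Lee differential in the colour model. -/
def kap : Option (Fin (n - 1)) → Row n → Row n → ℂ
  | none, _, _ => 0
  | some i, X, Y => if X = Y ∧ X (leftPos i) = X (rightPos i) then nu (X (leftPos i)) else 0

theorem kap_some (i : Fin (n - 1)) (X Y : Row n) : kap (some i) X Y =
    if X = Y ∧ X (leftPos i) = X (rightPos i) then nu (X (leftPos i)) else 0 := rfl

@[simp] theorem kap_none (X Y : Row n) : kap none X Y = 0 := rfl

/-- The points on the arc `γ`. -/
def marks (N n : ℕ) : Finset (Point N n) := Finset.univ.filter fun q => q.1 = 0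

/-- The filtration on the functions of colourings of a flat diagram. -/
def FilU (t : ℝ) (u : Shape N n) (a : ℝ) : Submodule ℂ ((Point N n → Bool) → ℂ) :=
  Fil (marks N n) t (circPerm u) a

theorem FilU_congr {t a : ℝ} {u : Shape N n} {f g : (Point N n → Bool) → ℂ}
    (hf : f ∈ FilU t u a) (h : ∀ ε, Col u ε → g ε = f ε) : g ∈ FilU t u a :=
  Fil_congr hf fun ε hε => h ε ((inv_circPerm_iff u ε).1 hε)

theorem Col.layer {u : Shape N n} {ε : Point N n → Bool} (h : Col u ε) {l : Fin N}
    {o : Option (Fin (n - 1))} (ho : u l = o) : LayerOK o (row ε l.castSucc) (row ε l.succ) :=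
  ho ▸ h.1 l

theorem kap_eq {i : Fin (n - 1)} {l : Fin N} {ε : Point N n → Bool}
    (h : LayerOK none (row ε l.castSucc) (row ε l.succ) ∨
      LayerOK (some i) (row ε l.castSucc) (row ε l.succ)) :
    kap (some i) (row ε l.castSucc) (row ε l.succ) =
      if ε (outCorners l i).1 = ε (outCorners l i).2 then nu (ε (outCorners l i).1) else 0 := by
  have key : (row ε l.castSucc = row ε l.succ ∧
      row ε l.castSucc (leftPos i) = row ε l.castSucc (rightPos i)) ↔
      ε (outCorners l i).1 = ε (outCorners l i).2 := by
    rcases h with h | ⟨h1, h2, h3⟩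
    · have h' : ∀ p, ε (l.castSucc, p) = ε (l.succ, p) := fun p => congrFun h p
      have h'' : row ε l.castSucc = row ε l.succ := h
      simp only [h'', true_and]
      rcases outCorners_eq l i with e | e <;> rw [e] <;> simp only [row, h']
    · simp only [row] at h1 h2 h3
      rcases outCorners_eq l i with e | e <;> rw [e] <;> constructor
      · rintro ⟨h4, h5⟩
        exact h5.trans (congrFun h4 _)
      · intro h4
        simp only at h4
        refine ⟨funext fun p => ?_, h1⟩
        by_cases hpl : p = leftPos i
        · subst hpl; simp only [row]; rw [h4, h2]
        by_cases hpr : p = rightPos i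
        · subst hpr; simp only [row]; rw [← h1, h4]
        exact h3 p hpl hpr
      · rintro ⟨h4, h5⟩
        simp only [row] at h5
        have := congrFun h4 (leftPos i)
        simp only [row] at this
        rw [← h5, this]
      · intro h4
        simp only at h4
        refine ⟨funext fun p => ?_, h1⟩
        by_cases hpl : p = leftPos i
        · subst hpl; simp only [row]; rw [h4, h1]
        by_cases hpr : p = rightPos i
        · subst hpr; simp only [row]; rw [← h4, h2]
        exact h3 p hpl hpr
  rw [kap_some]
  by_cases hk : ε (outCorners l i).1 = ε (outCorners l i).2
  · rw [if_pos (key.2 hk), if_pos hk]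
    congr 1
    rcases outCorners_eq l i with e | e
    · rw [e]; rfl
    · rw [e]; exact congrFun (key.2 hk).1 _
  · rw [if_neg fun h' => hk (key.1 h'), if_neg hk]

theorem circPerm_update_eq (u : Shape N n) (l : Fin N) (i : Fin (n - 1))
    {o o' : Option (Fin (n - 1))} (h : (o = none ∧ o' = some i) ∨ (o = some i ∧ o' = none)) :
    circPerm (Function.update u l o') =
      circPerm (Function.update u l o) * swap (outCorners l i).1 (outCorners l i).2 := by
  rcases h with ⟨rfl, rfl⟩ | ⟨rfl, rfl⟩
  · exact circPerm_update u l i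
  · rw [circPerm_update, mul_swap_mul_swap]

/-- Changing the resolution of a layer is filtered of degree `-1`. -/
theorem saddle_mem_FilU {t a : ℝ} (ht : t ∈ Set.Icc (0 : ℝ) 2) {u u' : Shape N n} {l : Fin N}
    {i : Fin (n - 1)} (h : (u l = none ∧ u' l = some i) ∨ (u l = some i ∧ u' l = none))
    (hne : ∀ k, k ≠ l → u' k = u k) {f : (Point N n → Bool) → ℂ} (hf : f ∈ FilU t u a) :
    (fun ε => kap (some i) (row ε l.castSucc) (row ε l.succ) * f ε) ∈ FilU t u' (a - 1) := by
  have e1 : u = Function.update u l (u l) := (Function.update_eq_self l u).symm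
  have e2 : u' = Function.update u l (u' l) := by
    funext k
    by_cases hk : k = l
    · subst hk; simp
    · simp [hk, hne k hk]
  have hf' : f ∈ Fil (marks N n) t (circPerm (Function.update u l (u l))) a := by
    rw [← e1]; exact hf
  have := saddle_mem_Fil ht (outCorners_ne l i) hf'
  rw [← circPerm_update_eq u l i h, ← e2] at this
  refine FilU_congr this fun ε hε => ?_
  rw [wop_apply, id, kap_eq]
  rcases h with ⟨-, h⟩ | ⟨-, h⟩
  · exact Or.inr (hε.layer h)
  · exact Or.inl (hε.layer h)

end Shapes

section Bubbles

variable {N n : ℕ}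

/-- In the closure of `u`, the set `O` is a circle that avoids `γ` and meets the layer `l`, which is
a cup and a cap; the point `r` lies on the other circle at this layer. -/
structure IsBubble (u : Shape N n) (l : Fin N) (i : Fin (n - 1)) (O : Finset (Point N n))
    (o r : Point N n) : Prop where
  layer : u l = some i
  mem : o ∈ O
  col : Col u fun q => decide (q ∈ O)
  const : ∀ ε, Col u ε → ∀ q ∈ O, ε q = ε o
  marks : ∀ q ∈ O, q.1 ≠ 0
  side : (r = (l.castSucc, leftPos i) ∧ r ∉ O ∧ (l.succ, leftPos i) ∈ O) ∨
    (r = (l.succ, leftPos i) ∧ r ∉ O ∧ (l.castSucc, leftPos i) ∈ O)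

theorem IsBubble.exists_perm {u : Shape N n} {l : Fin N} {i : Fin (n - 1)}
    {O : Finset (Point N n)} {o r : Point N n} (h : IsBubble u l i O o r) :
    ∃ x y, ¬ (circPerm u).SameCycle x y ∧ orb (circPerm u) x = O ∧ x ∈ O ∧
      (∀ ε, Col u ε → ε y = ε r) ∧ y ∉ O ∧
      circPerm (Function.update u l none) = circPerm u * swap x y := by
  have hind : ∀ q q', (circPerm u).SameCycle q q' → (q ∈ O ↔ q' ∈ O) := fun q q' hq => by
    have := ((inv_circPerm_iff u _).2 h.col).sameCycle hq
    simpa using this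
  have horb : ∀ x ∈ O, orb (circPerm u) x = O := fun x hx => by
    ext q
    rw [mem_orb]
    refine ⟨fun hq => (hind _ _ hq).1 hx, fun hq => sameCycle_iff.2 fun ε hε => ?_⟩
    have hε' := (inv_circPerm_iff u ε).1 hε
    rw [h.const ε hε' x hx, h.const ε hε' q hq]
  have hperm : circPerm (Function.update u l none) =
      circPerm u * swap (outCorners l i).1 (outCorners l i).2 := by
    have := circPerm_update_eq u l i (o := some i) (o' := none) (Or.inr ⟨rfl, rfl⟩)
    rwa [← h.layer, Function.update_eq_self] at this
  have hlr : ∀ ε, Col u ε → ε (l.castSucc, leftPos i) = ε (l.castSucc, rightPos i) ∧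
      ε (l.succ, leftPos i) = ε (l.succ, rightPos i) := fun ε hε =>
    ⟨(hε.layer h.layer).1, (hε.layer h.layer).2.1⟩
  have hO := hlr _ h.col
  simp only [decide_eq_decide] at hO
  have key : ∀ x y, x ∈ O → y ∉ O → (∀ ε, Col u ε → ε y = ε r) →
      circPerm (Function.update u l none) = circPerm u * swap x y →
      ∃ x y, ¬ (circPerm u).SameCycle x y ∧ orb (circPerm u) x = O ∧ x ∈ O ∧
      (∀ ε, Col u ε → ε y = ε r) ∧ y ∉ O ∧
      circPerm (Function.update u l none) = circPerm u * swap x y := fun x y hx hy hr hp =>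
    ⟨x, y, fun hs => hy ((hind x y hs).1 hx), horb x hx, hx, hr, hy, hp⟩
  rcases h.side with ⟨rfl, h1, h2⟩ | ⟨rfl, h1, h2⟩
  · rcases outCorners_eq l i with e | e <;> rw [e] at hperm
    · exact key _ _ (hO.2.1 h2) h1 (fun ε _ => rfl) (by rw [hperm, Equiv.swap_comm])
    · exact key _ _ h2 (fun h' => h1 (hO.1.2 h')) (fun ε hε => (hlr ε hε).1.symm) hperm
  · rcases outCorners_eq l i with e | e <;> rw [e] at hperm
    · exact key _ _ h2 (fun h' => h1 (hO.2.2 h')) (fun ε hε => (hlr ε hε).2.symm) hperm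
    · exact key _ _ (hO.1.1 h2) h1 (fun ε _ => rfl) (by rw [hperm, Equiv.swap_comm])

theorem IsBubble.disjoint_marks {u : Shape N n} {l : Fin N} {i : Fin (n - 1)}
    {O : Finset (Point N n)} {o r : Point N n} (h : IsBubble u l i O o r) :
    Disjoint (AnnularLee.marks N n) O := by
  rw [Finset.disjoint_right]
  intro q hq hm
  exact h.marks q hq (Finset.mem_filter.1 hm).2

theorem IsBubble.birth {u : Shape N n} {l : Fin N} {i : Fin (n - 1)}
    {O : Finset (Point N n)} {o r : Point N n} (h : IsBubble u l i O o r) {u' : Shape N n}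
    (hu' : u' = Function.update u l none) {t a : ℝ}
    {ρ : (Point N n → Bool) → (Point N n → Bool)}
    (hρ : ∀ ε, Col u ε → ∀ q, ρ ε q = if q ∈ O then ε r else ε q)
    {f : (Point N n → Bool) → ℂ} (hf : f ∈ FilU t u' a) :
    (fun ε => (nu (ε o))⁻¹ * f (ρ ε)) ∈ FilU t u (a + 1) := by
  obtain ⟨x, y, hns, horb, hx, hy, -, hp⟩ := h.exists_perm
  subst hu'
  unfold FilU at hf
  rw [hp] at hf
  have := birth_mem_Fil hns (by rw [horb]; exact h.disjoint_marks) (ρ := ρ) (fun ε hε q => by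
    have hε' := (inv_circPerm_iff u ε).1 hε
    rw [hρ ε hε', horb, hy ε hε']) hf
  refine FilU_congr this fun ε hε => ?_
  rw [wop_apply, h.const ε hε x hx]

theorem IsBubble.death {u : Shape N n} {l : Fin N} {i : Fin (n - 1)}
    {O : Finset (Point N n)} {o r : Point N n} (h : IsBubble u l i O o r) {u' : Shape N n}
    (hu' : u' = Function.update u l none) {t a : ℝ}
    {ρ : Bool → (Point N n → Bool) → (Point N n → Bool)}
    (hρ : ∀ ε, Col u' ε → ∀ c q, ρ c ε q = if q ∈ O then c else ε q)
    {f : (Point N n → Bool) → ℂ} (hf : f ∈ FilU t u a) :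
    (fun ε => (nu true)⁻¹ * f (ρ true ε) + (nu false)⁻¹ * f (ρ false ε)) ∈
      FilU t u' (a + 1) := by
  obtain ⟨x, y, hns, horb, hx, hy, -, hp⟩ := h.exists_perm
  subst hu'
  unfold FilU
  have := death_mem_Fil hns (by rw [horb]; exact h.disjoint_marks) (ρ := ρ) (fun ε hε c q => by
    rw [← hp] at hε
    rw [hρ ε ((inv_circPerm_iff _ ε).1 hε), horb]) hf
  rw [hp]
  exact this

end Bubbles

section Complex

variable {N n : ℕ}

/-- The letters of a padded braid word: a crossing with its sign, or an idle layer with a sign. -/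
abbrev Letter (n : ℕ) : Type := Option (Fin (n - 1)) × Bool

/-- The vertices of the cube of a padded braid word. -/
abbrev Vtx (N : ℕ) : Type := Fin N → Bool

/-- The flat diagram at a vertex. -/
def shape (L : Fin N → Letter n) (S : Vtx N) : Shape N n := fun l =>
  if S l = !(L l).2 then none else (L l).1

/-- The vertices that resolve all idle layers in the braid-like way. -/
def Adm (L : Fin N → Letter n) (S : Vtx N) : Prop := ∀ l, (L l).1 = none → S l = !(L l).2

/-- The contribution of a letter to the quantum degree. -/
def letterShift : Letter n → Bool → ℤ
  | (none, _), _ => 0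
  | (some _, true), s => 1 + s.toNat
  | (some _, false), s => s.toNat - 2

/-- The contribution of the vertex to the quantum degree. -/
def shift (L : Fin N → Letter n) (S : Vtx N) : ℤ := ∑ l, letterShift (L l) (S l)

/-- The sign of an edge. -/
def vsign (S : Vtx N) (l : Fin N) : ℂ := ∏ k, if k < l ∧ S k = true then -1 else 1

/-- Functions of a vertex and a colouring. -/
abbrev Ch (N n : ℕ) : Type := Vtx N → (Point N n → Bool) → ℂ

/-- The part of the differential that changes the layer `l`. -/
def dTerm (L : Fin N → Letter n) (l : Fin N) (f : Ch N n) : Ch N n := fun S ε =>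
  if S l = true then vsign S l * kap (L l).1 (row ε l.castSucc) (row ε l.succ) *
    f (Function.update S l false) ε else 0

/-- The Lee differential in the colour model. -/
def dM (L : Fin N → Letter n) (f : Ch N n) : Ch N n := fun S ε => ∑ l, dTerm L l f S ε

/-- The filtration in the colour model. -/
def FM (L : Fin N → Letter n) (t s : ℝ) : Submodule ℂ (Ch N n) where
  carrier := {f | ∀ S, Adm L S → f S ∈ FilU t (shape L S) (s - shift L S)}
  zero_mem' := fun _ _ => zero_mem _
  add_mem' := fun hf hg S hS => add_mem (hf S hS) (hg S hS)
  smul_mem' := fun c _ hf S hS => Submodule.smul_mem _ c (hf S hS)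

/-- The braid-like vertex. -/
def blVtx (L : Fin N → Letter n) : Vtx N := fun l => !(L l).2

/-- The colouring of the canonical cycle. -/
def altCol (N n : ℕ) : Point N n → Bool := fun q => decide (Odd (q.2 : ℕ))

/-- The canonical cycle, up to a factor. -/
def canM (L : Fin N → Letter n) : Ch N n := fun S ε =>
  if S = blVtx L ∧ ε = altCol N n then 1 else 0

/-- The filtration levels in the colour model. -/
def levelsM (L : Fin N → Letter n) (t : ℝ) : Set ℝ :=
  {s | ∃ y : Ch N n, (∃ s₀, y ∈ FM L t s₀) ∧ canM L + dM L y ∈ FM L t s}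

theorem dM_smul (L : Fin N → Letter n) (c : ℂ) (f : Ch N n) : dM L (c • f) = c • dM L f := by
  ext S ε
  simp only [dM, Pi.smul_apply, smul_eq_mul, Finset.mul_sum]
  refine Finset.sum_congr rfl fun l _ => ?_
  simp only [dTerm, Pi.smul_apply, smul_eq_mul]
  split_ifs <;> ring

theorem FM_congr {L : Fin N → Letter n} {t s : ℝ} {f g : Ch N n} (hf : f ∈ FM L t s)
    (h : ∀ S, Adm L S → ∀ ε, Col (shape L S) ε → g S ε = f S ε) : g ∈ FM L t s :=
  fun S hS => FilU_congr (hf S hS) (h S hS)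

/-- A filtered map that is compatible with the differentials and with the canonical cycles moves the
levels by at most its degree. -/
theorem levelsM_of_map {N' : ℕ} {L : Fin N → Letter n} {L' : Fin N' → Letter n} {t c : ℝ}
    (φ : Ch N n →ₗ[ℂ] Ch N' n) {lam : ℂ} (hlam : lam ≠ 0)
    (hφ : ∀ s f, f ∈ FM L t s → φ f ∈ FM L' t (s - c))
    (hc : ∀ S, Adm L' S → ∀ ε, Col (shape L' S) ε → φ (canM L) S ε = lam * canM L' S ε)
    (hd : ∀ f S, Adm L' S → ∀ ε, Col (shape L' S) ε → φ (dM L f) S ε = dM L' (φ f) S ε)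
    {s : ℝ} (hs : s ∈ levelsM L t) : s - c ∈ levelsM L' t := by
  obtain ⟨y, ⟨s₀, hy⟩, h⟩ := hs
  refine ⟨lam⁻¹ • φ y, ⟨s₀ - c, Submodule.smul_mem _ _ (hφ _ _ hy)⟩, ?_⟩
  refine FM_congr (Submodule.smul_mem _ lam⁻¹ (hφ _ _ h)) fun S hS ε hε => ?_
  rw [map_add, dM_smul]
  simp only [Pi.add_apply, Pi.smul_apply, smul_eq_mul]
  rw [hc S hS ε hε, hd y S hS ε hε]
  field_simp

/-- Multiplication by a function of the colours at the vertices with a given bit. -/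
def bitOp (l : Fin N) (b : Bool) (m : (Point N n → Bool) → ℂ) : Ch N n →ₗ[ℂ] Ch N n where
  toFun f S ε := if S l = b then m ε * f S ε else 0
  map_add' f g := by ext S ε; simp only [Pi.add_apply]; split_ifs <;> ring
  map_smul' c f := by
    ext S ε
    simp only [Pi.smul_apply, smul_eq_mul, RingHom.id_apply]
    split_ifs <;> ring

theorem bitOp_apply (l : Fin N) (b : Bool) (m : (Point N n → Bool) → ℂ) (f : Ch N n) (S : Vtx N)
    (ε : Point N n → Bool) : bitOp l b m f S ε = if S l = b then m ε * f S ε else 0 := rfl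

/-- The general form of the maps between the complexes with a crossing and an idle layer. -/
theorem levelsM_bitOp {L L' : Fin N → Letter n} {t c : ℝ} (l : Fin N)
    (hL : ∀ k, k ≠ l → L' k = L k) (hb : (L' l).2 = (L l).2) (m : (Point N n → Bool) → ℂ)
    (hm : m (altCol N n) ≠ 0)
    (hfil : ∀ (u : Shape N n) (a : ℝ) f, f ∈ FilU t u a → (fun ε => m ε * f ε) ∈
      FilU t u (a + letterShift (L l) (!(L l).2) - letterShift (L' l) (!(L l).2) - c))
    (h1 : (L l).2 = false → ∀ ε, m ε * kap (L l).1 (row ε l.castSucc) (row ε l.succ) = 0)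
    (h2 : (L l).2 = true → ∀ ε, m ε * kap (L' l).1 (row ε l.castSucc) (row ε l.succ) = 0)
    {s : ℝ} (hs : s ∈ levelsM L t) : s - c ∈ levelsM L' t := by
  have hbl : blVtx L' = blVtx L := by
    funext k
    by_cases hk : k = l
    · subst hk; simp [blVtx, hb]
    · simp [blVtx, hL k hk]
  refine levelsM_of_map (bitOp l (!(L l).2) m) hm (fun s f hf S hS => ?_) (fun S hS ε hε => ?_)
    (fun f S hS ε hε => ?_) hs
  · by_cases hSl : S l = !(L l).2
    · have hadm : Adm L S := fun k hk => by
        by_cases hkl : k = l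
        · subst hkl; exact hSl
        · rw [← hL k hkl] at hk ⊢; exact hS k hk
      have hsh : shape L' S = shape L S := by
        funext k
        by_cases hkl : k = l
        · subst hkl; simp [shape, hb, hSl]
        · simp [shape, hL k hkl]
      have hshift : (shift L S : ℝ) + letterShift (L' l) (!(L l).2) =
          shift L' S + letterShift (L l) (!(L l).2) := by
        have e : ∑ k ∈ Finset.univ.erase l, letterShift (L k) (S k) =
            ∑ k ∈ Finset.univ.erase l, letterShift (L' k) (S k) :=
          Finset.sum_congr rfl fun k hk => by rw [hL k (Finset.ne_of_mem_erase hk)]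
        unfold shift
        rw [← Finset.add_sum_erase _ _ (Finset.mem_univ l),
          ← Finset.add_sum_erase _ (fun k => letterShift (L' k) (S k)) (Finset.mem_univ l), e, hSl]
        push_cast
        ring
      have := hfil _ _ _ (hf S hadm)
      rw [hsh]
      convert this using 1
      · congr 1
        linarith
      · funext ε
        rw [bitOp_apply, if_pos hSl]
    · refine FilU_congr (zero_mem _) fun ε _ => ?_
      rw [bitOp_apply, if_neg hSl]; rfl
  · rw [bitOp_apply]
    unfold canM
    rw [hbl]
    by_cases hS' : S = blVtx L ∧ ε = altCol N n
    · rw [if_pos hS', if_pos (by rw [hS'.1]; rfl), hS'.2]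
    · rw [if_neg hS']; simp
  · rw [bitOp_apply]
    unfold dM
    by_cases hSl : S l = !(L l).2
    · rw [if_pos hSl, Finset.mul_sum]
      refine Finset.sum_congr rfl fun k _ => ?_
      unfold dTerm
      by_cases hk : k = l
      · subst hk
        by_cases hSk : S k = true
        · rw [if_pos hSk, if_pos hSk, bitOp_apply]
          have hb' : (L k).2 = false := by rw [hSk] at hSl; simpa using hSl
          simp only [Function.update_self, hb', Bool.not_false, Bool.false_eq_true, if_false]
          linear_combination vsign S k * f (Function.update S k false) ε * h1 hb' ε
        · rw [if_neg hSk, if_neg hSk, mul_zero]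
      · rw [hL k hk, bitOp_apply, Function.update_of_ne (Ne.symm hk), if_pos hSl]
        split_ifs <;> ring
    · rw [if_neg hSl]
      symm
      refine Finset.sum_eq_zero fun k _ => ?_
      unfold dTerm
      by_cases hk : k = l
      · subst hk
        by_cases hSk : S k = true
        · rw [if_pos hSk, bitOp_apply]
          have hb' : (L k).2 = true := by rw [hSk] at hSl; simpa using hSl
          simp only [Function.update_self, hb', Bool.not_true, if_true]
          linear_combination vsign S k * f (Function.update S k false) ε * h2 hb' ε
        · rw [if_neg hSk]
      · rw [bitOp_apply, Function.update_of_ne (Ne.symm hk), if_neg hSl]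
        simp

theorem sub_mul_kap (i : Fin (n - 1)) (l : Fin N) (ε : Point N n → Bool) :
    (sg (ε (l.castSucc, leftPos i)) - sg (ε (l.castSucc, rightPos i))) *
      kap (some i) (row ε l.castSucc) (row ε l.succ) = 0 := by
  rw [kap_some]
  split_ifs with h
  · have h2 := h.2
    simp only [row] at h2
    rw [h2, sub_self, zero_mul]
  · rw [mul_zero]

theorem sub_altCol_ne_zero (i : Fin (n - 1)) (l : Fin N) :
    sg (altCol N n (l.castSucc, leftPos i)) - sg (altCol N n (l.castSucc, rightPos i)) ≠ 0 := by
  unfold altCol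
  simp only [leftPos, rightPos, Nat.odd_add_one]
  by_cases h : Odd (i : ℕ) <;> norm_num [h, sg]

theorem sub_mem_FilU {t a : ℝ} (ht : t ∈ Set.Icc (0 : ℝ) 2) (u : Shape N n) (x y : Point N n)
    {f : (Point N n → Bool) → ℂ} (hf : f ∈ FilU t u a) :
    (fun ε => (sg (ε x) - sg (ε y)) * f ε) ∈ FilU t u (a - 2) := by
  refine FilU_congr (sub_mem (mul_sg_mem_Fil ht x hf) (mul_sg_mem_Fil ht y hf)) fun ε _ => ?_
  simp [sub_mul]

/-- Replacing a crossing by an idle layer moves the levels by at most `1`. -/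
theorem levelsM_to_idle {L L' : Fin N → Letter n} {t : ℝ} (ht : t ∈ Set.Icc (0 : ℝ) 2) (l : Fin N)
    (hL : ∀ k, k ≠ l → L' k = L k) {i : Fin (n - 1)} {b : Bool} (h1 : L l = (some i, b))
    (h2 : L' l = (none, b)) {s : ℝ} (hs : s ∈ levelsM L t) : s - 1 ∈ levelsM L' t := by
  cases b
  · refine levelsM_bitOp l hL (by rw [h1, h2])
      (fun ε => sg (ε (l.castSucc, leftPos i)) - sg (ε (l.castSucc, rightPos i)))
      (sub_altCol_ne_zero i l) (fun u a f hf => ?_) (fun _ ε => ?_) (fun h => ?_) hs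
    · rw [h1, h2]
      convert sub_mem_FilU ht u _ _ hf using 1
      congr 1
      simp only [letterShift, Bool.not_false, Bool.toNat_true]
      push_cast
      ring
    · rw [h1]; exact sub_mul_kap i l ε
    · simp [h1] at h
  · refine levelsM_bitOp l hL (by rw [h1, h2]) (fun _ => 1) one_ne_zero (fun u a f hf => ?_)
      (fun h => ?_) (fun _ ε => ?_) hs
    · rw [h1, h2]
      simpa [letterShift] using hf
    · simp [h1] at h
    · simp [h2]

/-- Replacing an idle layer by a crossing moves the levels by at most `1`. -/
theorem levelsM_of_idle {L L' : Fin N → Letter n} {t : ℝ} (ht : t ∈ Set.Icc (0 : ℝ) 2) (l : Fin N)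
    (hL : ∀ k, k ≠ l → L' k = L k) {i : Fin (n - 1)} {b : Bool} (h1 : L l = (none, b))
    (h2 : L' l = (some i, b)) {s : ℝ} (hs : s ∈ levelsM L t) : s - 1 ∈ levelsM L' t := by
  cases b
  · refine levelsM_bitOp l hL (by rw [h1, h2]) (fun _ => 1) one_ne_zero (fun u a f hf => ?_)
      (fun _ ε => ?_) (fun h => ?_) hs
    · rw [h1, h2]
      convert hf using 1
      · congr 1
        simp [letterShift]
      · simp
    · simp [h1]
    · simp [h1] at h
  · refine levelsM_bitOp l hL (by rw [h1, h2])
      (fun ε => sg (ε (l.castSucc, leftPos i)) - sg (ε (l.castSucc, rightPos i)))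
      (sub_altCol_ne_zero i l) (fun u a f hf => ?_) (fun h => ?_) (fun _ ε => ?_) hs
    · rw [h1, h2]
      convert sub_mem_FilU ht u _ _ hf using 1
      congr 1
      simp only [letterShift, Bool.not_true, Bool.toNat_false]
      push_cast
      ring
    · simp [h1] at h
    · rw [h2]; exact sub_mul_kap i l ε

end Complex

section Rows

variable {N n : ℕ}

/-- Replace the colours at height `h`. -/
def setRow (ε : Point N n → Bool) (h : Fin (N + 1)) (z : Row n) : Point N n → Bool := fun q =>
  if q.1 = h then z q.2 else ε q

@[simp] theorem row_setRow_self (ε : Point N n → Bool) (h : Fin (N + 1)) (z : Row n) :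
    row (setRow ε h z) h = z := by
  funext p; simp [row, setRow]

theorem row_setRow_of_ne (ε : Point N n → Bool) {h k : Fin (N + 1)} (z : Row n) (hk : k ≠ h) :
    row (setRow ε h z) k = row ε k := by
  funext p; simp [row, setRow, hk]

theorem setRow_apply_of_ne (ε : Point N n → Bool) {h k : Fin (N + 1)} (z : Row n) (hk : k ≠ h)
    (p : Fin n) : setRow ε h z (k, p) = ε (k, p) := by
  simp [setRow, hk]

theorem setRow_setRow (ε : Point N n → Bool) (h : Fin (N + 1)) (z z' : Row n) :
    setRow (setRow ε h z) h z' = setRow ε h z' := by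
  funext q; unfold setRow; split_ifs <;> rfl

theorem setRow_comm (ε : Point N n → Bool) {h k : Fin (N + 1)} (hk : h ≠ k) (z z' : Row n) :
    setRow (setRow ε h z) k z' = setRow (setRow ε k z') h z := by
  funext q; unfold setRow; split_ifs with h1 h2
  · exact absurd (h2.symm.trans h1) hk
  all_goals rfl

theorem setRow_row (ε : Point N n → Bool) (h : Fin (N + 1)) : setRow ε h (row ε h) = ε := by
  funext q; unfold setRow row; split_ifs with h1
  · rw [← h1]
  · rfl

theorem setRow_eq_self {ε : Point N n → Bool} {h : Fin (N + 1)} {z : Row n} (hz : row ε h = z) :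
    setRow ε h z = ε := by
  rw [← hz, setRow_row]

theorem LayerOK.symm {o : Option (Fin (n - 1))} {X Y : Row n} (h : LayerOK o X Y) :
    LayerOK o Y X := by
  cases o with
  | none => exact Eq.symm h
  | some i => exact ⟨h.2.1, h.1, fun p h1 h2 => (h.2.2 p h1 h2).symm⟩

/-- The positions that a letter involves. -/
def Supp (o : Option (Fin (n - 1))) (p : Fin n) : Prop := ∃ i, o = some i ∧ (p = leftPos i ∨ p = rightPos i)

/-- The supports are disjoint. -/
def Far (o o' : Option (Fin (n - 1))) : Prop := ∀ p, Supp o p → ¬ Supp o' p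

theorem Far.symm {o o' : Option (Fin (n - 1))} (h : Far o o') : Far o' o := fun p h1 h2 => h p h2 h1

theorem not_supp_none (p : Fin n) : ¬ Supp (none : Option (Fin (n - 1))) p := by
  rintro ⟨i, hi, -⟩; cases hi

theorem far_none_left (o : Option (Fin (n - 1))) : Far none o := fun p h => absurd h (not_supp_none p)

theorem far_none_right (o : Option (Fin (n - 1))) : Far o none := (far_none_left o).symm

theorem supp_left (i : Fin (n - 1)) : Supp (some i) (leftPos i) := ⟨i, rfl, Or.inl rfl⟩

theorem supp_right (i : Fin (n - 1)) : Supp (some i) (rightPos i) := ⟨i, rfl, Or.inr rfl⟩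

theorem LayerOK.eq_of_not_supp {o : Option (Fin (n - 1))} {X Y : Row n} (h : LayerOK o X Y)
    {p : Fin n} (hp : ¬ Supp o p) : X p = Y p := by
  cases o with
  | none => exact congrFun h p
  | some i => exact h.2.2 p (fun e => hp ⟨i, rfl, Or.inl e⟩) fun e => hp ⟨i, rfl, Or.inr e⟩

/-- The second row on the support of a letter, and the first one elsewhere. -/
def mid (A : Option (Fin (n - 1))) (X Y : Row n) : Row n := fun p => if Supp A p then Y p else X p

theorem mid_of_supp {A : Option (Fin (n - 1))} {p : Fin n} (h : Supp A p) (X Y : Row n) :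
    mid A X Y p = Y p := if_pos h

theorem mid_of_not {A : Option (Fin (n - 1))} {p : Fin n} (h : ¬ Supp A p) (X Y : Row n) :
    mid A X Y p = X p := if_neg h

theorem layerOK_exchange {A B oA oB : Option (Fin (n - 1))} (hfar : Far A B)
    (hA : oA = none ∨ oA = A) (hB : oB = none ∨ oB = B) {X Y Z : Row n}
    (h1 : LayerOK oB X Z) (h2 : LayerOK oA Z Y) :
    Z = mid A Y X ∧ LayerOK oA X (mid A X Y) ∧ LayerOK oB (mid A X Y) Y := by
  have hsA : ∀ p, ¬ Supp A p → Z p = Y p := fun p hp => h2.eq_of_not_supp (by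
    rcases hA with rfl | rfl
    · exact not_supp_none p
    · exact hp)
  have hsB : ∀ p, ¬ Supp B p → X p = Z p := fun p hp => h1.eq_of_not_supp (by
    rcases hB with rfl | rfl
    · exact not_supp_none p
    · exact hp)
  have hsA' : ∀ p, Supp A p → X p = Z p := fun p hp => hsB p (hfar p hp)
  have hsB' : ∀ p, Supp B p → ¬ Supp A p := fun p hp h => hfar p h hp
  refine ⟨funext fun p => ?_, ?_, ?_⟩
  · by_cases hp : Supp A p
    · rw [mid_of_supp hp, hsA' p hp]
    · rw [mid_of_not hp, hsA p hp]
  · rcases hA with rfl | rfl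
    · funext p
      by_cases hp : Supp A p
      · rw [mid_of_supp hp, hsA' p hp]; exact congrFun h2 p
      · rw [mid_of_not hp]
    · cases oA with
      | none => exact funext fun p => (mid_of_not (not_supp_none p) _ _).symm
      | some i =>
        obtain ⟨e1, e2, e3⟩ := h2
        refine ⟨?_, ?_, fun p hl hr => ?_⟩
        · rw [hsA' _ (supp_left i), hsA' _ (supp_right i), e1]
        · rw [mid_of_supp (supp_left i), mid_of_supp (supp_right i), e2]
        · rw [mid_of_not]
          rintro ⟨j, hj, h⟩
          cases hj
          exact h.elim hl hr
  · rcases hB with rfl | rfl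
    · funext p
      by_cases hp : Supp A p
      · rw [mid_of_supp hp]
      · rw [mid_of_not hp, ← hsA p hp]; exact congrFun h1 p
    · cases oB with
      | none =>
        funext p
        by_cases hp : Supp A p
        · rw [mid_of_supp hp]
        · rw [mid_of_not hp, ← hsA p hp]; exact congrFun h1 p
      | some j =>
        obtain ⟨e1, e2, e3⟩ := h1
        have hl := hsB' _ (supp_left j)
        have hr := hsB' _ (supp_right j)
        refine ⟨?_, ?_, fun p hl hr => ?_⟩
        · rw [mid_of_not hl, mid_of_not hr, e1]
        · rw [← hsA _ hl, ← hsA _ hr, e2]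
        · by_cases hp : Supp A p
          · rw [mid_of_supp hp]
          · rw [mid_of_not hp, e3 p hl hr, hsA p hp]

theorem Col.change {u u' : Shape N n} {a b : Fin N} (hab : a.succ = b.castSucc)
    (hu : ∀ l, l ≠ a → l ≠ b → u l = u' l) {ε ε' : Point N n → Bool} (hε : Col u' ε)
    (hε' : ∀ h, h ≠ a.succ → row ε' h = row ε h)
    (h1 : LayerOK (u a) (row ε a.castSucc) (row ε' a.succ))
    (h2 : LayerOK (u b) (row ε' a.succ) (row ε b.succ)) : Col u ε' := by
  have hca : a.castSucc ≠ a.succ := (Fin.castSucc_lt_succ).ne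
  have hcb : b.succ ≠ a.succ := by rw [hab]; exact (Fin.castSucc_lt_succ).ne'
  refine ⟨fun l => ?_, ?_⟩
  · by_cases hla : l = a
    · subst hla
      rwa [hε' _ hca]
    by_cases hlb : l = b
    · subst hlb
      rwa [← hab, hε' _ hcb]
    rw [hε', hε', hu l hla hlb]
    · exact hε.1 l
    · simpa using hla
    · rw [hab]; simpa using hlb
  · rw [hε', hε']
    · exact hε.2
    · exact (Fin.succ_ne_zero a).symm
    · rw [hab]; exact (Fin.castSucc_lt_last b).ne'

/-- Points of the middle row go to the row above or below. -/
def midPt (A : Option (Fin (n - 1))) (a b : Fin N) (q : Point N n) : Point N n :=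
  if q.1 = a.succ then (if Supp A q.2 then b.succ else a.castSucc, q.2) else q

/-- See `midPt`. -/
def midPt' (A : Option (Fin (n - 1))) (a b : Fin N) (q : Point N n) : Point N n :=
  if q.1 = a.succ then (if Supp A q.2 then a.castSucc else b.succ, q.2) else q

theorem row_midPt_self (A : Option (Fin (n - 1))) (a b : Fin N) (ε : Point N n → Bool) :
    row (ε ∘ midPt A a b) a.succ = mid A (row ε a.castSucc) (row ε b.succ) := by
  funext p
  simp only [row, midPt, Function.comp_apply, if_true, mid]
  split_ifs <;> rfl

theorem row_midPt_of_ne (A : Option (Fin (n - 1))) (a b : Fin N) (ε : Point N n → Bool)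
    {h : Fin (N + 1)} (hh : h ≠ a.succ) : row (ε ∘ midPt A a b) h = row ε h := by
  funext p
  simp [row, midPt, hh]

theorem row_midPt'_self (A : Option (Fin (n - 1))) (a b : Fin N) (ε : Point N n → Bool) :
    row (ε ∘ midPt' A a b) a.succ = mid A (row ε b.succ) (row ε a.castSucc) := by
  funext p
  simp only [row, midPt', Function.comp_apply, if_true, mid]
  split_ifs <;> rfl

theorem row_midPt'_of_ne (A : Option (Fin (n - 1))) (a b : Fin N) (ε : Point N n → Bool)
    {h : Fin (N + 1)} (hh : h ≠ a.succ) : row (ε ∘ midPt' A a b) h = row ε h := by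
  funext p
  simp [row, midPt', hh]

theorem ext_row {ε ε' : Point N n → Bool} (h : ∀ k, row ε k = row ε' k) : ε = ε' :=
  funext fun q => congrFun (h q.1) q.2

/-- Exchanging two adjacent layers with disjoint supports. -/
theorem exchange_isotopy {u u' : Shape N n} {a b : Fin N} (hab : a.succ = b.castSucc)
    {A B : Option (Fin (n - 1))} (hfar : Far A B) (hA : u a = none ∨ u a = A)
    (hB : u b = none ∨ u b = B) (hua : u' a = u b) (hub : u' b = u a)
    (hu : ∀ l, l ≠ a → l ≠ b → u' l = u l) :
    Isotopy (marks N n) (circPerm u) (marks N n) (circPerm u') (midPt A a b) (midPt' A a b) := by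
  have hca : a.castSucc ≠ a.succ := (Fin.castSucc_lt_succ).ne
  have hcb : b.succ ≠ a.succ := by rw [hab]; exact (Fin.castSucc_lt_succ).ne'
  have key' : ∀ ε, Col u' ε → _ := fun ε (hε : Col u' ε) =>
    layerOK_exchange (X := row ε a.castSucc) (Z := row ε a.succ) (Y := row ε b.succ) hfar hA hB
      (hε.layer hua) (by rw [hab]; exact hε.layer hub)
  have key : ∀ ε, Col u ε → _ := fun ε (hε : Col u ε) =>
    layerOK_exchange (X := row ε b.succ) (Z := row ε a.succ) (Y := row ε a.castSucc) hfar hA hB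
      (by rw [hab]; exact (hε.layer rfl).symm) (hε.layer rfl).symm
  refine ⟨fun ε hε => ?_, fun ε hε => ?_, fun ε hε => ?_, fun ε hε => ?_, ?_⟩
  · rw [inv_circPerm_iff] at hε ⊢
    obtain ⟨-, h1, h2⟩ := key' ε hε
    refine hε.change hab (fun l h1 h2 => (hu l h1 h2).symm)
      (fun h hh => row_midPt_of_ne A a b ε hh) ?_ ?_
    · rwa [row_midPt_self]
    · rwa [row_midPt_self]
  · rw [inv_circPerm_iff] at hε ⊢
    obtain ⟨-, h1, h2⟩ := key ε hε
    refine hε.change hab hu (fun h hh => row_midPt'_of_ne A a b ε hh) ?_ ?_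
    · rw [row_midPt'_self, hua]; exact h2.symm
    · rw [row_midPt'_self, hub]; exact h1.symm
  · rw [inv_circPerm_iff] at hε
    obtain ⟨h1, -⟩ := key ε hε
    refine congrFun (?_ : (ε ∘ midPt' A a b) ∘ midPt A a b = ε)
    refine ext_row fun k => ?_
    by_cases hk : k = a.succ
    · subst hk
      rw [row_midPt_self, row_midPt'_of_ne _ _ _ _ hca, row_midPt'_of_ne _ _ _ _ hcb, ← h1]
    · rw [row_midPt_of_ne _ _ _ _ hk, row_midPt'_of_ne _ _ _ _ hk]
  · rw [inv_circPerm_iff] at hε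
    obtain ⟨h1, -⟩ := key' ε hε
    refine congrFun (?_ : (ε ∘ midPt A a b) ∘ midPt' A a b = ε)
    refine ext_row fun k => ?_
    by_cases hk : k = a.succ
    · subst hk
      rw [row_midPt'_self, row_midPt_of_ne _ _ _ _ hca, row_midPt_of_ne _ _ _ _ hcb, ← h1]
    · rw [row_midPt'_of_ne _ _ _ _ hk, row_midPt_of_ne _ _ _ _ hk]
  · have hm : ∀ q ∈ marks N n, midPt A a b q = q := fun q hq => by
      have : q.1 ≠ a.succ := by
        rw [(Finset.mem_filter.1 hq).2]; exact (Fin.succ_ne_zero a).symm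
      simp [midPt, this]
    exact (Set.bijOn_id _).congr fun q hq => (hm q hq).symm

theorem exchange_mem_FilU {u u' : Shape N n} {a b : Fin N} (hab : a.succ = b.castSucc)
    {A B : Option (Fin (n - 1))} (hfar : Far A B) (hA : u a = none ∨ u a = A)
    (hB : u b = none ∨ u b = B) (hua : u' a = u b) (hub : u' b = u a)
    (hu : ∀ l, l ≠ a → l ≠ b → u' l = u l) {t w : ℝ} {f : (Point N n → Bool) → ℂ}
    (hf : f ∈ FilU t u w) : (fun ε => f (ε ∘ midPt A a b)) ∈ FilU t u' w := by
  refine FilU_congr ((exchange_isotopy hab hfar hA hB hua hub hu).mem_Fil hf) fun ε _ => ?_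
  simp

end Rows

section Exchange

variable {N n : ℕ}

theorem vsign_congr {S S' : Vtx N} {l : Fin N} (h : ∀ k, k < l → S k = S' k) :
    vsign S l = vsign S' l := by
  unfold vsign
  refine Finset.prod_congr rfl fun k _ => ?_
  by_cases hk : k < l
  · rw [h k hk]
  · simp [hk]

theorem vsign_succ {a b : Fin N} (hab : a.succ = b.castSucc) (S : Vtx N) :
    vsign S b = vsign S a * if S a = true then -1 else 1 := by
  have hv : (a : ℕ) + 1 = b := by simpa using congrArg Fin.val hab
  have h1 : ∀ k : Fin N, k < b ↔ k = a ∨ k < a := fun k => by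
    rw [Fin.lt_def, Fin.lt_def, Fin.ext_iff]; omega
  unfold vsign
  rw [← Finset.mul_prod_erase _ _ (Finset.mem_univ a),
    ← Finset.mul_prod_erase _ (fun k => if k < a ∧ S k = true then (-1 : ℂ) else 1) (Finset.mem_univ a)]
  have h2 : ∏ k ∈ Finset.univ.erase a, (if k < b ∧ S k = true then (-1 : ℂ) else 1) =
      ∏ k ∈ Finset.univ.erase a, if k < a ∧ S k = true then (-1 : ℂ) else 1 := by
    refine Finset.prod_congr rfl fun k hk => ?_
    simp only [h1, Finset.ne_of_mem_erase hk, false_or]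
  rw [h2]
  simp only [h1, true_or, true_and, lt_irrefl, false_and, if_false, one_mul]
  rw [mul_comm]

/-- The sign of the exchange of two crossings. -/
def exSign (a b : Fin N) (S : Vtx N) : ℂ := if S a = true ∧ S b = true then -1 else 1

theorem exSign_ne_zero (a b : Fin N) (S : Vtx N) : exSign a b S ≠ 0 := by
  unfold exSign; split_ifs <;> simp

theorem exSign_mul_vsign {a b : Fin N} (hab : a.succ = b.castSucc) (S : Vtx N) {l : Fin N}
    (hl : S l = true) : exSign a b S * vsign (S ∘ swap a b) (swap a b l) =
      vsign S l * exSign a b (Function.update S l false) := by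
  have hv : (a : ℕ) + 1 = b := by simpa using congrArg Fin.val hab
  have hne : a ≠ b := fun h => by rw [h] at hv; omega
  have ha : vsign (S ∘ swap a b) a = vsign S a := vsign_congr fun k hk => by
    have h1 : k ≠ a := hk.ne
    have h2 : k ≠ b := fun h => by rw [h, Fin.lt_def] at hk; omega
    rw [Function.comp_apply, Equiv.swap_apply_of_ne_of_ne h1 h2]
  by_cases hla : l = a
  · subst hla
    rw [Equiv.swap_apply_left, vsign_succ hab, ha]
    cases hb : S b <;> simp [exSign, hl, hb]
  by_cases hlb : l = b
  · subst hlb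
    rw [Equiv.swap_apply_right, vsign_succ hab, ha]
    cases hb : S a <;> simp [exSign, hl, hb]
  rw [Equiv.swap_apply_of_ne_of_ne hla hlb]
  have h1 : vsign (S ∘ swap a b) l = vsign S l := by
    unfold vsign
    rw [← Equiv.prod_comp (swap a b)]
    refine Finset.prod_congr rfl fun k _ => ?_
    have : swap a b k < l ↔ k < l := by
      rw [Fin.ext_iff] at hla hlb
      by_cases h1 : k = a
      · subst h1; rw [Equiv.swap_apply_left, Fin.lt_def, Fin.lt_def]; omega
      by_cases h2 : k = b
      · subst h2; rw [Equiv.swap_apply_right, Fin.lt_def, Fin.lt_def]; omega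
      rw [Equiv.swap_apply_of_ne_of_ne h1 h2]
    simp only [this, Function.comp_apply, Equiv.swap_apply_self]
  rw [h1, mul_comm]
  congr 1
  unfold exSign
  rw [Function.update_of_ne (Ne.symm hla), Function.update_of_ne (Ne.symm hlb)]

theorem kap_exchange_left {A : Option (Fin (n - 1))} {X Y Z : Row n} (hZ : Z = mid A Y X) :
    kap A X (mid A X Y) = kap A Z Y := by
  cases A with
  | none => rfl
  | some i =>
    rw [kap_some, kap_some]
    have h1 : X = mid (some i) X Y ↔ Z = Y := by
      rw [hZ, funext_iff, funext_iff]
      refine forall_congr' fun p => ?_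
      by_cases hp : Supp (some i) p
      · rw [mid_of_supp hp, mid_of_supp hp]
      · rw [mid_of_not hp, mid_of_not hp]; simp
    have h2 : Z (leftPos i) = X (leftPos i) := by rw [hZ, mid_of_supp (supp_left i)]
    have h3 : Z (rightPos i) = X (rightPos i) := by rw [hZ, mid_of_supp (supp_right i)]
    simp only [h1, h2, h3]

theorem kap_exchange_right {A B : Option (Fin (n - 1))} (hfar : Far A B) {X Y Z : Row n}
    (hZ : Z = mid A Y X) :
    kap B (mid A X Y) Y = kap B X Z := by
  cases B with
  | none => rfl
  | some j =>
    rw [kap_some, kap_some]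
    have h1 : mid A X Y = Y ↔ X = Z := by
      rw [hZ, funext_iff, funext_iff]
      refine forall_congr' fun p => ?_
      by_cases hp : Supp A p
      · rw [mid_of_supp hp, mid_of_supp hp]; simp
      · rw [mid_of_not hp, mid_of_not hp]
    rw [mid_of_not (hfar.symm _ (supp_left j)), mid_of_not (hfar.symm _ (supp_right j))]
    simp only [h1]

/-- The chain map that exchanges two layers. -/
def exOp (A : Option (Fin (n - 1))) (a b : Fin N) : Ch N n →ₗ[ℂ] Ch N n where
  toFun f S ε := exSign a b S * f (S ∘ swap a b) (ε ∘ midPt A a b)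
  map_add' f g := by ext S ε; simp [mul_add]
  map_smul' c f := by ext S ε; simp [mul_left_comm]

theorem exOp_apply (A : Option (Fin (n - 1))) (a b : Fin N) (f : Ch N n) (S : Vtx N)
    (ε : Point N n → Bool) :
    exOp A a b f S ε = exSign a b S * f (S ∘ swap a b) (ε ∘ midPt A a b) := rfl

theorem update_comp_swap {a b : Fin N} (S : Vtx N) (l : Fin N) (c : Bool) :
    Function.update S l c ∘ swap a b = Function.update (S ∘ swap a b) (swap a b l) c := by
  funext k
  by_cases hk : k = swap a b l
  · subst hk; simp
  · have : swap a b k ≠ l := fun h => hk (by rw [← h]; simp)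
    simp [hk, this]

theorem shape_comp_swap (L : Fin N → Letter n) (S : Vtx N) (a b l : Fin N) :
    shape (L ∘ swap a b) S l = shape L (S ∘ swap a b) (swap a b l) := by
  simp [shape]

/-- Exchanging two adjacent layers with disjoint supports raises no level. -/
theorem levelsM_exchange_subset {L : Fin N → Letter n} {a b : Fin N} (hab : a.succ = b.castSucc)
    (hfar : Far (L a).1 (L b).1) (t : ℝ) : levelsM L t ⊆ levelsM (L ∘ swap a b) t := by
  intro s hs
  have hca : a.castSucc ≠ a.succ := (Fin.castSucc_lt_succ).ne
  have hcb : b.succ ≠ a.succ := by rw [hab]; exact (Fin.castSucc_lt_succ).ne'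
  have hv : (a : ℕ) + 1 = b := by simpa using congrArg Fin.val hab
  have hne : a ≠ b := fun h => by rw [h] at hv; omega
  have hnone : ∀ (S : Vtx N) l, shape L S l = none ∨ shape L S l = (L l).1 := fun S l => by
    unfold shape; split_ifs <;> simp
  rw [← sub_zero s]
  refine levelsM_of_map (exOp (L a).1 a b) (exSign_ne_zero a b (blVtx (L ∘ swap a b)))
    (fun s f hf S hS => ?_) (fun S hS ε hε => ?_)
    (fun f S hS ε hε => ?_) hs
  · have hadm : Adm L (S ∘ swap a b) := fun l hl => by
      have := hS (swap a b l) (by simpa using hl)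
      simpa using this
    have hshift : shift (L ∘ swap a b) S = shift L (S ∘ swap a b) := by
      unfold shift
      rw [← Equiv.sum_comp (swap a b)]
      simp
    have := exchange_mem_FilU (u' := shape (L ∘ swap a b) S) hab hfar (hnone (S ∘ swap a b) a)
      (hnone (S ∘ swap a b) b)
      (by rw [shape_comp_swap, Equiv.swap_apply_left]) (by rw [shape_comp_swap, Equiv.swap_apply_right])
      (fun l h1 h2 => by rw [shape_comp_swap, Equiv.swap_apply_of_ne_of_ne h1 h2])
      (hf _ hadm)
    rw [hshift, sub_zero]
    refine FilU_congr (Submodule.smul_mem _ (exSign a b S) this) fun ε _ => ?_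
    rw [exOp_apply]; rfl
  · rw [exOp_apply]
    unfold canM
    have h1 : S ∘ swap a b = blVtx L ↔ S = blVtx (L ∘ swap a b) := by
      have : blVtx (L ∘ swap a b) = blVtx L ∘ swap a b := rfl
      rw [this]
      constructor
      · intro h; rw [← h]; funext l; simp
      · intro h; rw [h]; funext l; simp
    simp only [h1]
    by_cases hS' : S = blVtx (L ∘ swap a b)
    · have h2 : ε ∘ midPt (L a).1 a b = ε := by
        have hbl : ∀ l, shape (L ∘ swap a b) S l = none := fun l => by
          rw [hS']; simp [shape, blVtx]
        have e1 := hε.layer (hbl a)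
        have e2 := hε.layer (hbl b)
        rw [← hab] at e2
        refine ext_row fun k => ?_
        by_cases hk : k = a.succ
        · subst hk
          rw [row_midPt_self]
          funext p
          simp only [LayerOK] at e1 e2
          rw [mid, e1, ← e2, ite_self]
        · rw [row_midPt_of_ne _ _ _ _ hk]
      rw [h2, ← hS']
    · simp [hS']
  · rw [exOp_apply]
    unfold dM
    rw [← Equiv.sum_comp (swap a b), Finset.mul_sum]
    refine Finset.sum_congr rfl fun l _ => ?_
    unfold dTerm
    rw [Function.comp_apply, Equiv.swap_apply_self, ← update_comp_swap, exOp_apply]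
    by_cases hl : S l = true
    · rw [if_pos hl, if_pos hl]
      have hsg := exSign_mul_vsign hab S hl
      have hk : kap (L (swap a b l)).1 (row (ε ∘ midPt (L a).1 a b) (swap a b l).castSucc)
          (row (ε ∘ midPt (L a).1 a b) (swap a b l).succ) =
          kap (L (swap a b l)).1 (row ε l.castSucc) (row ε l.succ) := by
        have hex := layerOK_exchange (X := row ε a.castSucc) (Z := row ε a.succ)
          (Y := row ε b.succ) hfar (hnone (S ∘ swap a b) a) (hnone (S ∘ swap a b) b)
          (hε.layer (by rw [shape_comp_swap, Equiv.swap_apply_left]))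
          (by rw [hab]; exact hε.layer (by rw [shape_comp_swap, Equiv.swap_apply_right]))
        by_cases hla : l = a
        · subst hla
          rw [Equiv.swap_apply_left, ← hab, row_midPt_self, row_midPt_of_ne _ _ _ _ hcb]
          exact kap_exchange_right hfar hex.1
        by_cases hlb : l = b
        · subst hlb
          rw [Equiv.swap_apply_right, ← hab, row_midPt_self, row_midPt_of_ne _ _ _ _ hca]
          exact kap_exchange_left hex.1
        rw [Equiv.swap_apply_of_ne_of_ne hla hlb, row_midPt_of_ne, row_midPt_of_ne]
        · simpa using hla
        · rw [hab]; simpa using hlb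
      rw [hk]
      simp only [Function.comp_apply]
      linear_combination (kap (L (swap a b l)).1 (row ε l.castSucc) (row ε l.succ) *
        f (Function.update S l false ∘ swap a b) (ε ∘ midPt (L a).1 a b)) * hsg
    · rw [if_neg hl, if_neg hl, mul_zero]

theorem levelsM_exchange {L : Fin N → Letter n} {a b : Fin N} (hab : a.succ = b.castSucc)
    (hfar : Far (L a).1 (L b).1) (t : ℝ) : levelsM (L ∘ swap a b) t = levelsM L t := by
  refine Set.Subset.antisymm ?_ (levelsM_exchange_subset hab hfar t)
  have := levelsM_exchange_subset (L := L ∘ swap a b) hab (by simpa using hfar.symm) t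
  rwa [Function.comp_assoc, ← Equiv.coe_trans, ← Equiv.Perm.mul_def, Equiv.swap_mul_self,
    Equiv.Perm.coe_one, Function.comp_id] at this

end Exchange

section DropIdle

variable {N n : ℕ}

/-- The inclusion of the points of a diagram into those with one more layer at the end. -/
def upPt (q : Point N n) : Point (N + 1) n := (q.1.castSucc, q.2)

/-- The two heights at an idle layer at the end are identified. -/
def downPt (q : Point (N + 1) n) : Point N n :=
  (Fin.lastCases (motive := fun _ => Fin (N + 1)) (Fin.last N) id q.1, q.2)

theorem row_upPt (ε : Point (N + 1) n → Bool) (h : Fin (N + 1)) :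
    row (ε ∘ upPt) h = row ε h.castSucc := rfl

theorem row_downPt_castSucc (ε : Point N n → Bool) (h : Fin (N + 1)) :
    row (ε ∘ downPt) h.castSucc = row ε h := by
  funext p; simp [row, downPt]

theorem row_downPt_last (ε : Point N n → Bool) :
    row (ε ∘ downPt) (Fin.last (N + 1)) = row ε (Fin.last N) := by
  funext p; simp [row, downPt]

theorem Col.up {u : Shape N n} {u' : Shape (N + 1) n} (hu : ∀ l, u' l.castSucc = u l)
    (hlast : u' (Fin.last N) = none) {ε : Point (N + 1) n → Bool} (h : Col u' ε) :
    Col u (ε ∘ upPt) := by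
  refine ⟨fun l => ?_, ?_⟩
  · have := h.1 l.castSucc
    rwa [hu l, Fin.succ_castSucc] at this
  · rw [row_upPt, row_upPt, Fin.castSucc_zero, ← h.2]
    exact h.layer hlast

theorem Col.down {u : Shape N n} {u' : Shape (N + 1) n} (hu : ∀ l, u' l.castSucc = u l)
    (hlast : u' (Fin.last N) = none) {ε : Point N n → Bool} (h : Col u ε) :
    Col u' (ε ∘ downPt) := by
  refine ⟨fun l => ?_, ?_⟩
  · induction l using Fin.lastCases with
    | last =>
      rw [hlast, Fin.succ_last, row_downPt_castSucc, row_downPt_last]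
      exact rfl
    | cast l =>
      rw [hu l, Fin.succ_castSucc, row_downPt_castSucc, row_downPt_castSucc]
      exact h.1 l
  · rw [row_downPt_last, ← Fin.castSucc_zero, row_downPt_castSucc, h.2]

theorem down_up (q : Point N n) : downPt (upPt q) = q := by simp [downPt, upPt]

theorem Col.up_down {u' : Shape (N + 1) n} (hlast : u' (Fin.last N) = none)
    {ε : Point (N + 1) n → Bool} (h : Col u' ε) : (ε ∘ upPt) ∘ downPt = ε := by
  refine ext_row fun k => ?_
  induction k using Fin.lastCases with
  | last => rw [row_downPt_last, row_upPt, ← Fin.succ_last]; exact h.layer hlast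
  | cast k => rw [row_downPt_castSucc, row_upPt]

theorem upPt_bijOn : Set.BijOn (upPt : Point N n → Point (N + 1) n) (marks N n) (marks (N + 1) n) := by
  refine ⟨fun q hq => ?_, fun q _ q' _ h => ?_, fun q hq => ?_⟩
  · simp only [marks, Finset.coe_filter, Finset.mem_univ, true_and, Set.mem_ofPred_eq] at hq ⊢
    simp [upPt, hq]
  · rw [← down_up q, h, down_up]
  · simp only [marks, Finset.coe_filter, Finset.mem_univ, true_and, Set.mem_ofPred_eq] at hq
    refine ⟨(0, q.2), by simp [marks], ?_⟩
    simp [upPt, ← hq]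

theorem downPt_bijOn :
    Set.BijOn (downPt : Point (N + 1) n → Point N n) (marks (N + 1) n) (marks N n) := by
  have hud : ∀ q ∈ marks (N + 1) n, upPt (downPt q) = q := fun q hq => by
    have h0 : q.1 = 0 := (Finset.mem_filter.1 hq).2
    obtain ⟨q1, q2⟩ := q
    simp only at h0
    subst h0
    simp only [upPt, downPt]
    rw [← Fin.castSucc_zero, Fin.lastCases_castSucc]
    rfl
  refine ⟨fun q hq => ?_, fun q hq q' hq' h => ?_, fun q hq => ?_⟩
  · obtain ⟨r, hr, hrq⟩ := upPt_bijOn.surjOn hq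
    rw [← hrq, down_up]; exact hr
  · rw [← hud q hq, h, hud q' hq']
  · exact ⟨upPt q, upPt_bijOn.mapsTo hq, down_up q⟩

theorem up_isotopy {u : Shape N n} {u' : Shape (N + 1) n} (hu : ∀ l, u' l.castSucc = u l)
    (hlast : u' (Fin.last N) = none) :
    Isotopy (marks N n) (circPerm u) (marks (N + 1) n) (circPerm u') upPt downPt := by
  refine ⟨fun ε hε => ?_, fun ε hε => ?_, fun ε _ p => by rw [down_up], fun ε hε q => ?_, upPt_bijOn⟩
  all_goals rw [inv_circPerm_iff] at *
  · exact hε.up hu hlast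
  · exact hε.down hu hlast
  · exact congrFun (hε.up_down hlast) q

theorem down_isotopy {u : Shape N n} {u' : Shape (N + 1) n} (hu : ∀ l, u' l.castSucc = u l)
    (hlast : u' (Fin.last N) = none) :
    Isotopy (marks (N + 1) n) (circPerm u') (marks N n) (circPerm u) downPt upPt := by
  refine ⟨fun ε hε => ?_, fun ε hε => ?_, fun ε hε q => ?_, fun ε _ p => by rw [down_up],
    downPt_bijOn⟩
  all_goals rw [inv_circPerm_iff] at *
  · exact hε.down hu hlast
  · exact hε.up hu hlast
  · exact congrFun (hε.up_down hlast) q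

/-- Extend chains to one more idle layer. -/
def upOp (N n : ℕ) : Ch N n →ₗ[ℂ] Ch (N + 1) n where
  toFun f S ε := f (fun l => S l.castSucc) (ε ∘ upPt)
  map_add' _ _ := rfl
  map_smul' _ _ := rfl

/-- Restrict chains to one layer less. -/
def downOp (N n : ℕ) (c : Bool) : Ch (N + 1) n →ₗ[ℂ] Ch N n where
  toFun f S ε := f (Fin.snoc S c : Fin (N + 1) → Bool) (ε ∘ downPt)
  map_add' _ _ := rfl
  map_smul' _ _ := rfl

theorem vsign_castSucc (S : Vtx (N + 1)) (l : Fin N) :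
    vsign S l.castSucc = vsign (fun k => S k.castSucc) l := by
  unfold vsign
  rw [Fin.prod_univ_castSucc, if_neg, mul_one]
  · rfl
  · rintro ⟨h, -⟩
    exact absurd h (Fin.castSucc_lt_last l).le.not_gt

/-- An idle layer at the end does not change the levels. -/
theorem levelsM_snoc_idle {L : Fin N → Letter n} {L' : Fin (N + 1) → Letter n} {b : Bool}
    (hL : ∀ l, L' l.castSucc = L l) (hlast : L' (Fin.last N) = (none, b)) (t : ℝ) :
    levelsM L' t = levelsM L t := by
  have hshape : ∀ S l, shape L' S l.castSucc = shape L (fun k => S k.castSucc) l := fun S l => by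
    simp only [shape, hL]
  have hslast : ∀ S, shape L' S (Fin.last N) = none := fun S => by simp [shape, hlast]
  have hshift : ∀ S, shift L' S = shift L fun k => S k.castSucc := fun S => by
    unfold shift
    rw [Fin.sum_univ_castSucc, hlast]
    simp only [hL, letterShift, add_zero]
  have hadm : ∀ S, Adm L' S ↔ Adm L (fun k => S k.castSucc) ∧ S (Fin.last N) = !b := fun S => by
    unfold Adm
    rw [Fin.forall_fin_succ', hlast]
    simp only [hL, true_imp_iff]
  have hbl : ∀ S : Vtx (N + 1), S = blVtx L' ↔ (fun k => S k.castSucc) = blVtx L ∧ S (Fin.last N) = !b := fun S => by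
    rw [funext_iff, funext_iff, Fin.forall_fin_succ']
    simp only [blVtx, hL, hlast]
  have hdterm : ∀ (f : Ch (N + 1) n) S ε, dM L' f S ε = ∑ l : Fin N, dTerm L' l.castSucc f S ε :=
    fun f S ε => by
      unfold dM
      rw [Fin.sum_univ_castSucc]
      simp [dTerm, hlast]
  have halt1 : altCol (N + 1) n ∘ upPt = altCol N n := rfl
  have halt2 : altCol N n ∘ downPt = altCol (N + 1) n := rfl
  refine Set.Subset.antisymm (fun s hs => ?_) fun s hs => ?_
  · rw [← sub_zero s]
    have hsn : ∀ S : Vtx N, (fun k : Fin N => (Fin.snoc S (!b) : Fin (N + 1) → Bool) k.castSucc) = S := fun S => by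
      funext k; simp
    refine levelsM_of_map (downOp N n (!b)) one_ne_zero (fun s f hf S hS => ?_)
      (fun S hS ε hε => ?_) (fun f S hS ε hε => ?_) hs
    · have h1 := hf (Fin.snoc S (!b)) ((hadm _).2 ⟨by rwa [hsn], by simp⟩)
      rw [hshift, hsn] at h1
      rw [sub_zero]
      have := (down_isotopy (u := shape L S) (fun l => by rw [hshape, hsn]) (hslast _)).mem_Fil h1
      refine FilU_congr this fun ε _ => ?_
      rw [wop_apply, one_mul]; rfl
    · rw [one_mul]
      change canM L' (Fin.snoc S (!b)) (ε ∘ downPt) = _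
      unfold canM
      have h2 : ε ∘ downPt = altCol (N + 1) n ↔ ε = altCol N n := by
        constructor
        · intro h
          rw [← halt1, ← h]
          funext q
          simp [down_up]
        · rintro rfl; exact halt2
      simp only [hbl, hsn, Fin.snoc_last, and_true, h2]
    · change dM L' f (Fin.snoc S (!b)) (ε ∘ downPt) = _
      rw [hdterm]
      unfold dM
      refine Finset.sum_congr rfl fun l _ => ?_
      unfold dTerm
      rw [vsign_castSucc, hsn, hL, Fin.snoc_castSucc, Fin.succ_castSucc, row_downPt_castSucc,
        row_downPt_castSucc, ← Fin.snoc_update]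
      rfl
  · rw [← sub_zero s]
    refine levelsM_of_map (upOp N n) one_ne_zero (fun s f hf S hS => ?_)
      (fun S hS ε hε => ?_) (fun f S hS ε hε => ?_) hs
    · have h1 := hf _ ((hadm _).1 hS).1
      rw [hshift, sub_zero]
      have := (up_isotopy (u' := shape L' S) (fun l => hshape S l) (hslast _)).mem_Fil h1
      refine FilU_congr this fun ε _ => ?_
      rw [wop_apply, one_mul]; rfl
    · rw [one_mul]
      change canM L (fun l => S l.castSucc) (ε ∘ upPt) = _
      unfold canM
      have h2 : ε ∘ upPt = altCol N n ↔ ε = altCol (N + 1) n := by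
        constructor
        · intro h
          rw [← halt2, ← h, hε.up_down (hslast S)]
        · rintro rfl; exact halt1
      simp only [hbl, ((hadm S).1 hS).2, and_true, h2]
    · change dM L f (fun l => S l.castSucc) (ε ∘ upPt) = _
      rw [hdterm]
      unfold dM
      refine Finset.sum_congr rfl fun l _ => ?_
      unfold dTerm
      rw [vsign_castSucc, hL, Fin.succ_castSucc, row_upPt, row_upPt]
      have : (fun k : Fin N => Function.update S l.castSucc false k.castSucc) =
          Function.update (fun k : Fin N => S k.castSucc) l false := by
        funext k
        by_cases hk : k = l
        · subst hk; simp
        · simp [hk]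
      change _ = if S l.castSucc = true then _ * _ *
        f (fun k => Function.update S l.castSucc false k.castSucc) (ε ∘ upPt) else 0
      rw [this]

end DropIdle

section BubbleSet

variable {N n : ℕ}

/-- The circle between two layers that are joined by idle layers. -/
def bubbleSet (a c : Fin N) (i : Fin (n - 1)) : Finset (Point N n) := Finset.univ.filter fun q =>
  a.succ ≤ q.1 ∧ q.1 ≤ c.castSucc ∧ (q.2 = leftPos i ∨ q.2 = rightPos i)

theorem mem_bubbleSet {a c : Fin N} {i : Fin (n - 1)} {h : Fin (N + 1)} {p : Fin n} :
    (h, p) ∈ bubbleSet a c i ↔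
      a.succ ≤ h ∧ h ≤ c.castSucc ∧ (p = leftPos i ∨ p = rightPos i) := by
  simp [bubbleSet]

theorem Col.bubble_const {u : Shape N n} {a c : Fin N} {i : Fin (n - 1)}
    (ha : u a = some i) (hmid : ∀ k, a < k → k < c → u k = none)
    {ε : Point N n → Bool} (hε : Col u ε) {q : Point N n} (hq : q ∈ bubbleSet a c i) :
    ε q = ε (a.succ, leftPos i) := by
  obtain ⟨h, p⟩ := q
  obtain ⟨h1, h2, h3⟩ := mem_bubbleSet.1 hq
  have hrow : ∀ h : Fin (N + 1), a.succ ≤ h → h ≤ c.castSucc → row ε h = row ε a.succ := by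
    intro h
    induction h using Fin.induction with
    | zero => intro h0 _; exact absurd h0 (by simp)
    | succ k ih =>
      intro h1 h2
      rcases h1.eq_or_lt with e | e
      · rw [← e]
      · have hak : a < k := by simpa using e
        have hkc : k < c := by
          rw [Fin.lt_def]; rw [Fin.le_def] at h2; simpa using h2
        rw [← ih (by rw [Fin.le_def]; simpa [Nat.succ_le_iff] using hak)
          (by rw [Fin.le_def]; simpa using hkc.le)]
        exact (hε.layer (hmid k hak hkc)).symm
  have e1 : ε (h, p) = ε (a.succ, p) := congrFun (hrow h h1 h2) p
  rw [e1]
  rcases h3 with rfl | rfl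
  · rfl
  · exact (hε.layer ha).2.1.symm

theorem col_bubbleSet {u : Shape N n} {a c : Fin N} {i : Fin (n - 1)} (hac : a < c)
    (ha : u a = some i) (hc : u c = some i) (hmid : ∀ k, a < k → k < c → u k = none) :
    Col u fun q => decide (q ∈ bubbleSet a c i) := by
  refine ⟨fun k => ?_, ?_⟩
  · have hval : ∀ p, row (fun q => decide (q ∈ bubbleSet a c i)) k.castSucc p =
        decide ((a < k ∧ k ≤ c) ∧ (p = leftPos i ∨ p = rightPos i)) := fun p => by
      simp only [row, mem_bubbleSet, Fin.le_def, Fin.lt_def, Fin.val_succ, Fin.val_castSucc,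
        Nat.succ_le_iff, and_assoc]
    have hval' : ∀ p, row (fun q => decide (q ∈ bubbleSet a c i)) k.succ p =
        decide ((a ≤ k ∧ k < c) ∧ (p = leftPos i ∨ p = rightPos i)) := fun p => by
      simp only [row, mem_bubbleSet, Fin.le_def, Fin.lt_def, Fin.val_succ, Fin.val_castSucc,
        Nat.succ_le_iff, and_assoc, Nat.lt_succ_iff]
    have hgen : ((a < k ∧ k ≤ c) ↔ (a ≤ k ∧ k < c)) → ∀ o, u k = o → LayerOK o
        (row (fun q => decide (q ∈ bubbleSet a c i)) k.castSucc)
        (row (fun q => decide (q ∈ bubbleSet a c i)) k.succ) := fun h o ho => by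
      have e : row (fun q => decide (q ∈ bubbleSet a c i)) k.castSucc =
        row (fun q => decide (q ∈ bubbleSet a c i)) k.succ := by
        funext p; simp only [hval, hval', h]
      cases o with
      | none => exact e
      | some j =>
        have hout : ¬ (a ≤ k ∧ k < c) := fun hk => by
          by_cases hak : a = k
          · subst hak; exact absurd (h.2 hk).1 (lt_irrefl a)
          · rw [hmid k (lt_of_le_of_ne hk.1 hak) hk.2] at ho; cases ho
        rw [e]
        refine ⟨?_, ?_, fun _ _ _ => rfl⟩ <;> rw [hval', hval'] <;> simp [hout]
    by_cases hak : k = a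
    · subst hak
      rw [ha]
      refine ⟨?_, ?_, fun p h1 h2 => ?_⟩
      · rw [hval, hval]; simp
      · rw [hval', hval']; simp
      · rw [hval, hval']; simp [h1, h2]
    by_cases hck : k = c
    · subst hck
      rw [hc]
      refine ⟨?_, ?_, fun p h1 h2 => ?_⟩
      · rw [hval, hval]; simp
      · rw [hval', hval']; simp
      · rw [hval, hval']; simp [h1, h2]
    · exact hgen (by rw [Fin.lt_def, Fin.le_def, Fin.lt_def, Fin.le_def]; rw [Fin.ext_iff] at hak hck; omega) _ rfl
  · funext p
    simp only [row, mem_bubbleSet]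
    have h1 : ¬ Fin.last N ≤ c.castSucc := (Fin.castSucc_lt_last c).not_ge
    simp [h1]

theorem isBubble_lower {u : Shape N n} {a c : Fin N} {i : Fin (n - 1)} (hac : a < c)
    (ha : u a = some i) (hc : u c = some i) (hmid : ∀ k, a < k → k < c → u k = none) :
    IsBubble u a i (bubbleSet a c i) (a.succ, leftPos i) (a.castSucc, leftPos i) := by
  have hm : (a.succ, leftPos i) ∈ bubbleSet a c i :=
    mem_bubbleSet.2 ⟨le_rfl, by rw [Fin.le_def]; simpa [Nat.succ_le_iff] using hac, Or.inl rfl⟩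
  refine ⟨ha, hm, col_bubbleSet hac ha hc hmid,
    fun ε hε q hq => hε.bubble_const ha hmid hq, ?_, Or.inl ⟨rfl, ?_, hm⟩⟩
  · rintro ⟨h, p⟩ hq rfl
    exact absurd (mem_bubbleSet.1 hq).1 (by simp)
  · rw [mem_bubbleSet]
    rintro ⟨h, -⟩
    exact absurd h (Fin.castSucc_lt_succ).not_ge

theorem isBubble_upper {u : Shape N n} {a c : Fin N} {i : Fin (n - 1)} (hac : a < c)
    (ha : u a = some i) (hc : u c = some i) (hmid : ∀ k, a < k → k < c → u k = none) :
    IsBubble u c i (bubbleSet a c i) (a.succ, leftPos i) (c.succ, leftPos i) := by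
  have h := isBubble_lower hac ha hc hmid
  refine ⟨hc, h.mem, h.col, h.const, h.marks, Or.inr ⟨rfl, ?_, ?_⟩⟩
  · rw [mem_bubbleSet]
    rintro ⟨-, h, -⟩
    exact absurd h (Fin.castSucc_lt_succ).not_ge
  · exact mem_bubbleSet.2 ⟨by rw [Fin.le_def]; simpa [Nat.succ_le_iff] using hac, le_rfl, Or.inl rfl⟩

end BubbleSet

section Cancel

variable {N n : ℕ}

/-- Set the colours at the two positions of a letter. -/
def fill (i : Fin (n - 1)) (o : Bool) (z : Row n) : Row n := fun p =>
  if p = leftPos i ∨ p = rightPos i then o else z p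

theorem fill_left (i : Fin (n - 1)) (o : Bool) (z : Row n) : fill i o z (leftPos i) = o := by
  simp [fill]

theorem fill_right (i : Fin (n - 1)) (o : Bool) (z : Row n) : fill i o z (rightPos i) = o := by
  simp [fill]

theorem fill_self {i : Fin (n - 1)} {z : Row n} (h : z (leftPos i) = z (rightPos i)) :
    fill i (z (leftPos i)) z = z := by
  funext p
  unfold fill
  split_ifs with hp
  · rcases hp with rfl | rfl
    · rfl
    · exact h
  · rfl

theorem eq_fill_iff {i : Fin (n - 1)} {o : Bool} {z : Row n} :
    (z = fill i o z ∧ z (leftPos i) = z (rightPos i)) ↔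
      z (leftPos i) = z (rightPos i) ∧ z (leftPos i) = o := by
  constructor
  · rintro ⟨h1, h2⟩
    refine ⟨h2, ?_⟩
    rw [h1, fill_left]
  · rintro ⟨h1, rfl⟩
    exact ⟨(fill_self h1).symm, h1⟩

/-- Two sums over the layers. -/
theorem sum_eq_add_add {a b : Fin N} (hab : a ≠ b) (F : Fin N → ℂ) :
    ∑ l, F l = F a + F b + ∑ l ∈ (Finset.univ.erase a).erase b, F l := by
  rw [← Finset.add_sum_erase _ _ (Finset.mem_univ a), ← Finset.add_sum_erase (Finset.univ.erase a) F
    (Finset.mem_erase.2 ⟨hab.symm, Finset.mem_univ b⟩), add_assoc]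

theorem succ_ne_of_adjacent {a b : Fin N} (hab : a.succ = b.castSucc) : a ≠ b := by
  rintro rfl
  exact absurd hab (Fin.castSucc_lt_succ).ne'

theorem vsign_comp_swap {a b : Fin N} (hab : a.succ = b.castSucc) (S : Vtx N) {l : Fin N}
    (hl : S l = true) (hla : l ≠ a) (hlb : l ≠ b) : vsign (S ∘ swap a b) l = vsign S l := by
  have h := exSign_mul_vsign hab S hl
  rw [Equiv.swap_apply_of_ne_of_ne hla hlb] at h
  have h2 : exSign a b (Function.update S l false) = exSign a b S := by
    unfold exSign
    rw [Function.update_of_ne (Ne.symm hla), Function.update_of_ne (Ne.symm hlb)]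
  rw [h2, mul_comm] at h
  exact mul_right_cancel₀ (exSign_ne_zero a b S) h

/-- From two idle layers to two opposite crossings, on the non-braid-like resolution. -/
theorem opposite_birth_mem_FilU {t w : ℝ} (ht : t ∈ Set.Icc (0 : ℝ) 2) {u u' : Shape N n}
    {a b : Fin N} (hab : a.succ = b.castSucc) {i : Fin (n - 1)} (ha : u a = none) (hb : u b = none)
    (ha' : u' a = some i) (hb' : u' b = some i) (hu : ∀ l, l ≠ a → l ≠ b → u' l = u l)
    {f : (Point N n → Bool) → ℂ} (hf : f ∈ FilU t u w) :
    (fun ε => (nu (ε (a.succ, leftPos i)))⁻¹ * (kap (some i) (row ε a.castSucc) (row ε b.succ) *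
      f (setRow ε a.succ (row ε b.succ)))) ∈ FilU t u' w := by
  have hne := succ_ne_of_adjacent hab
  have hlt : a < b := by
    have := congrArg Fin.val hab
    rw [Fin.lt_def]; simp at this; omega
  have hmid : ∀ k, a < k → k < b → u' k = none := fun k h1 h2 => by
    have := congrArg Fin.val hab
    rw [Fin.lt_def] at h1 h2; simp at this; omega
  have h1 := saddle_mem_FilU ht (u' := Function.update u a (some i)) (l := a) (i := i)
    (Or.inl ⟨ha, by simp⟩) (fun k hk => by simp [hk]) hf
  have h2 := (isBubble_upper hlt ha' hb' hmid).birth (u' := Function.update u a (some i))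
    (by
      funext k
      by_cases hka : k = a
      · subst hka; simp [hne, ha']
      by_cases hkb : k = b
      · subst hkb; simp [hka, hb]
      simp [hka, hkb, hu])
    (ρ := fun ε => setRow ε a.succ (row ε b.succ)) (fun ε hε q => by
      obtain ⟨h, p⟩ := q
      by_cases hh : h = a.succ
      · subst hh
        obtain ⟨e1, e2, e3⟩ := hε.layer hb'
        simp only [mem_bubbleSet, le_refl, hab.le, true_and, setRow, if_true]
        split_ifs with hp
        · rcases hp with rfl | rfl
          · rfl
          · exact e2.symm
        · push Not at hp
          rw [hab]
          exact (e3 p hp.1 hp.2).symm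
      · rw [if_neg, setRow_apply_of_ne _ _ hh]
        rw [mem_bubbleSet]
        rintro ⟨h3, h4, -⟩
        exact hh (le_antisymm (by rw [hab]; exact h4) h3)) h1
  rw [sub_add_cancel] at h2
  refine FilU_congr h2 fun ε hε => ?_
  rw [row_setRow_of_ne _ _ (Fin.castSucc_lt_succ).ne, row_setRow_self]

/-- From the non-braid-like resolution of two opposite crossings to two idle layers. -/
theorem opposite_death_mem_FilU {t w : ℝ} (ht : t ∈ Set.Icc (0 : ℝ) 2) {u u' : Shape N n}
    {a b : Fin N} (hab : a.succ = b.castSucc) {i : Fin (n - 1)} (ha : u a = none) (hb : u b = none)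
    (ha' : u' a = some i) (hb' : u' b = some i) (hu : ∀ l, l ≠ a → l ≠ b → u' l = u l)
    {f : (Point N n → Bool) → ℂ} (hf : f ∈ FilU t u' w) :
    (fun ε => kap (some i) (row ε b.castSucc) (row ε b.succ) *
      ((nu true)⁻¹ * f (setRow ε a.succ (fill i true (row ε a.succ))) +
        (nu false)⁻¹ * f (setRow ε a.succ (fill i false (row ε a.succ))))) ∈ FilU t u w := by
  have hne := succ_ne_of_adjacent hab
  have hlt : a < b := by
    have := congrArg Fin.val hab
    rw [Fin.lt_def]; simp at this; omega
  have hmid : ∀ k, a < k → k < b → u' k = none := fun k h1 h2 => by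
    have := congrArg Fin.val hab
    rw [Fin.lt_def] at h1 h2; simp at this; omega
  have h2 := (isBubble_lower hlt ha' hb' hmid).death rfl
    (ρ := fun o ε => setRow ε a.succ (fill i o (row ε a.succ))) (fun ε hε o q => by
      obtain ⟨h, p⟩ := q
      by_cases hh : h = a.succ
      · subst hh
        simp only [mem_bubbleSet, le_refl, hab.le, true_and, setRow, if_true, fill, row]
      · rw [if_neg, setRow_apply_of_ne _ _ hh]
        rw [mem_bubbleSet]
        rintro ⟨h3, h4, -⟩
        exact hh (le_antisymm (by rw [hab]; exact h4) h3)) hf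
  have h1 := saddle_mem_FilU ht (u' := u) (l := b) (i := i)
    (Or.inr ⟨by simp [hne.symm, hb'], hb⟩) (fun k hk => by
      by_cases hka : k = a
      · subst hka; simp [ha]
      · simp [hka, hk, hu]) h2
  rwa [add_sub_cancel_right] at h1

/-- The chain map from two idle layers to two opposite crossings. -/
def openOp (i : Fin (n - 1)) (a b : Fin N) (c : Bool) : Ch N n →ₗ[ℂ] Ch N n where
  toFun f S ε :=
    if S a = !c ∧ S b = c then f S ε
    else if S a = c ∧ S b = !c then
      (nu (ε (a.succ, leftPos i)))⁻¹ * (kap (some i) (row ε a.castSucc) (row ε b.succ) *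
        f (S ∘ swap a b) (setRow ε a.succ (row ε b.succ)))
    else 0
  map_add' f g := by ext S ε; simp only [Pi.add_apply]; split_ifs <;> ring
  map_smul' c f := by
    ext S ε; simp only [Pi.smul_apply, smul_eq_mul, RingHom.id_apply]; split_ifs <;> ring

/-- The chain map from two opposite crossings to two idle layers. -/
def closeOp (i : Fin (n - 1)) (a b : Fin N) : Ch N n →ₗ[ℂ] Ch N n where
  toFun f S ε := f S ε - kap (some i) (row ε b.castSucc) (row ε b.succ) *
    ((nu true)⁻¹ * f (S ∘ swap a b) (setRow ε a.succ (fill i true (row ε a.succ))) +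
      (nu false)⁻¹ * f (S ∘ swap a b) (setRow ε a.succ (fill i false (row ε a.succ))))
  map_add' f g := by ext S ε; simp only [Pi.add_apply]; ring
  map_smul' c f := by
    ext S ε; simp only [Pi.smul_apply, smul_eq_mul, RingHom.id_apply]; ring

theorem openOp_apply (i : Fin (n - 1)) (a b : Fin N) (c : Bool) (f : Ch N n) (S : Vtx N)
    (ε : Point N n → Bool) : openOp i a b c f S ε = if S a = !c ∧ S b = c then f S ε
    else if S a = c ∧ S b = !c then
      (nu (ε (a.succ, leftPos i)))⁻¹ * (kap (some i) (row ε a.castSucc) (row ε b.succ) *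
        f (S ∘ swap a b) (setRow ε a.succ (row ε b.succ)))
    else 0 := rfl

theorem closeOp_apply (i : Fin (n - 1)) (a b : Fin N) (f : Ch N n) (S : Vtx N)
    (ε : Point N n → Bool) : closeOp i a b f S ε =
    f S ε - kap (some i) (row ε b.castSucc) (row ε b.succ) *
    ((nu true)⁻¹ * f (S ∘ swap a b) (setRow ε a.succ (fill i true (row ε a.succ))) +
      (nu false)⁻¹ * f (S ∘ swap a b) (setRow ε a.succ (fill i false (row ε a.succ)))) := rfl

theorem kap_altCol (i : Fin (n - 1)) (h : Fin (N + 1)) (Y : Row n) :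
    kap (some i) (row (altCol N n) h) Y = 0 := by
  rw [kap_some, if_neg]
  rintro ⟨-, h2⟩
  simp only [row, altCol, leftPos, rightPos, Nat.odd_add_one] at h2
  by_cases h : Odd (i : ℕ) <;> simp [h] at h2

theorem kap_self {i : Fin (n - 1)} {X : Row n} (h : X (leftPos i) = X (rightPos i)) :
    kap (some i) X X = nu (X (leftPos i)) := by
  rw [kap_some, if_pos ⟨rfl, h⟩]

theorem kap_eq_zero {i : Fin (n - 1)} {X Y : Row n}
    (h : ¬ (X = Y ∧ X (leftPos i) = X (rightPos i))) : kap (some i) X Y = 0 := by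
  rw [kap_some, if_neg h]

/-- The words agree except for two opposite crossings and two idle layers. -/
structure IsCancel (L L' : Fin N → Letter n) (i : Fin (n - 1)) (a b : Fin N) (c : Bool) : Prop where
  adj : a.succ = b.castSucc
  left : L a = (some i, c)
  right : L b = (some i, !c)
  left' : L' a = (none, c)
  right' : L' b = (none, !c)
  rest : ∀ k, k ≠ a → k ≠ b → L' k = L k

namespace IsCancel

variable {L L' : Fin N → Letter n} {i : Fin (n - 1)} {a b : Fin N} {c : Bool}
  (h : IsCancel L L' i a b c)
include h

theorem ne : a ≠ b := succ_ne_of_adjacent h.adj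

theorem shape_rest (S : Vtx N) (k : Fin N) (h1 : k ≠ a) (h2 : k ≠ b) :
    shape L' S k = shape L S k := by
  simp only [shape, h.rest k h1 h2]

theorem shape_left (S : Vtx N) : shape L S a = if S a = !c then none else some i := by
  simp only [shape, h.left]

theorem shape_right (S : Vtx N) : shape L S b = if S b = c then none else some i := by
  simp only [shape, h.right, Bool.not_not]

theorem shape_left' (S : Vtx N) : shape L' S a = none := by
  simp only [shape, h.left', ite_self]

theorem shape_right' (S : Vtx N) : shape L' S b = none := by
  simp only [shape, h.right', ite_self]

theorem swap_left (S : Vtx N) : (S ∘ swap a b) a = S b := by simp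

theorem swap_right (S : Vtx N) : (S ∘ swap a b) b = S a := by simp

theorem swap_rest (S : Vtx N) {k : Fin N} (h1 : k ≠ a) (h2 : k ≠ b) : (S ∘ swap a b) k = S k := by
  rw [Function.comp_apply, Equiv.swap_apply_of_ne_of_ne h1 h2]

theorem adm_of (S : Vtx N) (hS : Adm L S) (h1 : S a = !c) (h2 : S b = c) : Adm L' S := by
  intro k hk
  by_cases hka : k = a
  · subst hka; rw [h1, h.left']
  by_cases hkb : k = b
  · subst hkb; rw [h2, h.right', Bool.not_not]
  rw [h.rest k hka hkb] at hk ⊢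
  exact hS k hk

theorem adm (S : Vtx N) (hS : Adm L' S) : Adm L S := by
  intro k hk
  by_cases hka : k = a
  · subst hka; rw [h.left] at hk; cases hk
  by_cases hkb : k = b
  · subst hkb; rw [h.right] at hk; cases hk
  rw [← h.rest k hka hkb] at hk ⊢
  exact hS k hk

theorem bits (S : Vtx N) (hS : Adm L' S) : S a = (!c) ∧ S b = c := by
  have h1 := hS a (by rw [h.left'])
  have h2 := hS b (by rw [h.right'])
  rw [h.left'] at h1
  rw [h.right', Bool.not_not] at h2
  exact ⟨h1, h2⟩

theorem adm_swap (S : Vtx N) (hS : Adm L S) : Adm L (S ∘ swap a b) := by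
  intro k hk
  by_cases hka : k = a
  · subst hka; rw [h.left] at hk; cases hk
  by_cases hkb : k = b
  · subst hkb; rw [h.right] at hk; cases hk
  rw [h.swap_rest S hka hkb]
  exact hS k hk

theorem blVtx_eq : blVtx L' = blVtx L := by
  funext k
  by_cases hka : k = a
  · subst hka; simp [blVtx, h.left, h.left']
  by_cases hkb : k = b
  · subst hkb; simp [blVtx, h.right, h.right']
  simp [blVtx, h.rest k hka hkb]

theorem blVtx_bits : blVtx L a = (!c) ∧ blVtx L b = c := by
  simp [blVtx, h.left, h.right]

theorem shift_eq (S S' : Vtx N)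
    (h3 : ∀ k, k ≠ a → k ≠ b → S' k = S k) (h4 : S' a = !S' b) : shift L S' = shift L' S := by
  unfold shift
  have hb : b ∈ Finset.univ.erase a := Finset.mem_erase.2 ⟨h.ne.symm, Finset.mem_univ b⟩
  rw [← Finset.add_sum_erase _ _ (Finset.mem_univ a), ← Finset.add_sum_erase _ _ hb,
    ← Finset.add_sum_erase Finset.univ (fun k => letterShift (L' k) (S k)) (Finset.mem_univ a),
    ← Finset.add_sum_erase _ (fun k => letterShift (L' k) (S k)) hb]
  have e : ∑ k ∈ (Finset.univ.erase a).erase b, letterShift (L k) (S' k) =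
      ∑ k ∈ (Finset.univ.erase a).erase b, letterShift (L' k) (S k) :=
    Finset.sum_congr rfl fun k hk => by
      rw [Finset.mem_erase, Finset.mem_erase] at hk
      rw [h.rest k hk.2.1 hk.1, h3 k hk.2.1 hk.1]
  rw [e, h.left, h.right, h.left', h.right', h4]
  rw [← add_assoc, ← add_assoc]
  congr 1
  cases c <;> cases S' b <;> simp [letterShift]

theorem dM_idle (f : Ch N n) (S : Vtx N) (ε : Point N n → Bool) :
    dM L' f S ε = ∑ l ∈ (Finset.univ.erase a).erase b, dTerm L l f S ε := by
  unfold dM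
  rw [sum_eq_add_add h.ne]
  have ea : dTerm L' a f S ε = 0 := by simp [dTerm, h.left']
  have eb : dTerm L' b f S ε = 0 := by simp [dTerm, h.right']
  rw [ea, eb, zero_add, zero_add]
  refine Finset.sum_congr rfl fun l hl => ?_
  rw [Finset.mem_erase, Finset.mem_erase] at hl
  unfold dTerm
  rw [h.rest l hl.2.1 hl.1]

theorem dM_eq (f : Ch N n) (S : Vtx N) (ε : Point N n → Bool) :
    dM L f S ε = (if S a = true then vsign S a * kap (some i) (row ε a.castSucc) (row ε a.succ) *
      f (Function.update S a false) ε else 0) +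
      (if S b = true then (vsign S a * if S a = true then -1 else 1) *
        kap (some i) (row ε a.succ) (row ε b.succ) *
      f (Function.update S b false) ε else 0) +
      ∑ l ∈ (Finset.univ.erase a).erase b, dTerm L l f S ε := by
  unfold dM
  rw [sum_eq_add_add h.ne]
  congr 2
  · unfold dTerm; rw [h.left]
  · unfold dTerm; rw [h.right, vsign_succ h.adj, h.adj]

theorem kap_setRow (ε : Point N n → Bool) (z : Row n) {l : Fin N} (h1 : l ≠ a) (h2 : l ≠ b)
    (o : Option (Fin (n - 1))) : kap o (row (setRow ε a.succ z) l.castSucc)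
      (row (setRow ε a.succ z) l.succ) = kap o (row ε l.castSucc) (row ε l.succ) := by
  rw [row_setRow_of_ne, row_setRow_of_ne]
  · simpa using h1
  · rw [h.adj]; simpa using h2

theorem update_swap (S : Vtx N) {l : Fin N} (h1 : l ≠ a) (h2 : l ≠ b) :
    Function.update S l false ∘ swap a b = Function.update (S ∘ swap a b) l false := by
  rw [update_comp_swap, Equiv.swap_apply_of_ne_of_ne h1 h2]

theorem openOp_dTerm (f : Ch N n) (S : Vtx N) (ε : Point N n → Bool) {l : Fin N} (h1 : l ≠ a)
    (h2 : l ≠ b) : openOp i a b c (dTerm L l f) S ε = dTerm L l (openOp i a b c f) S ε := by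
  unfold dTerm
  rw [openOp_apply, openOp_apply, Function.update_of_ne h1.symm, Function.update_of_ne h2.symm,
    row_setRow_of_ne, row_setRow_of_ne, h.swap_rest S h1 h2, h.update_swap S h1 h2]
  · by_cases hl : S l = true
    · simp only [hl, if_true, vsign_comp_swap h.adj S hl h1 h2]
      split_ifs <;> ring
    · simp only [hl, Bool.false_eq_true, if_false]
      split_ifs <;> ring
  · simpa using h1
  · rw [h.adj]; simpa using h2

theorem closeOp_dTerm (f : Ch N n) (S : Vtx N) (ε : Point N n → Bool) {l : Fin N} (h1 : l ≠ a)
    (h2 : l ≠ b) : closeOp i a b (dTerm L l f) S ε = dTerm L l (closeOp i a b f) S ε := by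
  unfold dTerm
  rw [closeOp_apply, closeOp_apply, h.kap_setRow ε _ h1 h2, h.kap_setRow ε _ h1 h2,
    h.swap_rest S h1 h2, h.update_swap S h1 h2]
  by_cases hl : S l = true
  · simp only [hl, if_true, vsign_comp_swap h.adj S hl h1 h2]
    ring
  · simp only [hl, Bool.false_eq_true, if_false]
    ring

theorem row_left (ε : Point N n → Bool) (z : Row n) :
    row (setRow ε a.succ z) a.castSucc = row ε a.castSucc :=
  row_setRow_of_ne ε z (Fin.castSucc_lt_succ).ne

theorem row_right (ε : Point N n → Bool) (z : Row n) :
    row (setRow ε a.succ z) b.succ = row ε b.succ :=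
  row_setRow_of_ne ε z (by rw [h.adj]; exact (Fin.castSucc_lt_succ).ne')

theorem openOp_mem (t : ℝ) (ht : t ∈ Set.Icc (0 : ℝ) 2) {s : ℝ} {f : Ch N n}
    (hf : f ∈ FM L' t s) : openOp i a b c f ∈ FM L t s := by
  intro S hS
  by_cases h1 : S a = (!c) ∧ S b = c
  · have e : shape L' S = shape L S := by
      funext k
      by_cases hka : k = a
      · subst hka; rw [h.shape_left, h.shape_left', if_pos h1.1]
      by_cases hkb : k = b
      · subst hkb; rw [h.shape_right, h.shape_right', if_pos h1.2]
      exact h.shape_rest S k hka hkb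
    have := hf S (h.adm_of S hS h1.1 h1.2)
    rw [e, ← h.shift_eq S S (fun _ _ _ => rfl) (by rw [h1.1, h1.2])] at this
    refine FilU_congr this fun ε _ => ?_
    rw [openOp_apply, if_pos h1]
  by_cases h2 : S a = c ∧ S b = !c
  · have hS' : Adm L' (S ∘ swap a b) := h.adm_of _ (h.adm_swap S hS)
      (by rw [h.swap_left, h2.2]) (by rw [h.swap_right, h2.1])
    have := hf _ hS'
    rw [← h.shift_eq (S ∘ swap a b) S (fun k h3 h4 => (h.swap_rest S h3 h4).symm)
      (by rw [h2.1, h2.2, Bool.not_not])] at this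
    refine FilU_congr (opposite_birth_mem_FilU ht (u' := shape L S) (i := i) h.adj (h.shape_left' _)
      (h.shape_right' _) (by rw [h.shape_left, h2.1, if_neg (by simp)])
      (by rw [h.shape_right, h2.2, if_neg (by simp)]) (fun l h3 h4 => ?_) this) fun ε _ => ?_
    · rw [h.shape_rest _ l h3 h4]
      simp only [shape, h.swap_rest S h3 h4]
    · rw [openOp_apply, if_neg h1, if_pos h2]
  · refine FilU_congr (zero_mem _) fun ε _ => ?_
    rw [openOp_apply, if_neg h1, if_neg h2]
    rfl

theorem closeOp_mem (t : ℝ) (ht : t ∈ Set.Icc (0 : ℝ) 2) {s : ℝ} {f : Ch N n}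
    (hf : f ∈ FM L t s) : closeOp i a b f ∈ FM L' t s := by
  intro S hS
  obtain ⟨h1, h2⟩ := h.bits S hS
  have e : shape L' S = shape L S := by
    funext k
    by_cases hka : k = a
    · subst hka; rw [h.shape_left, h.shape_left', if_pos h1]
    by_cases hkb : k = b
    · subst hkb; rw [h.shape_right, h.shape_right', if_pos h2]
    exact h.shape_rest S k hka hkb
  have hf1 := hf S (h.adm S hS)
  have hf2 := hf (S ∘ swap a b) (h.adm_swap S (h.adm S hS))
  rw [h.shift_eq S S (fun _ _ _ => rfl) (by rw [h1, h2]), ← e] at hf1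
  rw [h.shift_eq S (S ∘ swap a b) (fun k h3 h4 => h.swap_rest S h3 h4)
    (by rw [h.swap_left, h.swap_right, h1, h2, Bool.not_not])] at hf2
  refine FilU_congr (sub_mem hf1 (opposite_death_mem_FilU ht (u := shape L' S) (i := i) h.adj
    (h.shape_left' _) (h.shape_right' _)
    (by rw [h.shape_left, h.swap_left, h2, if_neg (by simp)])
    (by rw [h.shape_right, h.swap_right, h1, if_neg (by simp)]) (fun l h3 h4 => ?_) hf2))
    fun ε _ => ?_
  · rw [h.shape_rest _ l h3 h4]
    simp only [shape, h.swap_rest S h3 h4]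
  · rw [closeOp_apply]; rfl

theorem openOp_canM (S : Vtx N) (ε : Point N n → Bool) :
    openOp i a b c (canM L') S ε = canM L S ε := by
  rw [openOp_apply]
  unfold canM
  rw [h.blVtx_eq]
  have hbits := h.blVtx_bits
  by_cases h1 : S a = (!c) ∧ S b = c
  · rw [if_pos h1]
  have hS : S ≠ blVtx L := fun e => h1 (by rw [e]; exact hbits)
  rw [if_neg h1]
  simp only [hS, false_and, if_false]
  by_cases h2 : S a = c ∧ S b = !c
  · rw [if_pos h2]
    split_ifs with h3
    · rw [← h.row_left ε (row ε b.succ), h3.2, kap_altCol]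
      ring
    · ring
  · rw [if_neg h2]

theorem closeOp_canM (S : Vtx N) (hS : Adm L' S) (ε : Point N n → Bool) :
    closeOp i a b (canM L) S ε = canM L' S ε := by
  have h1 : S ∘ swap a b ≠ blVtx L := fun e => by
    have h2 := h.swap_left S
    rw [e, h.blVtx_bits.1, (h.bits S hS).2] at h2
    simp at h2
  rw [closeOp_apply]
  unfold canM
  rw [h.blVtx_eq]
  simp [h1]

theorem openOp_dM (f : Ch N n) (S : Vtx N) (ε : Point N n → Bool)
    (hε : Col (shape L S) ε) : openOp i a b c (dM L' f) S ε = dM L (openOp i a b c f) S ε := by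
  have hd : dM L' f = ∑ l ∈ (Finset.univ.erase a).erase b, dTerm L l f := by
    funext S ε
    rw [h.dM_idle, Finset.sum_apply, Finset.sum_apply]
  rw [hd, map_sum, Finset.sum_apply, Finset.sum_apply, h.dM_eq]
  have hr : ∑ l ∈ (Finset.univ.erase a).erase b, openOp i a b c (dTerm L l f) S ε =
      ∑ l ∈ (Finset.univ.erase a).erase b, dTerm L l (openOp i a b c f) S ε :=
    Finset.sum_congr rfl fun l hl => by
      rw [Finset.mem_erase, Finset.mem_erase] at hl
      exact h.openOp_dTerm f S ε hl.2.1 hl.1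
  rw [hr]
  rw [right_eq_add]
  rw [openOp_apply, openOp_apply]
  simp only [Function.update_self, Function.update_of_ne h.ne, Function.update_of_ne h.ne.symm]
  have e1 := hε.layer (h.shape_left S)
  have e2 := hε.layer (h.shape_right S)
  rw [← h.adj] at e2
  have hs1 : S a = true → S b = true → Function.update S b false ∘ swap a b = Function.update S a false := by
    intro h1 h2
    rw [update_comp_swap, Equiv.swap_apply_right]
    congr 1
    funext k
    by_cases hka : k = a
    · subst hka; simp [h1, h2]
    by_cases hkb : k = b
    · subst hkb; simp [h1, h2]
    exact h.swap_rest S hka hkb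
  have hs2 : S a = true → S b = true → Function.update S a false ∘ swap a b = Function.update S b false := by
    intro h1 h2
    rw [update_comp_swap, Equiv.swap_apply_left]
    congr 1
    funext k
    by_cases hka : k = a
    · subst hka; simp [h1, h2]
    by_cases hkb : k = b
    · subst hkb; simp [h1, h2]
    exact h.swap_rest S hka hkb
  rcases ha : S a with _ | _ <;> rcases hb : S b with _ | _ <;> cases c <;>
    simp only [ha, hb, Bool.not_true, Bool.not_false, Bool.false_eq_true, if_true, if_false,
      and_self, and_true, and_false, mul_zero, add_zero, reduceCtorEq] at e1 e2 ⊢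
  · by_cases hk : row ε a.castSucc = row ε b.succ ∧
        row ε a.castSucc (leftPos i) = row ε a.castSucc (rightPos i)
    · have e3 : row ε a.castSucc = row ε a.succ := e1
      rw [← hk.1, ← e3, setRow_eq_self e3.symm, kap_self hk.2, hs2 ha hb]
      have h4 : ε (a.succ, leftPos i) = row ε a.castSucc (leftPos i) := (congrFun e3 _).symm
      rw [h4]
      field_simp [nu_ne_zero]
      ring
    · rw [kap_eq_zero hk, show row ε a.succ = row ε a.castSucc from Eq.symm e1, kap_eq_zero hk]
      ring
  · by_cases hk : row ε a.castSucc = row ε b.succ ∧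
        row ε a.castSucc (leftPos i) = row ε a.castSucc (rightPos i)
    · have e3 : row ε a.succ = row ε b.succ := e2
      rw [← e3, setRow_eq_self rfl, e3, ← hk.1, kap_self hk.2, hs1 ha hb]
      have h4 : ε (a.succ, leftPos i) = row ε a.castSucc (leftPos i) := by
        rw [hk.1, ← e3]; rfl
      rw [h4]
      field_simp [nu_ne_zero]
      ring
    · rw [kap_eq_zero hk, show row ε a.succ = row ε b.succ from e2, kap_eq_zero hk]
      ring

theorem closeOp_dM (f : Ch N n) (S : Vtx N) (hS : Adm L' S) (ε : Point N n → Bool)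
    (hε : Col (shape L' S) ε) : closeOp i a b (dM L f) S ε = dM L' (closeOp i a b f) S ε := by
  rw [h.dM_idle]
  have hr : ∑ l ∈ (Finset.univ.erase a).erase b, dTerm L l (closeOp i a b f) S ε =
      ∑ l ∈ (Finset.univ.erase a).erase b, closeOp i a b (dTerm L l f) S ε :=
    Finset.sum_congr rfl fun l hl => by
      rw [Finset.mem_erase, Finset.mem_erase] at hl
      exact (h.closeOp_dTerm f S ε hl.2.1 hl.1).symm
  have hd : dM L f = dTerm L a f + dTerm L b f +
      ∑ l ∈ (Finset.univ.erase a).erase b, dTerm L l f := by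
    funext S ε
    simp only [Pi.add_apply, Finset.sum_apply]
    exact sum_eq_add_add h.ne _
  rw [hr, hd, map_add, map_sum]
  simp only [Pi.add_apply, Finset.sum_apply]
  rw [add_eq_right]
  have e1 := hε.layer (h.shape_left' S)
  have e2 := hε.layer (h.shape_right' S)
  rw [← h.adj] at e2
  change row ε a.castSucc = row ε a.succ at e1
  change row ε a.succ = row ε b.succ at e2
  rw [closeOp_apply]
  simp only [Pi.add_apply]
  unfold dTerm
  rw [h.left, h.right, vsign_succ h.adj S, vsign_succ h.adj (S ∘ swap a b), h.swap_left,
    h.swap_right, h.row_left, h.row_left, ← h.adj, row_setRow_self, row_setRow_self, h.row_right,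
    h.row_right, ← e2, e1]
  obtain ⟨ha, hb⟩ := h.bits S hS
  have hsg : vsign (S ∘ swap a b) a = vsign S a := vsign_congr fun k hk => by
    have h1 : k ≠ b := fun e => by
      have := congrArg Fin.val h.adj
      rw [e, Fin.lt_def] at hk; simp at this; omega
    exact h.swap_rest S hk.ne h1
  have hs1 : Function.update (S ∘ swap a b) a false = Function.update S b false ∘ swap a b := by
    rw [update_comp_swap, Equiv.swap_apply_right]
  have hs2 : Function.update (S ∘ swap a b) b false = Function.update S a false ∘ swap a b := by
    rw [update_comp_swap, Equiv.swap_apply_left]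
  have hs3 : S b = true → S a = false →
      Function.update S b false ∘ swap a b = Function.update S b false := fun h1 h2 => by
    funext k
    by_cases hka : k = a
    · subst hka; simp [h2, h.ne]
    by_cases hkb : k = b
    · subst hkb; simp [h2, h.ne]
    rw [h.swap_rest _ hka hkb]
  have hs4 : S b = false → S a = true →
      Function.update S a false ∘ swap a b = Function.update S a false := fun h1 h2 => by
    funext k
    by_cases hka : k = a
    · subst hka; simp [h1, h.ne.symm]
    by_cases hkb : k = b
    · subst hkb; simp [h1, h.ne.symm]
    rw [h.swap_rest _ hka hkb]
  by_cases hk : row ε a.succ (leftPos i) = row ε a.succ (rightPos i)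
  · have hz : ∀ o, kap (some i) (row ε a.succ) (fill i o (row ε a.succ)) =
        if row ε a.succ (leftPos i) = o then nu o else 0 := fun o => by
      by_cases h1 : row ε a.succ (leftPos i) = o
      · rw [kap_some, if_pos (eq_fill_iff.2 ⟨hk, h1⟩), if_pos h1, h1]
      · rw [if_neg h1, kap_eq_zero fun h2 => h1 (eq_fill_iff.1 h2).2]
    have hz' : ∀ o, kap (some i) (fill i o (row ε a.succ)) (row ε a.succ) =
        if row ε a.succ (leftPos i) = o then nu o else 0 := fun o => by
      rw [← hz, kap_some, kap_some, fill_left, fill_right]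
      by_cases h1 : row ε a.succ = fill i o (row ε a.succ)
      · rw [← h1]
        have h2 : row ε a.succ (leftPos i) = o := by rw [h1, fill_left]
        simp [hk, ← h2]
      · simp [h1, Ne.symm h1]
    have hf : setRow ε a.succ (fill i (row ε a.succ (leftPos i)) (row ε a.succ)) = ε := by
      rw [fill_self hk, setRow_row]
    rw [hz, hz, hz', hz', kap_self hk, hs1, hs2, hsg]
    rcases hb' : S b with _ | _ <;> rw [hb'] at hb <;> subst hb <;>
      simp only [Bool.not_true, Bool.not_false] at ha
    · rcases ho : row ε a.succ (leftPos i) with _ | _ <;> rw [ho] at hf <;>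
        simp only [hs4 hb' ha, ha, hf, if_true, if_false, Bool.false_eq_true, reduceCtorEq] <;>
        field_simp [nu_ne_zero] <;> ring
    · rcases ho : row ε a.succ (leftPos i) with _ | _ <;> rw [ho] at hf <;>
        simp only [hs3 hb' ha, ha, hf, if_true, if_false, Bool.false_eq_true, reduceCtorEq] <;>
        field_simp [nu_ne_zero] <;> ring
  · rw [kap_eq_zero fun h' => hk h'.2]
    simp

/-- Two opposite crossings can be replaced by idle layers. -/
theorem levelsM_eq {t : ℝ} (ht : t ∈ Set.Icc (0 : ℝ) 2) : levelsM L t = levelsM L' t := by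
  refine Set.Subset.antisymm (fun s hs => ?_) fun s hs => ?_ <;> rw [← sub_zero s]
  · refine levelsM_of_map (closeOp i a b) one_ne_zero (fun s f hf => ?_) (fun S hS ε _ => ?_)
      (fun f S hS ε hε => h.closeOp_dM f S hS ε hε) hs
    · rw [sub_zero]; exact h.closeOp_mem t ht hf
    · rw [one_mul]; exact h.closeOp_canM S hS ε
  · refine levelsM_of_map (openOp i a b c) one_ne_zero (fun s f hf => ?_) (fun S hS ε _ => ?_)
      (fun f S hS ε hε => h.openOp_dM f S ε hε) hs
    · rw [sub_zero]; exact h.openOp_mem t ht hf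
    · rw [one_mul]; exact h.openOp_canM S ε

end IsCancel

end Cancel

section TripleLocal

variable {n : ℕ}

/-- Functions of the resolutions of three layers and of the two rows between them. -/
abbrev Loc (n : ℕ) : Type := Bool → Bool → Bool → Row n → Row n → ℂ

/-- The part of the differential that changes one of three layers. -/
def dLoc (o₁ o₂ o₃ : Option (Fin (n - 1))) (x y : Row n) (F : Loc n) : Loc n := fun p q r z₁ z₂ =>
  (if p then kap o₁ x z₁ * F false q r z₁ z₂ else 0) +
  (if q then (if p then -1 else 1) * kap o₂ z₁ z₂ * F p false r z₁ z₂ else 0) +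
  (if r then (if p then -1 else 1) * (if q then -1 else 1) * kap o₃ z₂ y * F p q false z₁ z₂ else 0)

/-- The death of the circle between two layers. -/
def capLoc (i : Fin (n - 1)) (x : Row n) (F : Row n → Row n → ℂ) : ℂ :=
  (nu true)⁻¹ * F (fill i true x) (fill i true x) +
    (nu false)⁻¹ * F (fill i false x) (fill i false x)

/-- The chain map of the third Reidemeister move, on three layers. -/
def braidLoc (i j : Fin (n - 1)) (x y : Row n) (F : Loc n) : Loc n
  | false, false, false, z₁, z₂ => F false false false z₁ z₂
  | false, true, false, _, _ => F true false false y y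
  | false, false, true, _, _ => F false true false x y
  | true, false, false, _, _ => F false true false x y
  | false, true, true, _, z₂ => F true true false z₂ y
  | true, true, false, z₁, _ => F false true true x z₁ -
      kap (some j) x z₁ * capLoc i x (F true false true)
  | true, false, true, z₁, _ => (nu (z₁ (leftPos j)))⁻¹ *
      (kap (some i) x x * F true true false x y + kap (some i) y y * F false true true x y -
        kap (some j) x y * kap (some i) y y * capLoc i x (F true false true))
  | true, true, true, _, _ => 0

/-- The two positions of a letter, in either order. -/
def IsPair (i : Fin (n - 1)) (p s : Fin n) : Prop :=
  (leftPos i = p ∧ rightPos i = s) ∨ (leftPos i = s ∧ rightPos i = p)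

variable {i j : Fin (n - 1)} {p s q : Fin n}

theorem IsPair.ne (h : IsPair i p s) : p ≠ s := by
  rcases h with ⟨rfl, rfl⟩ | ⟨rfl, rfl⟩
  · exact leftPos_ne_rightPos i
  · exact (leftPos_ne_rightPos i).symm

theorem IsPair.layerOK (h : IsPair i p s) {X Y : Row n} : LayerOK (some i) X Y ↔
    X p = X s ∧ Y p = Y s ∧ ∀ r, r ≠ p → r ≠ s → X r = Y r := by
  rcases h with ⟨rfl, rfl⟩ | ⟨rfl, rfl⟩
  · rfl
  · unfold LayerOK
    rw [eq_comm (a := X (rightPos i)), eq_comm (a := Y (rightPos i))]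
    exact and_congr Iff.rfl (and_congr Iff.rfl (forall_congr' fun r =>
      ⟨fun h h1 h2 => h h2 h1, fun h h1 h2 => h h2 h1⟩))

theorem IsPair.kap_eq (h : IsPair i p s) (X Y : Row n) :
    kap (some i) X Y = if X = Y ∧ X p = X s then nu (X s) else 0 := by
  rcases h with ⟨rfl, rfl⟩ | ⟨rfl, rfl⟩ <;> rw [kap_some]
  · split_ifs with h
    · rw [h.2]
    · rfl
  · simp only [eq_comm (a := X (rightPos i))]

theorem IsPair.apply_left (h : IsPair i p s) {X Y : Row n} (hX : LayerOK (some i) X Y) :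
    X (leftPos i) = X s := by
  rcases h with ⟨rfl, rfl⟩ | ⟨rfl, rfl⟩
  · exact hX.1
  · rfl

theorem IsPair.eq_iff (h : IsPair i p s) {X Y : Row n} (hX : LayerOK (some i) X Y) :
    X = Y ↔ X s = Y s := by
  refine ⟨fun e => by rw [e], fun e => ?_⟩
  obtain ⟨h1, h2, h3⟩ := h.layerOK.1 hX
  funext r
  by_cases hr : r = p
  · subst hr; rw [h1, h2, e]
  by_cases hs : r = s
  · subst hs; exact e
  exact h3 r hr hs

theorem IsPair.kap_layer (h : IsPair i p s) {X Y : Row n} (hX : LayerOK (some i) X Y) :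
    kap (some i) X Y = if X s = Y s then nu (X s) else 0 := by
  rw [h.kap_eq]
  simp only [h.eq_iff hX, (h.layerOK.1 hX).1, and_true]

theorem kap_comm (i : Fin (n - 1)) (X Y : Row n) : kap (some i) X Y = kap (some i) Y X := by
  rw [kap_some, kap_some]
  by_cases h : X = Y
  · rw [h]
  · simp [h, Ne.symm h]

theorem kap_eq_or (i : Fin (n - 1)) (X Y : Row n) :
    kap (some i) X Y = 0 ∨ (X = Y ∧ X (leftPos i) = X (rightPos i)) := by
  by_cases h : X = Y ∧ X (leftPos i) = X (rightPos i)
  · exact Or.inr h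
  · exact Or.inl (kap_eq_zero h)

/-- The death of a circle after a split that creates it. -/
theorem capLoc_kap (i : Fin (n - 1)) {x y : Row n} (h : LayerOK (some i) x y) (F : Row n → ℂ) :
    capLoc i x (fun z _ => kap (some i) z y * F z) = F y := by
  obtain ⟨h1, h2, h3⟩ := h
  have hf : ∀ o, kap (some i) (fill i o x) y = if y (leftPos i) = o then nu o else 0 := fun o => by
    rw [kap_some]
    have : (fill i o x = y ∧ fill i o x (leftPos i) = fill i o x (rightPos i)) ↔
        y (leftPos i) = o := by
      constructor
      · rintro ⟨e, -⟩; rw [← e, fill_left]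
      · rintro rfl
        refine ⟨?_, by rw [fill_left, fill_right]⟩
        funext r
        unfold fill
        split_ifs with hr
        · rcases hr with rfl | rfl
          · rfl
          · exact h2
        · push Not at hr
          exact h3 r hr.1 hr.2
    by_cases hy : y (leftPos i) = o
    · rw [if_pos (this.2 hy), if_pos hy, fill_left]
    · rw [if_neg fun h => hy (this.1 h), if_neg hy]
  have hy : fill i (y (leftPos i)) x = y := by
    funext r
    unfold fill
    split_ifs with hr
    · rcases hr with rfl | rfl
      · rfl
      · exact h2
    · push Not at hr
      exact h3 r hr.1 hr.2
  simp only [capLoc, hf]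
  rcases ho : y (leftPos i) with _ | _ <;> rw [ho] at hy <;> simp only [hy, if_true, if_false,
    Bool.false_eq_true, reduceCtorEq] <;> field_simp [nu_ne_zero] <;> ring

theorem capLoc_dLoc {i j : Fin (n - 1)} {x y : Row n} (hxx : LayerOK (some i) x x)
    (hxy : LayerOK (some i) x y) (F : Loc n) :
    capLoc i x (dLoc (some i) (some j) (some i) x y F true false true) =
      F false false true x x - F true false false y y := by
  have h1 := capLoc_kap i hxx fun z => F false false true z z
  have h2 := capLoc_kap i hxy fun z => F true false false z z
  rw [← h1, ← h2]
  simp only [capLoc, dLoc, if_true, if_false, Bool.false_eq_true, kap_comm i x]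
  ring

theorem nu_sq_sub (X Y O : Bool) : (nu O)⁻¹ * (sg X - sg Y) =
    (if X = O then nu X else 0) - if O = Y then nu O else 0 := by
  have h : ∀ b : Bool, (nu b)⁻¹ * (2 * sg b) = nu b := fun b => by
    rw [← nu_mul_self, inv_mul_cancel_left₀ (nu_ne_zero b)]
  have ht : sg true = 1 := rfl
  have hf : sg false = -1 := rfl
  have h1 := h true
  have h2 := h false
  rw [ht] at h1
  rw [hf] at h2
  cases X <;> cases Y <;> cases O <;> simp [ht, hf] <;> first | linear_combination h1 | linear_combination h2 | linear_combination -h1 | linear_combination -h2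

theorem IsPair.kap_sq (h : IsPair i p s) (X : Row n) :
    kap (some i) X X * kap (some i) X X = sg (X p) + sg (X s) := by
  rw [h.kap_eq]
  by_cases hX : X p = X s
  · rw [if_pos ⟨rfl, hX⟩, nu_mul_self, hX]; ring
  · rw [if_neg fun h => hX h.2]
    cases hp : X p <;> cases hs : X s <;> simp_all [sg]

theorem braidLoc_dLoc (hi : IsPair i p s) (hj : IsPair j q s) (hpq : p ≠ q) (x y z₁ z₂ : Row n)
    (F : Loc n) (b₁ b₂ b₃ : Bool) (h₁ : LayerOK (if b₁ then some j else none) x z₁)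
    (h₂ : LayerOK (if b₂ then some i else none) z₁ z₂)
    (h₃ : LayerOK (if b₃ then some j else none) z₂ y) :
    braidLoc i j x y (dLoc (some i) (some j) (some i) x y F) b₁ b₂ b₃ z₁ z₂ =
      dLoc (some j) (some i) (some j) x y (braidLoc i j x y F) b₁ b₂ b₃ z₁ z₂ := by
  cases b₁ <;> cases b₂ <;> cases b₃ <;>
    simp only [if_true, if_false, Bool.false_eq_true] at h₁ h₂ h₃
  · simp [braidLoc, dLoc]
  · change x = z₁ at h₁
    change z₁ = z₂ at h₂
    subst h₁ h₂
    simp only [braidLoc, dLoc, if_true, if_false, Bool.false_eq_true, zero_add, add_zero, one_mul]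
    rcases kap_eq_or j x y with e | e
    · rw [e]; ring
    · rw [e.1]
  · change x = z₁ at h₁
    change z₂ = y at h₃
    subst h₁ h₃
    simp only [braidLoc, dLoc, if_true, if_false, Bool.false_eq_true, zero_add, add_zero, one_mul]
    rcases kap_eq_or i x z₂ with e | e
    · rw [e]; ring
    · rw [e.1]
  · change x = z₁ at h₁
    subst h₁
    simp only [braidLoc, dLoc, if_true, if_false, Bool.false_eq_true, zero_add, add_zero, one_mul]
    have key1 : kap (some i) x z₂ * F false true false z₂ y =
        kap (some i) x z₂ * F false true false x y := by
      rcases kap_eq_or i x z₂ with e | e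
      · rw [e]; ring
      · rw [e.1]
    have key2 : kap (some j) z₂ y * F true false false z₂ y =
        kap (some j) z₂ y * F true false false y y := by
      rcases kap_eq_or j z₂ y with e | e
      · rw [e]; ring
      · rw [e.1]
    linear_combination key1 - key2
  · change z₁ = z₂ at h₂
    change z₂ = y at h₃
    subst h₃ h₂
    simp only [braidLoc, dLoc, if_true, if_false, Bool.false_eq_true, zero_add, add_zero, one_mul]
    rcases kap_eq_or j x z₁ with e | e
    · rw [e]; ring
    · rw [e.1]
  · change z₁ = z₂ at h₂
    subst h₂
    have hxy : LayerOK (some j) x y := by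
      obtain ⟨a1, a2, a3⟩ := hj.layerOK.1 h₁
      obtain ⟨b1, b2, b3⟩ := hj.layerOK.1 h₃
      exact hj.layerOK.2 ⟨a1, b2, fun r hr hs => (a3 r hr hs).trans (b3 r hr hs)⟩
    have hp : x p = y p := (hj.layerOK.1 hxy).2.2 p hpq hi.ne
    have hsq := nu_sq_sub (x s) (y s) (z₁ s)
    have hO : z₁ (leftPos j) = z₁ s := hj.apply_left h₁.symm
    have hx := hi.kap_sq x
    have hy := hi.kap_sq y
    simp only [braidLoc, dLoc, if_true, if_false, Bool.false_eq_true, zero_add, add_zero, one_mul,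
      hO, hj.kap_layer h₁, hj.kap_layer h₃]
    have key : kap (some j) x y * (kap (some i) y y * capLoc i x
        (dLoc (some i) (some j) (some i) x y F true false true)) =
        kap (some j) x y * (kap (some i) y y * F false false true x y -
          kap (some i) x x * F true false false x y) := by
      rcases kap_eq_or j x y with e | ⟨e, -⟩
      · rw [e]; ring
      subst e
      rcases kap_eq_or i x x with e | ⟨-, e⟩
      · rw [e]; ring
      rw [capLoc_dLoc ⟨e, e, fun _ _ _ => rfl⟩ ⟨e, e, fun _ _ _ => rfl⟩]
      ring
    simp only [mul_one]
    rw [hp] at hx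
    linear_combination (-(nu (z₁ s))⁻¹) * key + F false true false x y * hsq +
      (nu (z₁ s))⁻¹ * F false true false x y * hx - (nu (z₁ s))⁻¹ * F false true false x y * hy
  · change z₂ = y at h₃
    subst h₃
    have key : kap (some j) x z₁ * capLoc i x
        (dLoc (some i) (some j) (some i) x z₂ F true false true) =
        kap (some j) x z₁ * (F false false true x z₁ - F true false false z₂ z₂) := by
      rcases kap_eq_or j x z₁ with e | ⟨e, -⟩
      · rw [e]; ring
      subst e
      rw [capLoc_dLoc ⟨h₂.1, h₂.1, fun _ _ _ => rfl⟩ h₂]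
    have key2 : kap (some i) z₁ z₂ * F false true false x z₁ =
        kap (some i) z₁ z₂ * F false true false x z₂ := by
      rcases kap_eq_or i z₁ z₂ with e | ⟨e, -⟩
      · rw [e]; ring
      rw [e]
    simp only [braidLoc]
    rw [key]
    simp only [braidLoc, dLoc, if_true, if_false, Bool.false_eq_true, zero_add, add_zero, one_mul]
    linear_combination (-1) * key2
  · obtain ⟨a1, a2, a3⟩ := hj.layerOK.1 h₁
    obtain ⟨b1, b2, b3⟩ := hi.layerOK.1 h₂
    obtain ⟨c1, c2, c3⟩ := hj.layerOK.1 h₃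
    have hq : z₁ q = z₂ q := b3 q hpq.symm hj.ne
    have hz : z₁ = z₂ := (hi.eq_iff h₂).2 (by rw [← a2, hq, c1])
    subst hz
    have hO : z₁ (leftPos j) = z₁ s := hj.apply_left h₁.symm
    have hxp : x p = z₁ s := (a3 p hpq hi.ne).trans b1
    have hyp : y p = z₁ s := (c3 p hpq hi.ne).symm.trans b1
    have e1 : kap (some i) x x = kap (some j) x z₁ := by
      rw [hi.kap_eq, hj.kap_layer h₁, hxp]
      by_cases h : x s = z₁ s
      · simp [h]
      · simp [h, Ne.symm h]
    have e2 : kap (some i) y y = kap (some j) z₁ y := by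
      rw [hi.kap_eq, hj.kap_layer h₃, hyp]
      by_cases h : z₁ s = y s
      · simp [h]
      · simp [h]
    have e3 : kap (some i) z₁ z₁ = nu (z₁ s) := by
      rw [hi.kap_eq, if_pos ⟨rfl, b1⟩]
    have key1 : kap (some j) x z₁ * F true true false z₁ y =
        kap (some j) x z₁ * F true true false x y := by
      rcases kap_eq_or j x z₁ with e | ⟨e, -⟩
      · rw [e]; ring
      · rw [e]
    have key2 : kap (some j) z₁ y * F false true true x z₁ =
        kap (some j) z₁ y * F false true true x y := by
      rcases kap_eq_or j z₁ y with e | ⟨e, -⟩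
      · rw [e]; ring
      · rw [e]
    have key3 : kap (some j) x y * kap (some j) z₁ y = kap (some j) x z₁ * kap (some j) z₁ y := by
      rcases kap_eq_or j z₁ y with e | ⟨e, -⟩
      · rw [e]; ring
      · rw [e]
    have hn := nu_ne_zero (z₁ s)
    simp only [braidLoc, dLoc, if_true, hO, e1, e2, e3]
    field_simp
    linear_combination (-1) * key1 - key2 - capLoc i x (F true false true) * key3

end TripleLocal

section TripleFiltered

variable {N n : ℕ}

/-- Moving a letter one layer up past an idle layer. -/
theorem shift_up_mem_FilU {u u' : Shape N n} {a b : Fin N} (hab : a.succ = b.castSucc)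
    (hb : u b = none) (ha' : u' a = none) (hb' : u' b = u a)
    (hu : ∀ l, l ≠ a → l ≠ b → u' l = u l) {t w : ℝ} {f : (Point N n → Bool) → ℂ}
    (hf : f ∈ FilU t u w) : (fun ε => f (setRow ε a.succ (row ε b.succ))) ∈ FilU t u' w := by
  refine FilU_congr (exchange_mem_FilU hab (far_none_right (u a)) (Or.inr rfl) (Or.inl hb)
    (ha'.trans hb.symm) hb' hu hf) fun ε hε => ?_
  congr 1
  have e1 : row ε a.castSucc = row ε a.succ := hε.layer ha'
  have e2 := hε.layer hb'
  rw [← hab, ← e1] at e2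
  refine ext_row fun k => ?_
  by_cases hk : k = a.succ
  · subst hk
    rw [row_midPt_self, row_setRow_self]
    funext p
    unfold mid
    split_ifs with hp
    · rfl
    · exact (e2.eq_of_not_supp hp).symm
  · rw [row_midPt_of_ne _ _ _ _ hk, row_setRow_of_ne _ _ hk]

/-- Moving a letter one layer down past an idle layer. -/
theorem shift_down_mem_FilU {u u' : Shape N n} {a b : Fin N} (hab : a.succ = b.castSucc)
    (ha : u a = none) (ha' : u' a = u b) (hb' : u' b = none)
    (hu : ∀ l, l ≠ a → l ≠ b → u' l = u l) {t w : ℝ} {f : (Point N n → Bool) → ℂ}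
    (hf : f ∈ FilU t u w) : (fun ε => f (setRow ε a.succ (row ε a.castSucc))) ∈ FilU t u' w := by
  refine FilU_congr (exchange_mem_FilU hab (far_none_left (u b)) (Or.inl ha) (Or.inr rfl)
    ha' (hb'.trans ha.symm) hu hf) fun ε hε => ?_
  congr 1
  refine ext_row fun k => ?_
  by_cases hk : k = a.succ
  · subst hk
    rw [row_midPt_self, row_setRow_self]
    funext p
    rw [mid_of_not (not_supp_none p)]
  · rw [row_midPt_of_ne _ _ _ _ hk, row_setRow_of_ne _ _ hk]

/-- Replace three layers. -/
def tri (a b c : Fin N) (u : Shape N n) (o₁ o₂ o₃ : Option (Fin (n - 1))) : Shape N n := fun l =>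
  if l = a then o₁ else if l = b then o₂ else if l = c then o₃ else u l

/-- Three consecutive layers. -/
structure Consec (a b c : Fin N) : Prop where
  left : a.succ = b.castSucc
  right : b.succ = c.castSucc

namespace Consec

variable {a b c : Fin N} (h : Consec a b c) {u : Shape N n} {o₁ o₂ o₃ : Option (Fin (n - 1))}
include h

theorem val : (a : ℕ) + 1 = b ∧ (b : ℕ) + 1 = c := by
  have h1 := congrArg Fin.val h.left
  have h2 := congrArg Fin.val h.right
  exact ⟨by simpa using h1, by simpa using h2⟩

theorem ne₁ : a ≠ b := succ_ne_of_adjacent h.left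

theorem ne₂ : b ≠ c := succ_ne_of_adjacent h.right

theorem ne₃ : a ≠ c := fun e => by have := h.val; rw [e] at this; omega

theorem lt : a < c := by rw [Fin.lt_def]; have := h.val; omega

theorem between {k : Fin N} (h1 : a < k) (h2 : k < c) : k = b := by
  have := h.val
  rw [Fin.lt_def] at h1 h2
  exact Fin.ext (by omega)

theorem tri_left : tri a b c u o₁ o₂ o₃ a = o₁ := if_pos rfl

theorem tri_mid : tri a b c u o₁ o₂ o₃ b = o₂ := by
  simp [tri, h.ne₁.symm]

theorem tri_right : tri a b c u o₁ o₂ o₃ c = o₃ := by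
  simp [tri, h.ne₃.symm, h.ne₂.symm]

theorem heights : a.castSucc ≠ a.succ ∧ a.castSucc ≠ b.succ ∧ a.succ ≠ b.succ ∧ c.succ ≠ a.succ ∧
    c.succ ≠ b.succ := by
  have := h.val
  simp only [ne_eq, Fin.ext_iff, Fin.val_succ, Fin.val_castSucc]
  omega

theorem setRows_eq (ε : Point N n → Bool) (z₁ z₂ : Row n) {h' : Fin (N + 1)} (h1 : h' ≠ a.succ)
    (h2 : h' ≠ b.succ) : row (setRow (setRow ε a.succ z₁) b.succ z₂) h' = row ε h' := by
  rw [row_setRow_of_ne _ _ h2, row_setRow_of_ne _ _ h1]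

theorem row_x (ε : Point N n → Bool) (z₁ z₂ : Row n) :
    row (setRow (setRow ε a.succ z₁) b.succ z₂) a.castSucc = row ε a.castSucc :=
  h.setRows_eq ε z₁ z₂ h.heights.1 h.heights.2.1

theorem row_y (ε : Point N n → Bool) (z₁ z₂ : Row n) :
    row (setRow (setRow ε a.succ z₁) b.succ z₂) c.succ = row ε c.succ :=
  h.setRows_eq ε z₁ z₂ h.heights.2.2.2.1 h.heights.2.2.2.2

theorem row_z₁ (ε : Point N n → Bool) (z₁ z₂ : Row n) :
    row (setRow (setRow ε a.succ z₁) b.succ z₂) a.succ = z₁ := by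
  rw [row_setRow_of_ne _ _ h.heights.2.2.1, row_setRow_self]

theorem row_z₂ (ε : Point N n → Bool) (z₁ z₂ : Row n) :
    row (setRow (setRow ε a.succ z₁) b.succ z₂) b.succ = z₂ := row_setRow_self _ _ _

theorem setRows_setRows (ε : Point N n → Bool) (z₁ z₂ z₁' z₂' : Row n) :
    setRow (setRow (setRow (setRow ε a.succ z₁) b.succ z₂) a.succ z₁') b.succ z₂' =
      setRow (setRow ε a.succ z₁') b.succ z₂' := by
  rw [setRow_comm _ h.heights.2.2.1.symm, setRow_setRow, setRow_setRow]

theorem setRow_left (ε : Point N n → Bool) (z₁ : Row n) :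
    setRow ε a.succ z₁ = setRow (setRow ε a.succ z₁) b.succ (row ε b.succ) := by
  rw [setRow_eq_self (row_setRow_of_ne _ _ h.heights.2.2.1.symm)]

theorem setRow_right (ε : Point N n → Bool) (z₂ : Row n) :
    setRow ε b.succ z₂ = setRow (setRow ε a.succ (row ε a.succ)) b.succ z₂ := by
  rw [setRow_row]

variable {t w : ℝ} {f : (Point N n → Bool) → ℂ}

theorem up_left (hf : f ∈ FilU t (tri a b c u o₁ none o₃) w) :
    (fun ε => f (setRow (setRow ε a.succ (row ε b.succ)) b.succ (row ε b.succ))) ∈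
      FilU t (tri a b c u none o₁ o₃) w := by
  refine FilU_congr (shift_up_mem_FilU h.left h.tri_mid h.tri_left
    (h.tri_mid.trans h.tri_left.symm) (fun l h1 h2 => by simp [tri, h1, h2]) hf) fun ε _ => ?_
  rw [← h.setRow_left]

theorem up_right (hf : f ∈ FilU t (tri a b c u o₁ o₂ none) w) :
    (fun ε => f (setRow (setRow ε a.succ (row ε a.succ)) b.succ (row ε c.succ))) ∈
      FilU t (tri a b c u o₁ none o₂) w := by
  refine FilU_congr (shift_up_mem_FilU h.right h.tri_right h.tri_mid
    (h.tri_right.trans h.tri_mid.symm) (fun l h1 h2 => by simp [tri, h1, h2]) hf) fun ε _ => ?_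
  rw [← h.setRow_right]

theorem down_left (hf : f ∈ FilU t (tri a b c u none o₂ o₃) w) :
    (fun ε => f (setRow (setRow ε a.succ (row ε a.castSucc)) b.succ (row ε b.succ))) ∈
      FilU t (tri a b c u o₂ none o₃) w := by
  refine FilU_congr (shift_down_mem_FilU h.left h.tri_left (h.tri_left.trans h.tri_mid.symm)
    h.tri_mid (fun l h1 h2 => by simp [tri, h1, h2]) hf) fun ε _ => ?_
  rw [← h.setRow_left]

theorem down_right (hf : f ∈ FilU t (tri a b c u o₁ none o₃) w) :
    (fun ε => f (setRow (setRow ε a.succ (row ε a.succ)) b.succ (row ε a.succ))) ∈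
      FilU t (tri a b c u o₁ o₃ none) w := by
  refine FilU_congr (shift_down_mem_FilU h.right h.tri_mid (h.tri_mid.trans h.tri_right.symm)
    h.tri_right (fun l h1 h2 => by simp [tri, h1, h2]) hf) fun ε _ => ?_
  rw [← h.setRow_right, h.left]

theorem mem_bubble {i : Fin (n - 1)} (q : Point N n) : q ∈ bubbleSet a c i ↔
    (q.1 = a.succ ∨ q.1 = b.succ) ∧ (q.2 = leftPos i ∨ q.2 = rightPos i) := by
  obtain ⟨k, p⟩ := q
  rw [mem_bubbleSet, ← and_assoc]
  refine and_congr_left fun _ => ?_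
  have := h.val
  simp only [Fin.ext_iff, Fin.le_def, Fin.val_succ, Fin.val_castSucc]
  omega

theorem birth {j : Fin (n - 1)} (hf : f ∈ FilU t (tri a b c u (some j) none none) w) :
    (fun ε => (nu (row ε a.succ (leftPos j)))⁻¹ *
      f (setRow (setRow ε a.succ (row ε c.succ)) b.succ (row ε c.succ))) ∈
      FilU t (tri a b c u (some j) none (some j)) (w + 1) := by
  refine (isBubble_upper (u := tri a b c u (some j) none (some j)) h.lt h.tri_left h.tri_right
    fun k h1 h2 => by rw [h.between h1 h2]; exact h.tri_mid).birth (?_ : tri a b c u (some j) none none = _)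
    (ρ := fun ε => setRow (setRow ε a.succ (row ε c.succ)) b.succ (row ε c.succ))
    (fun ε hε q => ?_) hf
  · funext k
    by_cases hk : k = c
    · subst hk; rw [h.tri_right, Function.update_self]
    · rw [Function.update_of_ne hk]; simp [tri, hk]
  · have e1 : row ε a.succ = row ε b.succ := by
      rw [h.left]; exact hε.layer h.tri_mid
    obtain ⟨-, e2, e3⟩ := hε.layer h.tri_right
    rw [← h.right] at e3
    obtain ⟨k, p⟩ := q
    rw [show setRow (setRow ε a.succ (row ε c.succ)) b.succ (row ε c.succ) (k, p) =
      row (setRow (setRow ε a.succ (row ε c.succ)) b.succ (row ε c.succ)) k p from rfl]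
    simp only [h.mem_bubble]
    by_cases hk : k = a.succ ∨ k = b.succ
    · have e4 : row (setRow (setRow ε a.succ (row ε c.succ)) b.succ (row ε c.succ)) k =
          row ε c.succ := by
        rcases hk with rfl | rfl
        · exact h.row_z₁ _ _ _
        · exact h.row_z₂ _ _ _
      rw [e4]
      simp only [hk, true_and]
      split_ifs with hp
      · rcases hp with rfl | rfl
        · rfl
        · exact e2.symm
      · push Not at hp
        rw [← e3 p hp.1 hp.2]
        rcases hk with rfl | rfl
        · rw [← e1]; rfl
        · rfl
    · rw [if_neg fun h => hk h.1]
      push Not at hk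
      rw [h.setRows_eq _ _ _ hk.1 hk.2]
      rfl

theorem death {i : Fin (n - 1)} (hf : f ∈ FilU t (tri a b c u (some i) none (some i)) w) :
    (fun ε => capLoc i (row ε a.castSucc) fun z₁ z₂ =>
      f (setRow (setRow ε a.succ z₁) b.succ z₂)) ∈ FilU t (tri a b c u none none (some i)) (w + 1) := by
  have := (isBubble_lower (u := tri a b c u (some i) none (some i)) h.lt h.tri_left h.tri_right
    fun k h1 h2 => by rw [h.between h1 h2]; exact h.tri_mid).death (u' := tri a b c u none none (some i))
    (by
      funext k
      by_cases hk : k = a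
      · subst hk; rw [h.tri_left, Function.update_self]
      · rw [Function.update_of_ne hk]; simp [tri, hk])
    (ρ := fun o ε => setRow (setRow ε a.succ (fill i o (row ε a.castSucc))) b.succ
      (fill i o (row ε a.castSucc))) (fun ε hε o q => by
        have e0 : row ε a.castSucc = row ε a.succ := hε.layer h.tri_left
        have e1 : row ε a.succ = row ε b.succ := by
          rw [h.left]; exact hε.layer h.tri_mid
        obtain ⟨k, p⟩ := q
        simp only [h.mem_bubble]
        rw [show setRow (setRow ε a.succ (fill i o (row ε a.castSucc))) b.succ
          (fill i o (row ε a.castSucc)) (k, p) = row (setRow (setRow ε a.succ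
          (fill i o (row ε a.castSucc))) b.succ (fill i o (row ε a.castSucc))) k p from rfl]
        by_cases hk : k = a.succ ∨ k = b.succ
        · have e4 : row (setRow (setRow ε a.succ (fill i o (row ε a.castSucc))) b.succ
              (fill i o (row ε a.castSucc))) k = fill i o (row ε k) := by
            rcases hk with rfl | rfl
            · rw [h.row_z₁, e0]
            · rw [h.row_z₂, e0, e1]
          rw [e4]
          simp only [hk, true_and]
          rfl
        · rw [if_neg fun h => hk h.1]
          push Not at hk
          rw [h.setRows_eq _ _ _ hk.1 hk.2]
          rfl) hf
  exact this

theorem saddle_left (ht : t ∈ Set.Icc (0 : ℝ) 2) {i : Fin (n - 1)}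
    (ho : (o₁ = none ∧ o₂ = some i) ∨ (o₁ = some i ∧ o₂ = none)) {o o' : Option (Fin (n - 1))}
    (hf : f ∈ FilU t (tri a b c u o₁ o o') w) :
    (fun ε => kap (some i) (row ε a.castSucc) (row ε a.succ) * f ε) ∈
      FilU t (tri a b c u o₂ o o') (w - 1) :=
  saddle_mem_FilU ht (by rwa [h.tri_left, h.tri_left]) (fun k hk => by simp [tri, hk]) hf

theorem saddle_right (ht : t ∈ Set.Icc (0 : ℝ) 2) {i : Fin (n - 1)}
    (ho : (o₁ = none ∧ o₂ = some i) ∨ (o₁ = some i ∧ o₂ = none)) {o o' : Option (Fin (n - 1))}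
    (hf : f ∈ FilU t (tri a b c u o o' o₁) w) :
    (fun ε => kap (some i) (row ε b.succ) (row ε c.succ) * f ε) ∈
      FilU t (tri a b c u o o' o₂) (w - 1) := by
  rw [h.right]
  exact saddle_mem_FilU ht (by rwa [h.tri_right, h.tri_right]) (fun k hk => by simp [tri, hk]) hf

theorem braidLoc_mem (ht : t ∈ Set.Icc (0 : ℝ) 2) {i j : Fin (n - 1)} {w : ℕ → ℝ}
    {G : Bool → Bool → Bool → (Point N n → Bool) → ℂ}
    (hG : ∀ p q r, G p q r ∈ FilU t (tri a b c u (if p then some i else none)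
      (if q then some j else none) (if r then some i else none))
      (w (p.toNat + q.toNat + r.toNat))) (b₁ b₂ b₃ : Bool) :
    (fun ε => braidLoc i j (row ε a.castSucc) (row ε c.succ)
      (fun p q r z₁ z₂ => G p q r (setRow (setRow ε a.succ z₁) b.succ z₂)) b₁ b₂ b₃
      (row ε a.succ) (row ε b.succ)) ∈ FilU t (tri a b c u (if b₁ then some j else none)
      (if b₂ then some i else none) (if b₃ then some j else none))
      (w (b₁.toNat + b₂.toNat + b₃.toNat)) := by
  have hcol : ∀ {o₁ o₂ o₃ : Option (Fin (n - 1))} {ε}, Col (tri a b c u o₁ o₂ o₃) ε →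
      LayerOK o₁ (row ε a.castSucc) (row ε a.succ) ∧ LayerOK o₂ (row ε a.succ) (row ε b.succ) ∧
      LayerOK o₃ (row ε b.succ) (row ε c.succ) := fun {o₁ o₂ o₃ ε} hε => by
    refine ⟨hε.layer h.tri_left, ?_, ?_⟩
    · rw [h.left]; exact hε.layer h.tri_mid
    · rw [h.right]; exact hε.layer h.tri_right
  cases b₁ <;> cases b₂ <;> cases b₃ <;>
    simp only [if_true, if_false, Bool.false_eq_true, Bool.toNat_true, Bool.toNat_false, zero_add,
      add_zero]
  · have := hG false false false
    simp only [if_false, Bool.false_eq_true, Bool.toNat_false, add_zero] at this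
    refine FilU_congr this fun ε _ => ?_
    simp only [braidLoc]
    rw [setRow_row, setRow_row]
  · have := hG false true false
    simp only [if_true, if_false, Bool.false_eq_true, Bool.toNat_true, Bool.toNat_false, add_zero,
      zero_add] at this
    refine FilU_congr (h.up_right this) fun ε hε => ?_
    have e : row ε a.castSucc = row ε a.succ := (hcol hε).1
    simp only [braidLoc, e]
  · have := hG true false false
    simp only [if_true, if_false, Bool.false_eq_true, Bool.toNat_true, Bool.toNat_false, add_zero] at this
    refine FilU_congr (h.up_left this) fun ε hε => ?_
    have e : row ε b.succ = row ε c.succ := (hcol hε).2.2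
    simp only [braidLoc, e]
  · have := hG true true false
    simp only [if_true, if_false, Bool.false_eq_true, Bool.toNat_true, Bool.toNat_false, add_zero] at this
    refine FilU_congr (h.up_left (h.up_right this)) fun ε hε => ?_
    simp only [braidLoc, h.setRows_setRows, h.row_z₁, h.row_y]
  · have := hG false true false
    simp only [if_true, if_false, Bool.false_eq_true, Bool.toNat_true, Bool.toNat_false, add_zero,
      zero_add] at this
    refine FilU_congr (h.down_left this) fun ε hε => ?_
    have e : row ε b.succ = row ε c.succ := (hcol hε).2.2
    simp only [braidLoc, e]
  · have g1 := hG true true false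
    have g2 := hG false true true
    have g3 := hG true false true
    simp only [if_true, if_false, Bool.false_eq_true, Bool.toNat_true, Bool.toNat_false, add_zero,
      zero_add] at g1 g2 g3
    have k1 := h.birth (h.down_left (h.saddle_left ht (Or.inr ⟨rfl, rfl⟩) g1))
    have k2 := h.birth (h.down_left (h.saddle_right ht (Or.inr ⟨rfl, rfl⟩) g2))
    have k3 := h.birth (h.saddle_left ht (Or.inl ⟨rfl, rfl⟩) (i := j)
      (h.saddle_right ht (Or.inr ⟨rfl, rfl⟩) (h.death g3)))
    rw [sub_add_cancel] at k1 k2 k3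
    rw [add_sub_cancel_right] at k3
    refine FilU_congr (sub_mem (add_mem k1 k2) k3) fun ε hε => ?_
    simp only [Pi.sub_apply, Pi.add_apply, braidLoc, h.setRows_setRows, h.row_z₁, h.row_z₂, h.row_y,
      h.row_x, row]
    ring
  · have g1 := hG false true true
    have g2 := hG true false true
    simp only [if_true, if_false, Bool.false_eq_true, Bool.toNat_true, Bool.toNat_false, add_zero,
      zero_add] at g1 g2
    have k1 := h.down_right (h.down_left g1)
    have k2 := h.saddle_left ht (Or.inl ⟨rfl, rfl⟩) (i := j) (h.down_right (h.death g2))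
    rw [add_sub_cancel_right] at k2
    refine FilU_congr (sub_mem k1 k2) fun ε hε => ?_
    simp only [Pi.sub_apply, braidLoc, h.setRows_setRows, h.row_z₂, h.row_x]
  · refine FilU_congr (zero_mem _) fun ε _ => rfl

end Consec

end TripleFiltered

section BraidMove

variable {N n : ℕ}

theorem braidLoc_add (i j : Fin (n - 1)) (x y : Row n) (F G : Loc n) (b₁ b₂ b₃ : Bool)
    (z₁ z₂ : Row n) : braidLoc i j x y (F + G) b₁ b₂ b₃ z₁ z₂ =
    braidLoc i j x y F b₁ b₂ b₃ z₁ z₂ + braidLoc i j x y G b₁ b₂ b₃ z₁ z₂ := by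
  cases b₁ <;> cases b₂ <;> cases b₃ <;> simp only [braidLoc, capLoc, Pi.add_apply] <;> ring

/-- The chain map of the third Reidemeister move preserves the number of `1`-resolutions. -/
theorem braidLoc_scale (i j : Fin (n - 1)) (x y : Row n) (K : ℕ → ℂ) (F : Loc n)
    (b₁ b₂ b₃ : Bool) (z₁ z₂ : Row n) :
    braidLoc i j x y (fun p q r w₁ w₂ => K (p.toNat + q.toNat + r.toNat) * F p q r w₁ w₂)
      b₁ b₂ b₃ z₁ z₂ =
    K (b₁.toNat + b₂.toNat + b₃.toNat) * braidLoc i j x y F b₁ b₂ b₃ z₁ z₂ := by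
  cases b₁ <;> cases b₂ <;> cases b₃ <;>
    simp only [braidLoc, capLoc, Bool.toNat_true, Bool.toNat_false, zero_add, add_zero,
      Nat.reduceAdd] <;> ring

/-- Prescribe three bits. -/
def setBits (S : Vtx N) (a b c : Fin N) (p q r : Bool) : Vtx N :=
  Function.update (Function.update (Function.update S a p) b q) c r

/-- A chain, as a function of three resolutions and of the rows between them. -/
def loc (a b c : Fin N) (f : Ch N n) (S : Vtx N) (ε : Point N n → Bool) : Loc n :=
  fun p q r z₁ z₂ => f (setBits S a b c p q r) (setRow (setRow ε a.succ z₁) b.succ z₂)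

/-- The chain map of the third Reidemeister move. -/
def braidOp (i j : Fin (n - 1)) (a b c : Fin N) : Ch N n →ₗ[ℂ] Ch N n where
  toFun f S ε := braidLoc i j (row ε a.castSucc) (row ε c.succ) (loc a b c f S ε)
    (S a) (S b) (S c) (row ε a.succ) (row ε b.succ)
  map_add' f g := by
    ext S ε
    exact braidLoc_add i j _ _ (loc a b c f S ε) (loc a b c g S ε) _ _ _ _ _
  map_smul' k f := by
    ext S ε
    exact braidLoc_scale i j _ _ (fun _ => k) (loc a b c f S ε) _ _ _ _ _

theorem braidOp_apply (i j : Fin (n - 1)) (a b c : Fin N) (f : Ch N n) (S : Vtx N)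
    (ε : Point N n → Bool) : braidOp i j a b c f S ε =
      braidLoc i j (row ε a.castSucc) (row ε c.succ) (loc a b c f S ε)
        (S a) (S b) (S c) (row ε a.succ) (row ε b.succ) := rfl

theorem vsign_update (S : Vtx N) {a l : Fin N} (p : Bool) :
    vsign (Function.update S a p) l =
      vsign (Function.update S a false) l * if a < l ∧ p = true then -1 else 1 := by
  unfold vsign
  rw [← Finset.mul_prod_erase _ _ (Finset.mem_univ a), ← Finset.mul_prod_erase _
    (fun k => if k < l ∧ Function.update S a false k = true then (-1 : ℂ) else 1)
    (Finset.mem_univ a)]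
  simp only [Function.update_self, Bool.false_eq_true, and_false, if_false, one_mul]
  rw [mul_comm]
  congr 1
  refine Finset.prod_congr rfl fun k hk => ?_
  rw [Function.update_of_ne (Finset.ne_of_mem_erase hk), Function.update_of_ne (Finset.ne_of_mem_erase hk)]

/-- The layers apart from three. -/
def rest (a b c : Fin N) : Finset (Fin N) := ((Finset.univ.erase a).erase b).erase c

theorem mem_rest {a b c l : Fin N} : l ∈ rest a b c ↔ l ≠ a ∧ l ≠ b ∧ l ≠ c := by
  simp only [rest, Finset.mem_erase, Finset.mem_univ, and_true]
  tauto

namespace Consec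

variable {a b c : Fin N} (h : Consec a b c)
include h

theorem setBits_left (S : Vtx N) (p q r : Bool) : setBits S a b c p q r a = p := by
  simp [setBits, h.ne₁, h.ne₃]

theorem setBits_mid (S : Vtx N) (p q r : Bool) : setBits S a b c p q r b = q := by
  simp [setBits, h.ne₂]

theorem setBits_right (S : Vtx N) (p q r : Bool) : setBits S a b c p q r c = r := by
  simp [setBits]

theorem setBits_of_ne (S : Vtx N) (p q r : Bool) {l : Fin N} (h1 : l ≠ a) (h2 : l ≠ b)
    (h3 : l ≠ c) : setBits S a b c p q r l = S l := by
  simp [setBits, h1, h2, h3]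

theorem eq_setBits {S S' : Vtx N} {p q r : Bool} (h1 : S' a = p) (h2 : S' b = q) (h3 : S' c = r)
    (h4 : ∀ l, l ≠ a → l ≠ b → l ≠ c → S' l = S l) : S' = setBits S a b c p q r := by
  funext l
  by_cases ha : l = a
  · subst ha; rw [h.setBits_left, h1]
  by_cases hb : l = b
  · subst hb; rw [h.setBits_mid, h2]
  by_cases hc : l = c
  · subst hc; rw [h.setBits_right, h3]
  rw [h.setBits_of_ne S p q r ha hb hc, h4 l ha hb hc]

theorem setBits_setBits (S : Vtx N) (p q r p' q' r' : Bool) :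
    setBits (setBits S a b c p q r) a b c p' q' r' = setBits S a b c p' q' r' :=
  h.eq_setBits (h.setBits_left _ _ _ _) (h.setBits_mid _ _ _ _) (h.setBits_right _ _ _ _)
    fun l h1 h2 h3 => by rw [h.setBits_of_ne _ _ _ _ h1 h2 h3, h.setBits_of_ne _ _ _ _ h1 h2 h3]

theorem setBits_self (S : Vtx N) : setBits S a b c (S a) (S b) (S c) = S :=
  (h.eq_setBits rfl rfl rfl fun _ _ _ _ => rfl).symm

theorem loc_self (f : Ch N n) (S : Vtx N) (ε : Point N n → Bool) :
    loc a b c f S ε (S a) (S b) (S c) (row ε a.succ) (row ε b.succ) = f S ε := by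
  unfold loc
  rw [h.setBits_self, setRow_row, setRow_row]

theorem loc_loc (f : Ch N n) (S : Vtx N) (ε : Point N n → Bool) (p q r : Bool) (z₁ z₂ : Row n) :
    loc a b c f (setBits S a b c p q r) (setRow (setRow ε a.succ z₁) b.succ z₂) =
      loc a b c f S ε := by
  funext p' q' r' z₁' z₂'
  unfold loc
  rw [h.setBits_setBits, h.setRows_setRows]

theorem lt_iff {l : Fin N} (h2 : l ≠ b) (h3 : l ≠ c) : (b < l ↔ a < l) ∧ (c < l ↔ a < l) := by
  have := h.val
  simp only [Fin.lt_def, ne_eq, Fin.ext_iff] at *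
  omega

theorem vsign_setBits (S : Vtx N) (p q r : Bool) {l : Fin N} (h2 : l ≠ b) (h3 : l ≠ c) :
    vsign (setBits S a b c p q r) l = vsign (setBits S a b c false false false) l *
      (if a < l then -1 else 1) ^ (p.toNat + q.toNat + r.toNat) := by
  obtain ⟨e1, e2⟩ := h.lt_iff h2 h3
  unfold setBits
  rw [vsign_update _ r, Function.update_comm h.ne₂, vsign_update _ q, Function.update_comm h.ne₂.symm,
    Function.update_comm h.ne₁, Function.update_comm h.ne₃, vsign_update _ p, ← Function.update_comm h.ne₃,
    ← Function.update_comm h.ne₁]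
  simp only [e1, e2]
  by_cases hl : a < l <;> cases p <;> cases q <;> cases r <;> (simp [hl]; try ring)

theorem sum_eq (F : Fin N → ℂ) : ∑ l, F l = F a + F b + F c + ∑ l ∈ rest a b c, F l := by
  rw [sum_eq_add_add h.ne₁, ← Finset.add_sum_erase ((Finset.univ.erase a).erase b) F
    (a := c) (by simp [h.ne₂.symm, h.ne₃.symm]), ← add_assoc]
  rfl

/-- The differential, split into the three layers and the other ones. -/
theorem dM_eq (L : Fin N → Letter n) (f : Ch N n) (S : Vtx N) (ε : Point N n → Bool) :
    dM L f S ε = vsign S a * dLoc (L a).1 (L b).1 (L c).1 (row ε a.castSucc) (row ε c.succ)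
      (loc a b c f S ε) (S a) (S b) (S c) (row ε a.succ) (row ε b.succ) +
      ∑ l ∈ rest a b c, dTerm L l f S ε := by
  unfold dM
  rw [h.sum_eq]
  congr 1
  have ea : loc a b c f S ε false (S b) (S c) (row ε a.succ) (row ε b.succ) =
      f (Function.update S a false) ε := by
    unfold loc
    rw [setRow_row, setRow_row, ← h.eq_setBits (S' := Function.update S a false)
      (Function.update_self ..) (Function.update_of_ne h.ne₁.symm ..)
      (Function.update_of_ne h.ne₃.symm ..) fun l h1 _ _ => Function.update_of_ne h1 ..]
  have eb : loc a b c f S ε (S a) false (S c) (row ε a.succ) (row ε b.succ) =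
      f (Function.update S b false) ε := by
    unfold loc
    rw [setRow_row, setRow_row, ← h.eq_setBits (S' := Function.update S b false)
      (Function.update_of_ne h.ne₁ ..) (Function.update_self ..)
      (Function.update_of_ne h.ne₂.symm ..) fun l _ h1 _ => Function.update_of_ne h1 ..]
  have ec : loc a b c f S ε (S a) (S b) false (row ε a.succ) (row ε b.succ) =
      f (Function.update S c false) ε := by
    unfold loc
    rw [setRow_row, setRow_row, ← h.eq_setBits (S' := Function.update S c false)
      (Function.update_of_ne h.ne₃ ..) (Function.update_of_ne h.ne₂ ..) (Function.update_self ..)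
      fun l _ _ h1 => Function.update_of_ne h1 ..]
  unfold dLoc dTerm
  rw [ea, eb, ec, vsign_succ h.right, vsign_succ h.left, ← h.left, ← h.right]
  split_ifs <;> ring

end Consec

/-- The words agree except for the two sides of a braid relation. -/
structure IsBraidMove (L L' : Fin N → Letter n) (i j : Fin (n - 1)) (a b c : Fin N) : Prop where
  consec : Consec a b c
  left : L a = (some i, true)
  mid : L b = (some j, true)
  right : L c = (some i, true)
  left' : L' a = (some j, true)
  mid' : L' b = (some i, true)
  right' : L' c = (some j, true)
  rest : ∀ k, k ≠ a → k ≠ b → k ≠ c → L' k = L k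

namespace IsBraidMove

variable {L L' : Fin N → Letter n} {i j : Fin (n - 1)} {a b c : Fin N}
  (h : IsBraidMove L L' i j a b c)
include h

theorem adm (S : Vtx N) (p q r : Bool) (hS : Adm L' S) : Adm L (setBits S a b c p q r) := by
  intro l hl
  by_cases h1 : l = a
  · subst h1; rw [h.left] at hl; cases hl
  by_cases h2 : l = b
  · subst h2; rw [h.mid] at hl; cases hl
  by_cases h3 : l = c
  · subst h3; rw [h.right] at hl; cases hl
  rw [h.consec.setBits_of_ne _ _ _ _ h1 h2 h3]
  rw [← h.rest l h1 h2 h3] at hl ⊢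
  exact hS l hl

theorem shape_eq (S : Vtx N) (p q r : Bool) : shape L (setBits S a b c p q r) =
    tri a b c (shape L' S) (if p then some i else none) (if q then some j else none)
      (if r then some i else none) := by
  have hc := h.consec
  funext l
  by_cases h1 : l = a
  · subst h1
    rw [hc.tri_left, shape, hc.setBits_left, h.left]
    cases p <;> simp
  by_cases h2 : l = b
  · subst h2
    rw [hc.tri_mid, shape, hc.setBits_mid, h.mid]
    cases q <;> simp
  by_cases h3 : l = c
  · subst h3
    rw [hc.tri_right, shape, hc.setBits_right, h.right]
    cases r <;> simp
  simp only [shape, tri, h1, h2, h3, if_false, hc.setBits_of_ne _ _ _ _ h1 h2 h3, h.rest l h1 h2 h3]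

theorem shape_eq' (S : Vtx N) : shape L' S =
    tri a b c (shape L' S) (if S a then some j else none) (if S b then some i else none)
      (if S c then some j else none) := by
  have hc := h.consec
  funext l
  by_cases h1 : l = a
  · subst h1
    rw [hc.tri_left, shape, h.left']
    cases S l <;> simp
  by_cases h2 : l = b
  · subst h2
    rw [hc.tri_mid, shape, h.mid']
    cases S l <;> simp
  by_cases h3 : l = c
  · subst h3
    rw [hc.tri_right, shape, h.right']
    cases S l <;> simp
  simp only [tri, h1, h2, h3, if_false]

theorem shift_eq (S : Vtx N) (p q r : Bool) : (shift L (setBits S a b c p q r) : ℝ) =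
    shift L' S - ((S a).toNat + (S b).toNat + (S c).toNat : ℕ) +
      (p.toNat + q.toNat + r.toNat : ℕ) := by
  have hs : ∀ F : Fin N → ℤ, ∑ l, F l = F a + F b + F c + ∑ l ∈ AnnularLee.rest a b c, F l := fun F => by
    have hc := h.consec
    rw [← Finset.add_sum_erase _ _ (Finset.mem_univ a), ← Finset.add_sum_erase (Finset.univ.erase a) F
      (a := b) (by simp [hc.ne₁.symm]), ← Finset.add_sum_erase ((Finset.univ.erase a).erase b) F
      (a := c) (by simp [hc.ne₂.symm, hc.ne₃.symm]), ← add_assoc, ← add_assoc]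
    rfl
  have e : ∑ l ∈ AnnularLee.rest a b c, letterShift (L l) (setBits S a b c p q r l) =
      ∑ l ∈ AnnularLee.rest a b c, letterShift (L' l) (S l) := Finset.sum_congr rfl fun l hl => by
    obtain ⟨h1, h2, h3⟩ := mem_rest.1 hl
    rw [h.consec.setBits_of_ne _ _ _ _ h1 h2 h3, h.rest l h1 h2 h3]
  unfold shift
  rw [hs, hs, e, h.consec.setBits_left, h.consec.setBits_mid, h.consec.setBits_right, h.left, h.mid,
    h.right, h.left', h.mid', h.right']
  simp only [letterShift]
  push_cast
  ring

theorem braidOp_mem {t s : ℝ} (ht : t ∈ Set.Icc (0 : ℝ) 2) {f : Ch N n} (hf : f ∈ FM L t s) :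
    braidOp i j a b c f ∈ FM L' t s := by
  intro S hS
  have := h.consec.braidLoc_mem (u := shape L' S) ht (i := i) (j := j)
    (G := fun p q r => f (setBits S a b c p q r))
    (w := fun m => s - (shift L' S - ((S a).toNat + (S b).toNat + (S c).toNat : ℕ) + m))
    (fun p q r => by
      have := hf _ (h.adm S p q r hS)
      rwa [h.shape_eq, h.shift_eq] at this) (S a) (S b) (S c)
  rw [← h.shape_eq', sub_add_cancel] at this
  exact this

theorem braidOp_canM (S : Vtx N) (ε : Point N n → Bool) :
    braidOp i j a b c (canM L) S ε = canM L' S ε := by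
  have hc := h.consec
  have hbl : ∀ p q r, setBits S a b c p q r = blVtx L → p = false ∧ q = false ∧ r = false :=
    fun p q r e => by
      refine ⟨?_, ?_, ?_⟩
      · have := congrFun e a
        rwa [hc.setBits_left, blVtx, h.left] at this
      · have := congrFun e b
        rwa [hc.setBits_mid, blVtx, h.mid] at this
      · have := congrFun e c
        rwa [hc.setBits_right, blVtx, h.right] at this
  have h0 : ∀ p q r z₁ z₂, ¬ (p = false ∧ q = false ∧ r = false) →
      loc a b c (canM L) S ε p q r z₁ z₂ = 0 := fun p q r z₁ z₂ hn => by
    unfold loc canM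
    exact if_neg fun h1 => hn (hbl p q r h1.1)
  have hbl' : S = blVtx L' ↔ S = blVtx L := by
    have : blVtx L' = blVtx L := by
      funext l
      by_cases h1 : l = a
      · subst h1; simp [blVtx, h.left, h.left']
      by_cases h2 : l = b
      · subst h2; simp [blVtx, h.mid, h.mid']
      by_cases h3 : l = c
      · subst h3; simp [blVtx, h.right, h.right']
      simp [blVtx, h.rest l h1 h2 h3]
    rw [this]
  have hT : canM L' S ε = canM L S ε := by
    unfold canM
    simp only [hbl']
  rw [hT, braidOp_apply]
  by_cases hb : S a = false ∧ S b = false ∧ S c = false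
  · obtain ⟨ha, hb, hc'⟩ := hb
    rw [← hc.loc_self (canM L) S ε, ha, hb, hc']
    rfl
  · have e : canM L S ε = 0 := by
      rw [← hc.loc_self (canM L) S ε]
      exact h0 _ _ _ _ _ hb
    rw [e]
    rcases ha : S a <;> rcases hb' : S b <;> rcases hc' : S c <;>
      simp only [ha, hb', hc', and_self, not_true_eq_false] at hb <;>
      simp [braidLoc, capLoc, h0]

theorem braidOp_dTerm (f : Ch N n) (S : Vtx N) (ε : Point N n → Bool) {l : Fin N} (h1 : l ≠ a)
    (h2 : l ≠ b) (h3 : l ≠ c) :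
    braidOp i j a b c (dTerm L l f) S ε = dTerm L' l (braidOp i j a b c f) S ε := by
  have hc := h.consec
  have hr : ∀ z₁ z₂ : Row n,
      row (setRow (setRow ε a.succ z₁) b.succ z₂) l.castSucc = row ε l.castSucc ∧
      row (setRow (setRow ε a.succ z₁) b.succ z₂) l.succ = row ε l.succ := fun z₁ z₂ => by
    refine ⟨hc.setRows_eq _ _ _ ?_ ?_, hc.setRows_eq _ _ _ ?_ ?_⟩
    · rw [hc.left]; simpa using h2
    · rw [hc.right]; simpa using h3
    · simpa using h1
    · simpa using h2
  set K : ℕ → ℂ := fun m => if S l = true then vsign (setBits S a b c false false false) l *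
    (if a < l then -1 else 1) ^ m * kap (L l).1 (row ε l.castSucc) (row ε l.succ) else 0 with hK
  have e : loc a b c (dTerm L l f) S ε = fun p q r z₁ z₂ => K (p.toNat + q.toNat + r.toNat) *
      loc a b c f (Function.update S l false) ε p q r z₁ z₂ := by
    funext p q r z₁ z₂
    have e1 : Function.update (setBits S a b c p q r) l false =
        setBits (Function.update S l false) a b c p q r := by
      refine hc.eq_setBits ?_ ?_ ?_ fun k g1 g2 g3 => ?_
      · rw [Function.update_of_ne h1.symm, hc.setBits_left]
      · rw [Function.update_of_ne h2.symm, hc.setBits_mid]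
      · rw [Function.update_of_ne h3.symm, hc.setBits_right]
      · by_cases hk : k = l
        · subst hk; simp
        · rw [Function.update_of_ne hk, Function.update_of_ne hk, hc.setBits_of_ne _ _ _ _ g1 g2 g3]
    simp only [loc, dTerm, hK, hc.setBits_of_ne _ _ _ _ h1 h2 h3, (hr z₁ z₂).1, (hr z₁ z₂).2, e1]
    by_cases hS : S l = true
    · rw [if_pos hS, if_pos hS, hc.vsign_setBits _ _ _ _ h2 h3]
    · rw [if_neg hS, if_neg hS, zero_mul]
  rw [braidOp_apply, e, braidLoc_scale]
  unfold dTerm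
  rw [braidOp_apply, Function.update_of_ne h1.symm, Function.update_of_ne h2.symm,
    Function.update_of_ne h3.symm, h.rest l h1 h2 h3]
  simp only [hK]
  rw [← hc.vsign_setBits _ _ _ _ h2 h3, hc.setBits_self]
  split_ifs <;> simp

theorem braidOp_dM (hij : (i : ℕ) + 1 = j ∨ (j : ℕ) + 1 = i) (f : Ch N n) (S : Vtx N)
    (ε : Point N n → Bool) (hε : Col (shape L' S) ε) :
    braidOp i j a b c (dM L f) S ε = dM L' (braidOp i j a b c f) S ε := by
  have hc := h.consec
  obtain ⟨p, q, s, hi, hj, hpq⟩ : ∃ p q s, IsPair i p s ∧ IsPair j q s ∧ p ≠ q := by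
    rcases hij with e | e
    · refine ⟨leftPos i, rightPos j, leftPos j, Or.inl ⟨rfl, ?_⟩, Or.inr ⟨rfl, rfl⟩, ?_⟩
      · exact Fin.ext e
      · intro e'
        have := congrArg Fin.val e'
        simp [leftPos, rightPos] at this
        omega
    · refine ⟨rightPos i, leftPos j, leftPos i, Or.inr ⟨rfl, rfl⟩, Or.inl ⟨rfl, Fin.ext e⟩, ?_⟩
      intro e'
      have := congrArg Fin.val e'
      simp [leftPos, rightPos] at this
      omega
  set I : Ch N n := fun S ε => vsign S a * dLoc (some i) (some j) (some i) (row ε a.castSucc)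
    (row ε c.succ) (loc a b c f S ε) (S a) (S b) (S c) (row ε a.succ) (row ε b.succ) with hI
  have hd : dM L f = I + ∑ l ∈ AnnularLee.rest a b c, dTerm L l f := by
    funext S ε
    rw [hc.dM_eq L f S ε, h.left, h.mid, h.right]
    simp only [Pi.add_apply, Finset.sum_apply, hI]
  rw [hd, map_add, map_sum, hc.dM_eq L', h.left', h.mid', h.right']
  simp only [Pi.add_apply, Finset.sum_apply]
  congr 1
  · have e1 : loc a b c I S ε = fun p q r z₁ z₂ => vsign S a * dLoc (some i) (some j) (some i)
        (row ε a.castSucc) (row ε c.succ) (loc a b c f S ε) p q r z₁ z₂ := by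
      funext p q r z₁ z₂
      rw [loc]
      simp only [hI]
      rw [hc.loc_loc, hc.row_x, hc.row_y, hc.row_z₁, hc.row_z₂, hc.setBits_left, hc.setBits_mid,
        hc.setBits_right]
      congr 1
      refine vsign_congr fun k hk => hc.setBits_of_ne _ _ _ _ hk.ne ?_ ?_
      · rintro rfl; have := hc.val; rw [Fin.lt_def] at hk; omega
      · rintro rfl; have := hc.val; rw [Fin.lt_def] at hk; omega
    have e2 : loc a b c (braidOp i j a b c f) S ε = braidLoc i j (row ε a.castSucc) (row ε c.succ)
        (loc a b c f S ε) := by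
      funext p q r z₁ z₂
      rw [loc, braidOp_apply, hc.loc_loc, hc.row_x, hc.row_y, hc.row_z₁, hc.row_z₂,
        hc.setBits_left, hc.setBits_mid, hc.setBits_right]
    rw [braidOp_apply, e1, e2, braidLoc_scale i j _ _ (fun _ => vsign S a)]
    congr 1
    rw [h.shape_eq'] at hε
    refine braidLoc_dLoc hi hj hpq _ _ _ _ _ _ _ _ (hε.layer hc.tri_left) ?_ ?_
    · rw [hc.left]; exact hε.layer hc.tri_mid
    · rw [hc.right]; exact hε.layer hc.tri_right
  · refine Finset.sum_congr rfl fun l hl => ?_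
    obtain ⟨h1, h2, h3⟩ := mem_rest.1 hl
    exact h.braidOp_dTerm f S ε h1 h2 h3

theorem symm : IsBraidMove L' L j i a b c :=
  ⟨h.consec, h.left', h.mid', h.right', h.left, h.mid, h.right,
    fun k h1 h2 h3 => (h.rest k h1 h2 h3).symm⟩

theorem levelsM_subset {t : ℝ} (ht : t ∈ Set.Icc (0 : ℝ) 2) (hij : (i : ℕ) + 1 = j ∨ (j : ℕ) + 1 = i) :
    levelsM L t ⊆ levelsM L' t := by
  intro s hs
  rw [← sub_zero s]
  refine levelsM_of_map (braidOp i j a b c) one_ne_zero (fun s f hf => ?_) (fun S hS ε _ => ?_)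
    (fun f S _ ε hε => h.braidOp_dM hij f S ε hε) hs
  · rw [sub_zero]; exact h.braidOp_mem ht hf
  · rw [one_mul]; exact h.braidOp_canM S ε

/-- The levels are invariant under the braid relation. -/
theorem levelsM_eq {t : ℝ} (ht : t ∈ Set.Icc (0 : ℝ) 2) (hij : (i : ℕ) + 1 = j ∨ (j : ℕ) + 1 = i) :
    levelsM L t = levelsM L' t :=
  Set.Subset.antisymm (h.levelsM_subset ht hij) (h.symm.levelsM_subset ht hij.symm)

end IsBraidMove

end BraidMove

section Labels

variable {P C : Type*} [DecidableEq P] [Fintype P] [Fintype C]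

/-- The classes of `κ` are the cycles of `π`, and `ρ` chooses a point on each of them. -/
structure IsCycles (π : Perm P) (κ : P → C) (ρ : C → P) : Prop where
  rep : ∀ c, κ (ρ c) = c
  iff : ∀ p q, κ p = κ q ↔ π.SameCycle p q

/-- The labels given by the parities of exponents. -/
def labOf (κ : P → C) (τ : P → ℕ) (c : C) : Bool := decide (Even (∑ p with κ p = c, τ p))

/-- Exponents with the given labels. -/
def tauOf (κ : P → C) (ρ : C → P) (lab : C → Bool) (p : P) : ℕ :=
  if p = ρ (κ p) ∧ lab (κ p) = false then 1 else 0

/-- The value of a labelled generator at a colouring. -/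
def chi (lab η : C → Bool) : ℂ := ∏ c, if lab c then 1 else sg (η c)

/-- The degree of a label. -/
def signOf (b : Bool) : ℝ := if b then 1 else -1

theorem neg_one_pow_eq_signOf (k : ℕ) : (-1 : ℝ) ^ k = signOf (decide (Even k)) := by
  by_cases h : Even k
  · simp [h, signOf]
  · simp [signOf, h, Odd.neg_one_pow (Nat.not_even_iff_odd.1 h)]

theorem sum_chi_mul_chi (lab lab' : C → Bool) :
    ∑ η : C → Bool, chi lab η * chi lab' η = if lab = lab' then 2 ^ Fintype.card C else 0 := by
  have h1 : ∀ η : C → Bool, chi lab η * chi lab' η =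
      ∏ c, (if lab c then 1 else sg (η c)) * (if lab' c then 1 else sg (η c)) := fun η => by
    rw [chi, chi, Finset.prod_mul_distrib]
  simp only [h1]
  rw [← Fintype.prod_sum fun c b => (if lab c then (1 : ℂ) else sg b) * (if lab' c then 1 else sg b)]
  split_ifs with h
  · subst h
    rw [Finset.prod_congr rfl fun c _ => (?_ : _ = (2 : ℂ))]
    · simp
    · cases lab c <;> norm_num [sg]
  · obtain ⟨c, hc⟩ := Function.ne_iff.1 h
    refine Finset.prod_eq_zero (Finset.mem_univ c) ?_
    cases h1 : lab c <;> cases h2 : lab' c <;> simp_all [sg]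

namespace IsCycles

variable {π : Perm P} {κ : P → C} {ρ : C → P} (h : IsCycles π κ ρ)
include h

theorem surj : Function.Surjective κ := fun c => ⟨ρ c, h.rep c⟩

theorem inv_iff (ε : P → Bool) : Inv π ε ↔ ∃ η : C → Bool, ε = η ∘ κ := by
  constructor
  · intro hε
    refine ⟨fun c => ε (ρ c), funext fun p => ?_⟩
    exact hε.sameCycle ((h.iff _ _).1 (h.rep (κ p)).symm)
  · rintro ⟨η, rfl⟩ p
    exact congrArg η ((h.iff _ _).2 (Equiv.Perm.sameCycle_apply_left.2 (Equiv.Perm.SameCycle.refl π p)))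

theorem filter_eq (p : P) : (Finset.univ.filter fun q => κ q = κ p) = orb π p := by
  ext q
  rw [Finset.mem_filter, mem_orb, h.iff]
  simp only [Finset.mem_univ, true_and]
  exact ⟨fun h => h.symm, fun h => h.symm⟩

theorem labOf_apply (τ : P → ℕ) (p : P) : labOf κ τ (κ p) = decide (Even (∑ q ∈ orb π p, τ q)) := by
  rw [labOf, h.filter_eq]

theorem labOf_tauOf (lab : C → Bool) : labOf κ (tauOf κ ρ lab) = lab := by
  funext c
  have h1 : ∑ p with κ p = c, tauOf κ ρ lab p = if lab c = false then 1 else 0 := by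
    rw [Finset.sum_eq_single (ρ c)]
    · simp only [tauOf, h.rep, true_and]
    · intro p hp hne
      rw [tauOf, if_neg]
      rintro ⟨h1, -⟩
      rw [(Finset.mem_filter.1 hp).2] at h1
      exact hne h1
    · intro hn
      exact (hn (Finset.mem_filter.2 ⟨Finset.mem_univ _, h.rep c⟩)).elim
  unfold labOf
  rw [h1]
  cases lab c <;> simp

theorem mono_eq (τ : P → ℕ) (η : C → Bool) :
    mono π τ (η ∘ κ) = chi (labOf κ τ) η * nrm π (η ∘ κ) := by
  unfold mono chi
  congr 1
  rw [← Finset.prod_fiberwise Finset.univ κ]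
  refine Finset.prod_congr rfl fun c _ => ?_
  rw [Finset.prod_congr rfl fun p hp => (?_ : _ = sg (η c) ^ τ p), Finset.prod_pow_eq_pow_sum]
  · unfold labOf
    by_cases he : Even (∑ p with κ p = c, τ p)
    · simp [he, sg_pow_of_even]
    · simp [he, sg_pow_of_odd _ (Nat.not_even_iff_odd.1 he)]
  · rw [Function.comp_apply, (Finset.mem_filter.1 hp).2]

theorem mono_congr {τ τ' : P → ℕ} (hl : labOf κ τ = labOf κ τ') {ε : P → Bool} (hε : Inv π ε) :
    mono π τ ε = mono π τ' ε := by
  obtain ⟨η, rfl⟩ := (h.inv_iff ε).1 hε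
  rw [h.mono_eq, h.mono_eq, hl]

theorem wt_eq (M : Finset P) (t : ℝ) (τ : P → ℕ) : wt M t π τ = ∑ c, signOf (labOf κ τ c) *
    if Odd (M.filter fun p => κ p = c).card then 1 - t else 1 := by
  unfold wt
  symm
  refine Finset.sum_bij (fun c _ => Finset.univ.filter fun q => κ q = c) (fun c _ => ?_)
    (fun c _ c' _ hcc => ?_) (fun o ho => ?_) (fun c _ => ?_)
  · obtain ⟨p, rfl⟩ := h.surj c
    rw [h.filter_eq]
    exact orb_mem_orbs π p
  · obtain ⟨p, rfl⟩ := h.surj c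
    have : p ∈ Finset.univ.filter fun q => κ q = κ p := by simp
    have hcc' : (Finset.univ.filter fun q => κ q = κ p) = Finset.univ.filter fun q => κ q = c' := hcc
    rw [hcc'] at this
    exact (Finset.mem_filter.1 this).2
  · obtain ⟨p, rfl⟩ := mem_orbs.1 ho
    exact ⟨κ p, Finset.mem_univ _, h.filter_eq p⟩
  · unfold degOn
    rw [neg_one_pow_eq_signOf]
    congr 3
    congr 1
    ext q
    simp

theorem wt_congr (M : Finset P) (t : ℝ) {τ τ' : P → ℕ} (hl : labOf κ τ = labOf κ τ') :
    wt M t π τ = wt M t π τ' := by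
  rw [h.wt_eq, h.wt_eq, hl]

/-- The coefficients of labelled generators can be read off from the values. -/
theorem eq_zero_of_sum_mono {g : (C → Bool) → ℂ}
    (hg : ∀ ε, Inv π ε → ∑ lab, g lab * mono π (tauOf κ ρ lab) ε = 0) : g = 0 := by
  funext lab
  have h1 : ∀ η : C → Bool, ∑ lab', g lab' * chi lab' η = 0 := fun η => by
    have := hg (η ∘ κ) ((h.inv_iff _).2 ⟨η, rfl⟩)
    simp only [h.mono_eq, h.labOf_tauOf, ← mul_assoc, ← Finset.sum_mul] at this
    exact (mul_eq_zero.1 this).resolve_right (nrm_ne_zero _ _)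
  have h2 : ∑ η : C → Bool, (∑ lab', g lab' * chi lab' η) * chi lab η = 0 := by simp [h1]
  simp only [Finset.sum_mul] at h2
  rw [Finset.sum_comm] at h2
  simp only [mul_assoc, ← Finset.mul_sum, sum_chi_mul_chi] at h2
  simpa using h2

theorem exists_sum_mono {M : Finset P} {t a : ℝ} {f : (P → Bool) → ℂ} (hf : f ∈ Fil M t π a) :
    ∃ g : (C → Bool) → ℂ, (∀ lab, g lab ≠ 0 → a ≤ wt M t π (tauOf κ ρ lab)) ∧
      ∀ ε, Inv π ε → f ε = ∑ lab, g lab * mono π (tauOf κ ρ lab) ε := by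
  induction hf using Submodule.span_induction with
  | mem f hf =>
    obtain ⟨c, τ, hc, hf⟩ := hf
    refine ⟨fun lab => if lab = labOf κ τ then c else 0, fun lab hl => ?_, fun ε hε => ?_⟩
    · by_cases h1 : lab = labOf κ τ
      · subst h1
        rw [h.wt_congr M t (h.labOf_tauOf (labOf κ τ))]
        exact hc fun h2 => hl (by simp [h2])
      · exact absurd (if_neg h1) hl
    · rw [hf ε hε]
      simp only [ite_mul, zero_mul, Finset.sum_ite_eq', Finset.mem_univ, if_true]
      rw [h.mono_congr (h.labOf_tauOf (labOf κ τ)) hε]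
  | zero => exact ⟨0, fun lab h => absurd rfl h, fun ε _ => by simp⟩
  | add f f' _ _ hf hf' =>
    obtain ⟨g, hg, hfg⟩ := hf
    obtain ⟨g', hg', hfg'⟩ := hf'
    refine ⟨g + g', fun lab hl => ?_, fun ε hε => ?_⟩
    · by_cases h1 : g lab = 0
      · exact hg' lab fun h2 => hl (by simp [h1, h2])
      · exact hg lab h1
    · simp only [Pi.add_apply, add_mul, Finset.sum_add_distrib, hfg ε hε, hfg' ε hε]
  | smul c f _ hf =>
    obtain ⟨g, hg, hfg⟩ := hf
    refine ⟨c • g, fun lab hl => hg lab fun h1 => hl (by simp [h1]), fun ε hε => ?_⟩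
    simp only [Pi.smul_apply, smul_eq_mul, mul_assoc, ← Finset.mul_sum, hfg ε hε]

end IsCycles

end Labels

section Saddle

variable {P C C' : Type*} [DecidableEq P] [Fintype P] [Fintype C] [Fintype C']
  {π π' : Perm P} {κ : P → C} {ρ : C → P} {κ' : P → C'} {ρ' : C' → P} {x y : P}

theorem mergeCoeff_parity (a b : ℕ) (r : Bool) : mergeCoeff (decide (Even a)) (decide (Even b)) r =
    if r = decide (Even (a + b)) then 1 else 0 := by
  simp only [Nat.even_add]
  by_cases ha : Even a <;> by_cases hb : Even b <;> cases r <;> simp [ha, hb, mergeCoeff]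

theorem splitCoeff_parity (a b : ℕ) (q r : Bool) : splitCoeff (decide (Even (a + b))) q r =
    (if q = decide (Even (a + 1)) ∧ r = decide (Even b) then 1 else 0) +
    if q = decide (Even a) ∧ r = decide (Even (b + 1)) then 1 else 0 := by
  simp only [Nat.even_add, Nat.even_add_one]
  by_cases ha : Even a <;> by_cases hb : Even b <;> cases q <;> cases r <;>
    simp [ha, hb, splitCoeff]

theorem not_mem_union_iff (h : IsCycles π κ ρ) (z : P) :
    z ∉ orb π x ∪ orb π y ↔ κ z ≠ κ x ∧ κ z ≠ κ y := by
  rw [Finset.mem_union, mem_orb, mem_orb, ← h.iff, ← h.iff, not_or]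
  exact and_congr ne_comm ne_comm

/-- The coefficient of a merge in terms of exponents. -/
theorem merge_labels (h : IsCycles π κ ρ) (h' : IsCycles (π * swap x y) κ' ρ')
    (hxy : ¬ π.SameCycle x y) (τ : P → ℕ) (lab' : C' → Bool) :
    (if ∀ z, κ z ≠ κ x → κ z ≠ κ y → lab' (κ' z) = labOf κ τ (κ z) then
      mergeCoeff (labOf κ τ (κ x)) (labOf κ τ (κ y)) (lab' (κ' x)) else 0) =
    if lab' = labOf κ' τ then 1 else 0 := by
  have hx : x ∈ orb π x ∪ orb π y := by simp [Equiv.Perm.SameCycle.refl]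
  have e : labOf κ' τ (κ' x) = decide (Even (∑ q ∈ orb π x, τ q + ∑ q ∈ orb π y, τ q)) := by
    rw [h'.labOf_apply, orb_mul_swap_of_mem hxy hx, Finset.sum_union (disjoint_orb hxy)]
  have hiff : lab' = labOf κ' τ ↔ (∀ z, κ z ≠ κ x → κ z ≠ κ y → lab' (κ' z) = labOf κ τ (κ z)) ∧
      lab' (κ' x) = labOf κ' τ (κ' x) := by
    constructor
    · rintro rfl
      refine ⟨fun z h1 h2 => ?_, rfl⟩
      rw [h'.labOf_apply, h.labOf_apply,
        orb_mul_swap_of_not_mem hxy ((not_mem_union_iff h z).2 ⟨h1, h2⟩)]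
    · rintro ⟨h1, h2⟩
      funext c
      obtain ⟨z, rfl⟩ := h'.surj c
      by_cases hz : z ∈ orb π x ∪ orb π y
      · have : κ' z = κ' x := by
          rw [h'.iff, ← orb_eq_iff, orb_mul_swap_of_mem hxy hz, orb_mul_swap_of_mem hxy hx]
        rw [this, h2]
      · have hz' := (not_mem_union_iff h z).1 hz
        rw [h1 z hz'.1 hz'.2, h'.labOf_apply, h.labOf_apply, orb_mul_swap_of_not_mem hxy hz]
  rw [h.labOf_apply τ x, h.labOf_apply τ y, mergeCoeff_parity, ← e]
  by_cases h1 : ∀ z, κ z ≠ κ x → κ z ≠ κ y → lab' (κ' z) = labOf κ τ (κ z)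
  · rw [if_pos h1]
    by_cases h2 : lab' (κ' x) = labOf κ' τ (κ' x)
    · rw [if_pos h2, if_pos (hiff.2 ⟨h1, h2⟩)]
    · rw [if_neg h2, if_neg fun h3 => h2 (hiff.1 h3).2]
  · rw [if_neg h1, if_neg fun h3 => h1 (hiff.1 h3).1]

/-- The coefficient of a split in terms of exponents. -/
theorem split_labels (h : IsCycles (π * swap x y) κ ρ) (h' : IsCycles π κ' ρ')
    (hxy : ¬ π.SameCycle x y) (τ : P → ℕ) (lab' : C' → Bool) :
    (if ∀ z, κ z ≠ κ x → κ z ≠ κ y → lab' (κ' z) = labOf κ τ (κ z) then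
      splitCoeff (labOf κ τ (κ x)) (lab' (κ' x)) (lab' (κ' y)) else 0) =
    (if lab' = labOf κ' (τ + Pi.single x 1) then 1 else 0) +
      if lab' = labOf κ' (τ + Pi.single y 1) then 1 else 0 := by
  have hx : x ∈ orb π x ∪ orb π y := by simp [Equiv.Perm.SameCycle.refl]
  have hy : y ∈ orb π x ∪ orb π y := by simp [Equiv.Perm.SameCycle.refl]
  have hκ : κ x = κ y := (h.iff _ _).2 (sameCycle_mul_swap hxy)
  have e : labOf κ τ (κ x) = decide (Even (∑ q ∈ orb π x, τ q + ∑ q ∈ orb π y, τ q)) := by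
    rw [h.labOf_apply, orb_mul_swap_of_mem hxy hx, Finset.sum_union (disjoint_orb hxy)]
  have hsingle : ∀ z p, ∑ q ∈ orb π p, (τ + Pi.single z 1 : P → ℕ) q =
      ∑ q ∈ orb π p, τ q + if π.SameCycle p z then 1 else 0 := fun z p => by
    simp only [Pi.add_apply, Finset.sum_add_distrib, Finset.sum_pi_single', mem_orb]
  have hin : ∀ z, z ∉ orb π x ∪ orb π y ↔ κ z ≠ κ x := fun z => by
    rw [not_iff_comm, not_not, h.iff, ← orb_eq_iff, orb_mul_swap_of_mem hxy hx]
    constructor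
    · intro hz
      by_contra hz'
      rw [orb_mul_swap_of_not_mem hxy hz'] at hz
      exact hz' (by rw [← hz]; simp [Equiv.Perm.SameCycle.refl])
    · exact fun hz => orb_mul_swap_of_mem hxy hz
  have hiff : ∀ w, w = x ∨ w = y → (lab' = labOf κ' (τ + Pi.single w 1) ↔
      (∀ z, κ z ≠ κ x → κ z ≠ κ y → lab' (κ' z) = labOf κ τ (κ z)) ∧
      lab' (κ' x) = decide (Even (∑ q ∈ orb π x, τ q + if π.SameCycle x w then 1 else 0)) ∧
      lab' (κ' y) = decide (Even (∑ q ∈ orb π y, τ q + if π.SameCycle y w then 1 else 0))) := by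
    intro w hw
    have hout : ∀ z, z ∉ orb π x ∪ orb π y →
        labOf κ' (τ + Pi.single w 1) (κ' z) = labOf κ τ (κ z) := fun z hz => by
      rw [h'.labOf_apply, h.labOf_apply, orb_mul_swap_of_not_mem hxy hz, hsingle, if_neg, add_zero]
      simp only [Finset.mem_union, mem_orb, not_or] at hz
      rcases hw with rfl | rfl
      · exact fun h => hz.1 h.symm
      · exact fun h => hz.2 h.symm
    constructor
    · rintro rfl
      refine ⟨fun z h1 _ => hout z ((hin z).2 h1), ?_, ?_⟩ <;> rw [h'.labOf_apply, hsingle]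
    · rintro ⟨h1, h2, h3⟩
      funext c
      obtain ⟨z, rfl⟩ := h'.surj c
      by_cases hz : z ∈ orb π x ∪ orb π y
      · rcases Finset.mem_union.1 hz with hz | hz
        · rw [← (h'.iff x z).2 (mem_orb.1 hz), h2, h'.labOf_apply, hsingle]
        · rw [← (h'.iff y z).2 (mem_orb.1 hz), h3, h'.labOf_apply, hsingle]
      · have hz' := (hin z).1 hz
        rw [hout z hz, h1 z hz' (by rwa [← hκ])]
  have hyx : ¬ π.SameCycle y x := fun h => hxy h.symm
  have i1 := hiff x (Or.inl rfl)
  have i2 := hiff y (Or.inr rfl)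
  rw [if_pos (Equiv.Perm.SameCycle.refl π x), if_neg hyx, add_zero] at i1
  rw [if_neg hxy, if_pos (Equiv.Perm.SameCycle.refl π y), add_zero] at i2
  rw [e, splitCoeff_parity]
  by_cases h1 : ∀ z, κ z ≠ κ x → κ z ≠ κ y → lab' (κ' z) = labOf κ τ (κ z)
  · rw [if_pos h1]
    congr 1
    · exact if_congr (by rw [i1]; exact (and_iff_right h1).symm) rfl rfl
    · exact if_congr (by rw [i2]; exact (and_iff_right h1).symm) rfl rfl
  · rw [if_neg h1, if_neg fun h3 => h1 (i1.1 h3).1, if_neg fun h3 => h1 (i2.1 h3).1, add_zero]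

theorem mergeCoeff_comm (p q r : Bool) : mergeCoeff p q r = mergeCoeff q p r := by
  cases p <;> cases q <;> cases r <;> rfl

theorem splitCoeff_comm (p q r : Bool) : splitCoeff p q r = splitCoeff p r q := by
  cases p <;> cases q <;> cases r <;> rfl

end Saddle

section Bridge

variable {n : ℕ} (w : BraidWord n)

/-- The crossings of a braid word as letters without idle layers. -/
def letters (l : Fin w.length) : Letter n := (some (w.get l).1, (w.get l).2)

/-- The flat diagram of a complete resolution. -/
abbrev flat (S : Vertex w) : Shape w.length n := shape (letters w) S

theorem flat_of_braidlike {S : Vertex w} {l : Fin w.length} (h : IsBraidlike w S l) :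
    flat w S l = none := if_pos h

theorem flat_of_not {S : Vertex w} {l : Fin w.length} (h : ¬ IsBraidlike w S l) :
    flat w S l = some (w.get l).1 := if_neg h

theorem col_flat_iff (S : Vertex w) (ε : Pt w → Bool) :
    Col (flat w S) ε ↔ ∀ x y, Joined w S x y → ε x = ε y := by
  constructor
  · rintro hε x y hxy
    cases hxy with
    | strand l p hl hr =>
      by_cases hb : IsBraidlike w S l
      · exact congrFun (hε.layer (flat_of_braidlike w hb)) p
      · exact (hε.layer (flat_of_not w hb)).2.2 p hl hr
    | left l h => exact congrFun (hε.layer (flat_of_braidlike w h)) _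
    | right l h => exact congrFun (hε.layer (flat_of_braidlike w h)) _
    | lower l h => exact (hε.layer (flat_of_not w h)).1
    | upper l h => exact (hε.layer (flat_of_not w h)).2.1
    | closing p => exact congrFun hε.2 p
  · intro h
    refine ⟨fun l => ?_, funext fun p => h _ _ (.closing p)⟩
    by_cases hb : IsBraidlike w S l
    · rw [flat_of_braidlike w hb]
      funext p
      by_cases hl : p = leftPos (w.get l).1
      · subst hl; exact h _ _ (.left l hb)
      by_cases hr : p = rightPos (w.get l).1
      · subst hr; exact h _ _ (.right l hb)
      exact h _ _ (.strand l p hl hr)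
    · rw [flat_of_not w hb]
      exact ⟨h _ _ (.lower l hb), h _ _ (.upper l hb), fun p hl hr => h _ _ (.strand l p hl hr)⟩

instance instFintypeCircle (S : Vertex w) : Fintype (Circle w S) :=
  have : Finite (Circle w S) := Quot.finite _
  Fintype.ofFinite _

theorem isCycles_circleAt (S : Vertex w) :
    IsCycles (circPerm (flat w S)) (circleAt w S) Quot.out where
  rep := Quot.out_eq
  iff p q := by
    constructor
    · intro h
      rw [sameCycle_iff]
      intro ε hε
      have hj := (col_flat_iff w S ε).1 ((inv_circPerm_iff _ ε).1 hε)
      exact congrArg (Quot.lift ε hj) h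
    · intro h
      have hc : Col (flat w S) fun r => decide (circleAt w S p = circleAt w S r) :=
        (col_flat_iff w S _).2 fun x y hxy => by
          have : circleAt w S x = circleAt w S y := Quot.sound hxy
          simp only [this]
      have := ((inv_circPerm_iff _ _).2 hc).sameCycle h
      simpa using this

/-- The points `cornerA`, `cornerB` and the two points `outCorners` lie on the same circles. -/
theorem corners_eq (S : Vertex w) (l : Fin w.length) :
    (circleAt w S (cornerA w l) = circleAt w S (outCorners l (w.get l).1).1 ∧
      circleAt w S (cornerB w l) = circleAt w S (outCorners l (w.get l).1).2) ∨
    (circleAt w S (cornerA w l) = circleAt w S (outCorners l (w.get l).1).2 ∧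
      circleAt w S (cornerB w l) = circleAt w S (outCorners l (w.get l).1).1) := by
  rcases outCorners_eq l (w.get l).1 with e | e <;> rw [e]
  · exact Or.inl ⟨rfl, rfl⟩
  · by_cases hb : IsBraidlike w S l
    · exact Or.inl ⟨Quot.sound (.left l hb), (Quot.sound (.right l hb)).symm⟩
    · exact Or.inr ⟨Quot.sound (.lower l hb), (Quot.sound (.upper l hb)).symm⟩

/-- The values of a chain at the colourings. -/
def toModel : Chain w →ₗ[ℂ] Ch w.length n where
  toFun f S ε := ∑ lab : Circle w S → Bool,
    f ⟨S, lab⟩ * mono (circPerm (flat w S)) (tauOf (circleAt w S) Quot.out lab) ε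
  map_add' f g := by
    ext S ε; simp only [Pi.add_apply, add_mul, Finset.sum_add_distrib]
  map_smul' c f := by
    ext S ε
    simp only [Pi.smul_apply, smul_eq_mul, RingHom.id_apply, mul_assoc, ← Finset.mul_sum]

theorem toModel_apply (f : Chain w) (S : Vertex w) (ε : Pt w → Bool) : toModel w f S ε =
    ∑ lab : Circle w S → Bool,
      f ⟨S, lab⟩ * mono (circPerm (flat w S)) (tauOf (circleAt w S) Quot.out lab) ε := rfl

theorem sum_get_eq_countP {α : Type*} (v : List α) (p : α → Bool) :
    ∑ l : Fin v.length, (if p (v.get l) then (1 : ℤ) else 0) = v.countP p := by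
  induction v with
  | nil => simp
  | cons a v ih =>
    rw [List.countP_cons]
    have : ∑ l : Fin (a :: v).length, (if p ((a :: v).get l) then (1 : ℤ) else 0) =
        (if p a then 1 else 0) + ∑ l : Fin v.length, (if p (v.get l) then (1 : ℤ) else 0) :=
      Fin.sum_univ_succ _
    rw [this, ih]
    push_cast
    ring

theorem shift_letters (S : Vertex w) :
    shift (letters w) S = height w S + posCrossings w - 2 * negCrossings w := by
  have h1 : (height w S : ℤ) = ∑ l, ((S l).toNat : ℤ) := by
    unfold height
    rw [Nat.card_eq_fintype_card, Fintype.card_subtype, Finset.card_filter]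
    push_cast
    refine Finset.sum_congr rfl fun l _ => ?_
    cases S l <;> simp
  unfold shift posCrossings negCrossings
  rw [h1, ← sum_get_eq_countP, ← sum_get_eq_countP, Finset.mul_sum, ← Finset.sum_add_distrib,
    ← Finset.sum_sub_distrib]
  refine Finset.sum_congr rfl fun l _ => ?_
  unfold letters
  cases hb : (w.get l).2 <;> simp [letterShift] <;> ring

theorem isNontrivial_iff (S : Vertex w) (c : Circle w S) : IsNontrivial w S c ↔
    Odd ((marks w.length n).filter fun q => circleAt w S q = c).card := by
  unfold IsNontrivial
  have : Nat.card {p : Fin n // circleAt w S (0, p) = c} =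
      ((marks w.length n).filter fun q => circleAt w S q = c).card := by
    rw [Nat.card_eq_fintype_card, Fintype.card_subtype]
    refine Finset.card_bij (fun p _ => (0, p)) (fun p hp => ?_) (fun p _ q _ h => ?_) (fun q hq => ?_)
    · rw [Finset.mem_filter] at hp ⊢
      exact ⟨by simp [marks], hp.2⟩
    · exact (Prod.ext_iff.1 h).2
    · obtain ⟨q1, q2⟩ := q
      rw [Finset.mem_filter] at hq
      have h0 : q1 = 0 := (Finset.mem_filter.1 hq.1).2
      subst h0
      exact ⟨q2, by simpa using hq.2, rfl⟩
  rw [this]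

theorem jtGrading_eq (t : ℝ) (S : Vertex w) (lab : Circle w S → Bool) :
    jtGrading w t ⟨S, lab⟩ = wt (marks w.length n) t (circPerm (flat w S))
      (tauOf (circleAt w S) Quot.out lab) + shift (letters w) S := by
  have hs : ∀ b, (labelDeg b : ℝ) = signOf b := fun b => by cases b <;> simp [labelDeg, signOf]
  rw [(isCycles_circleAt w S).wt_eq, (isCycles_circleAt w S).labOf_tauOf, shift_letters]
  unfold jtGrading jGrading kGrading
  rw [finsum_eq_sum_of_fintype, finsum_eq_sum_of_fintype]
  push_cast
  have : ∑ c : Circle w S, signOf (lab c) * (if Odd ((marks w.length n).filter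
      fun q => circleAt w S q = c).card then 1 - t else 1) = ∑ c : Circle w S, signOf (lab c) -
      t * ∑ c : Circle w S, if IsNontrivial w S c then signOf (lab c) else 0 := by
    rw [Finset.mul_sum, ← Finset.sum_sub_distrib]
    refine Finset.sum_congr rfl fun c _ => ?_
    simp only [isNontrivial_iff]
    split_ifs <;> ring
  rw [this]
  simp only [hs]
  ring

theorem adm_letters (S : Vertex w) : Adm (letters w) S := fun l hl => by cases hl

theorem toModel_mem {t s : ℝ} {f : Chain w} (hf : f ∈ filtration w t s) :
    toModel w f ∈ FM (letters w) t s := by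
  intro S _
  have : toModel w f S = ∑ lab : Circle w S → Bool, f ⟨S, lab⟩ •
      mono (circPerm (flat w S)) (tauOf (circleAt w S) Quot.out lab) := by
    funext ε
    rw [toModel_apply, Finset.sum_apply]
    rfl
  rw [this]
  refine Submodule.sum_mem _ fun lab _ => mem_Fil_of (f ⟨S, lab⟩) _ (fun hne => ?_) fun ε _ => rfl
  have := hf ⟨S, lab⟩ hne
  rw [jtGrading_eq] at this
  linarith

theorem toModel_injective {f g : Chain w}
    (h : ∀ S ε, Col (flat w S) ε → toModel w f S ε = toModel w g S ε) : f = g := by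
  have : ∀ S, (fun lab : Circle w S → Bool => f ⟨S, lab⟩ - g ⟨S, lab⟩) = 0 := fun S =>
    (isCycles_circleAt w S).eq_zero_of_sum_mono fun ε hε => by
      have := h S ε ((inv_circPerm_iff _ ε).1 hε)
      rw [toModel_apply, toModel_apply] at this
      simp only [sub_mul, Finset.sum_sub_distrib, this, sub_self]
  funext e
  obtain ⟨S, lab⟩ := e
  exact sub_eq_zero.1 (congrFun (this S) lab)

theorem exists_toModel_eq {t s : ℝ} {F : Ch w.length n} (hF : F ∈ FM (letters w) t s) :
    ∃ f ∈ filtration w t s, ∀ S ε, Col (flat w S) ε → toModel w f S ε = F S ε := by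
  have h : ∀ S, ∃ g : (Circle w S → Bool) → ℂ, _ := fun S =>
    (isCycles_circleAt w S).exists_sum_mono (hF S (adm_letters w S))
  choose g hg hgF using h
  refine ⟨fun e => g e.1 e.2, fun e he => ?_, fun S ε hε => ?_⟩
  · obtain ⟨S, lab⟩ := e
    have := hg S lab he
    rw [jtGrading_eq]
    linarith
  · rw [toModel_apply, hgF S ε ((inv_circPerm_iff _ ε).2 hε)]

theorem mem_filtration_iff {t s : ℝ} {f : Chain w} :
    f ∈ filtration w t s ↔ toModel w f ∈ FM (letters w) t s := by
  refine ⟨toModel_mem w, fun h => ?_⟩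
  obtain ⟨g, hg, hgf⟩ := exists_toModel_eq w h
  rwa [toModel_injective w fun S ε hε => (hgf S ε hε).symm]

end Bridge

section BridgeDifferential

variable {n : ℕ} (w : BraidWord n)

theorem vsign_eq_pow {N : ℕ} (S : Vtx N) (l : Fin N) :
    vsign S l = (-1) ^ Nat.card {k : Fin N // k < l ∧ S k = true} := by
  unfold vsign
  rw [Nat.card_eq_fintype_card, Fintype.card_subtype, Finset.prod_ite]
  simp

theorem edgeSign_update (S : Vertex w) (l : Fin w.length) :
    edgeSign w (Function.update S l false) l = vsign S l := by
  unfold edgeSign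
  rw [← vsign_eq_pow]
  exact vsign_congr fun k hk => Function.update_of_ne hk.ne ..

/-- The contribution of the crossing `l` to an entry of the matrix. -/
def edgeEntry (l : Fin w.length) (e e' : Gen w) : ℂ :=
  if IsEdge w l e e' then edgeSign w e.1 l * localCoeff w l e e' else 0

theorem edgeEntry_eq_zero {l : Fin w.length} {e e' : Gen w}
    (h : ¬ (e'.1 l = true ∧ e.1 = Function.update e'.1 l false)) : edgeEntry w l e e' = 0 := by
  refine if_neg fun he => h ?_
  obtain ⟨h1, h2, -⟩ := he
  rw [h2]
  refine ⟨by simp, ?_⟩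
  rw [Function.update_idem, ← h1, Function.update_eq_self]

theorem sum_gen {F : Gen w → ℂ} (S : Vertex w) (hF : ∀ e, e.1 ≠ S → F e = 0) :
    ∑ e, F e = ∑ lab : Circle w S → Bool, F ⟨S, lab⟩ := by
  symm
  refine Finset.sum_of_injOn (fun lab => (⟨S, lab⟩ : Gen w)) (fun a _ b _ h => ?_)
    (fun _ _ => Finset.mem_coe.2 (Finset.mem_univ _)) (fun e _ he => hF e fun h => he ?_)
    fun _ _ => rfl
  · simpa using h
  · obtain ⟨S', lab⟩ := e
    subst h
    exact ⟨lab, Finset.mem_coe.2 (Finset.mem_univ _), rfl⟩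

theorem flat_update {S : Vertex w} {l : Fin w.length} (hl : S l = true) :
    ((flat w (Function.update S l false) l = none ∧ flat w S l = some (w.get l).1) ∨
      (flat w (Function.update S l false) l = some (w.get l).1 ∧ flat w S l = none)) ∧
    circPerm (flat w S) = circPerm (flat w (Function.update S l false)) *
      swap (outCorners l (w.get l).1).1 (outCorners l (w.get l).1).2 := by
  have h1 : (flat w (Function.update S l false) l = none ∧ flat w S l = some (w.get l).1) ∨
      (flat w (Function.update S l false) l = some (w.get l).1 ∧ flat w S l = none) := by
    simp only [shape, letters, Function.update_self, hl]
    cases (w.get l).2 <;> simp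
  refine ⟨h1, ?_⟩
  have h2 := circPerm_update_eq (flat w (Function.update S l false)) l (w.get l).1 h1
  rw [Function.update_eq_self] at h2
  rw [← h2]
  congr 1
  funext k
  by_cases hk : k = l
  · subst hk; simp
  · simp [shape, hk]

/-- The contribution of a crossing to the differential, evaluated at a colouring. -/
theorem sum_edgeEntry {S S₀ : Vertex w} {l : Fin w.length} (hl : S l = true)
    (hS₀ : S₀ = Function.update S l false) (lab : Circle w S₀ → Bool) {ε : Pt w → Bool} (hε : Col (flat w S) ε) :
    ∑ lab' : Circle w S → Bool, edgeEntry w l ⟨S₀, lab⟩ ⟨S, lab'⟩ *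
      mono (circPerm (flat w S)) (tauOf (circleAt w S) Quot.out lab') ε =
    vsign S l * kap (letters w l).1 (row ε l.castSucc) (row ε l.succ) *
      mono (circPerm (flat w S₀))
        (tauOf (circleAt w S₀) Quot.out lab) ε := by
  obtain ⟨hu, hperm⟩ := flat_update w hl
  rw [← hS₀] at hu hperm
  have hlayer : LayerOK none (row ε l.castSucc) (row ε l.succ) ∨
      LayerOK (some (w.get l).1) (row ε l.castSucc) (row ε l.succ) := by
    rcases hu with ⟨-, h⟩ | ⟨-, h⟩
    · exact Or.inr (hε.layer h)
    · exact Or.inl (hε.layer h)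
  have hkap : kap (letters w l).1 (row ε l.castSucc) (row ε l.succ) = _ := kap_eq hlayer
  have hc := corners_eq w S₀ l
  have hc' := corners_eq w S l
  have hne := outCorners_ne l (w.get l).1
  have hinv : Inv (circPerm (flat w S)) ε := (inv_circPerm_iff _ ε).2 hε
  have hS' := isCycles_circleAt w S
  have hS := isCycles_circleAt w S₀
  set x := (outCorners l (w.get l).1).1
  set y := (outCorners l (w.get l).1).2
  set τ := tauOf (circleAt w S₀) Quot.out lab
  have hlab : labOf (circleAt w S₀) τ = lab := hS.labOf_tauOf lab
  have hedge : ∀ lab', IsEdge w l ⟨S₀, lab⟩ ⟨S, lab'⟩ ↔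
      ∀ z, (circleAt w S₀) z ≠ (circleAt w S₀) x → (circleAt w S₀) z ≠ (circleAt w S₀) y → lab' ((circleAt w S) z) = labOf (circleAt w S₀) τ ((circleAt w S₀) z) := fun lab' => by
    have h1 : S = Function.update S₀ l true := by
      rw [hS₀, Function.update_idem, ← hl, Function.update_eq_self]
    unfold IsEdge
    rw [hlab]
    constructor
    · rintro ⟨-, -, h3⟩ z h4 h5
      rcases hc with ⟨e1, e2⟩ | ⟨e1, e2⟩
      · exact h3 z (by rw [e1]; exact h4) (by rw [e2]; exact h5)
      · exact h3 z (by rw [e1]; exact h5) (by rw [e2]; exact h4)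
    · intro h3
      refine ⟨(congrFun hS₀ l).trans (Function.update_self ..), h1, fun z h4 h5 => ?_⟩
      rcases hc with ⟨e1, e2⟩ | ⟨e1, e2⟩
      · exact h3 z (by rw [← e1]; exact h4) (by rw [← e2]; exact h5)
      · exact h3 z (by rw [← e2]; exact h5) (by rw [← e1]; exact h4)
  have he : edgeSign w S₀ l = vsign S l := by rw [hS₀, edgeSign_update]
  have hentry : ∀ lab', edgeEntry w l ⟨S₀, lab⟩ ⟨S, lab'⟩ = vsign S l *
      if ∀ z, (circleAt w S₀) z ≠ (circleAt w S₀) x → (circleAt w S₀) z ≠ (circleAt w S₀) y → lab' ((circleAt w S) z) = labOf (circleAt w S₀) τ ((circleAt w S₀) z) then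
        localCoeff w l ⟨S₀, lab⟩ ⟨S, lab'⟩ else 0 := fun lab' => by
    unfold edgeEntry
    rw [if_congr (hedge lab') rfl rfl, he, mul_ite, mul_zero]
  rw [hkap]
  by_cases hsc : (circPerm (flat w S₀)).SameCycle x y
  · have hκ : (circleAt w S₀) x = (circleAt w S₀) y := (hS.iff x y).2 hsc
    have hloc : ∀ lab', localCoeff w l ⟨S₀, lab⟩ ⟨S, lab'⟩ =
        splitCoeff (labOf (circleAt w S₀) τ ((circleAt w S₀) x)) (lab' ((circleAt w S) x)) (lab' ((circleAt w S) y)) := fun lab' => by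
      have hA : circleAt w S₀ (cornerA w l) = (circleAt w S₀) x ∧ circleAt w S₀ (cornerB w l) = (circleAt w S₀) x := by
        rcases hc with ⟨e1, e2⟩ | ⟨e1, e2⟩
        · exact ⟨e1, e2.trans hκ.symm⟩
        · exact ⟨e1.trans hκ.symm, e2⟩
      unfold localCoeff
      simp only [hA.1, hA.2, ne_eq, not_true_eq_false, if_false, hlab]
      rcases hc' with ⟨e1, e2⟩ | ⟨e1, e2⟩
      · rw [e1, e2]
      · rw [e1, e2, splitCoeff_comm]
    have hperm2 : circPerm (flat w S₀) = circPerm (flat w S) * swap x y := by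
      rw [hperm, mul_swap_mul_swap]
    have hns : ¬ (circPerm (flat w S)).SameCycle x y := by
      rw [hperm]; exact not_sameCycle_mul_swap hsc hne
    rw [hperm2] at hS
    have key := split_labels hS hS' hns τ
    have hm := mono_mul_swap_of_sameCycle hne hsc τ (ε := ε) (by rw [← hperm]; exact hinv)
    rw [mul_assoc, hm, ← hperm, ← hS'.mono_congr (hS'.labOf_tauOf (labOf (circleAt w S) (τ + Pi.single x 1))) hinv,
      ← hS'.mono_congr (hS'.labOf_tauOf (labOf (circleAt w S) (τ + Pi.single y 1))) hinv]
    simp only [hentry, hloc, key]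
    simp only [mul_assoc, ← Finset.mul_sum, add_mul, ite_mul, one_mul, zero_mul, Finset.sum_add_distrib,
      Finset.sum_ite_eq', Finset.mem_univ, if_true]
  · have hκ : (circleAt w S₀) x ≠ (circleAt w S₀) y := fun h => hsc ((hS.iff x y).1 h)
    have hκ' : (circleAt w S) x = (circleAt w S) y := (hS'.iff x y).2 (by rw [hperm]; exact sameCycle_mul_swap hsc)
    have hloc : ∀ lab', localCoeff w l ⟨S₀, lab⟩ ⟨S, lab'⟩ =
        mergeCoeff (labOf (circleAt w S₀) τ ((circleAt w S₀) x)) (labOf (circleAt w S₀) τ ((circleAt w S₀) y)) (lab' ((circleAt w S) x)) := fun lab' => by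
      have hA : circleAt w S (cornerA w l) = (circleAt w S) x := by
        rcases hc' with ⟨e1, e2⟩ | ⟨e1, e2⟩
        · exact e1
        · exact e1.trans hκ'.symm
      unfold localCoeff
      simp only [hA]
      rcases hc with ⟨e1, e2⟩ | ⟨e1, e2⟩
      · rw [e1, e2, if_pos hκ, hlab]
      · rw [e1, e2, if_pos hκ.symm, hlab, mergeCoeff_comm]
    have hS'' := hS'
    rw [hperm] at hS''
    have key := merge_labels hS hS'' hsc τ
    have hm := mono_mul_swap_of_not hsc τ (ε := ε) (by rw [← hperm]; exact hinv)
    rw [if_pos (hS'.iff x y |>.1 hκ' |> hinv.sameCycle), mul_assoc, hm, ← hperm,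
      ← hS'.mono_congr (hS'.labOf_tauOf (labOf (circleAt w S) τ)) hinv]
    simp only [hentry, hloc, key]
    simp only [mul_assoc, ← Finset.mul_sum, ite_mul, one_mul, zero_mul,
      Finset.sum_ite_eq', Finset.mem_univ, if_true]

theorem toModel_leeDifferential (f : Chain w) (S : Vertex w) {ε : Pt w → Bool}
    (hε : Col (flat w S) ε) :
    toModel w (leeDifferential w f) S ε = dM (letters w) (toModel w f) S ε := by
  rw [toModel_apply]
  have h1 : ∀ lab, leeDifferential w f ⟨S, lab⟩ =
      ∑ l, ∑ e, edgeEntry w l e ⟨S, lab⟩ * f e := fun lab => by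
    rw [Finset.sum_comm]
    change ∑ e, (∑ l, _) * f e = _
    simp only [Finset.sum_mul]
    rfl
  simp only [h1, Finset.sum_mul]
  rw [Finset.sum_comm]
  unfold dM
  refine Finset.sum_congr rfl fun l _ => ?_
  rw [Finset.sum_comm]
  unfold dTerm
  by_cases hl : S l = true
  · rw [if_pos hl, sum_gen w (Function.update S l false), toModel_apply, Finset.mul_sum]
    · refine Finset.sum_congr rfl fun lab _ => ?_
      have := sum_edgeEntry w hl rfl lab hε
      rw [mul_left_comm, ← this, Finset.mul_sum]
      refine Finset.sum_congr rfl fun lab' _ => ?_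
      ring
    · intro e he
      refine Finset.sum_eq_zero fun lab _ => ?_
      rw [edgeEntry_eq_zero w fun h => he h.2]
      ring
  · rw [if_neg hl]
    refine Finset.sum_eq_zero fun e _ => Finset.sum_eq_zero fun lab _ => ?_
    rw [edgeEntry_eq_zero w fun h => hl h.1]
    ring

end BridgeDifferential

section BridgeLevels

variable {n : ℕ} (w : BraidWord n)

theorem flat_braidlikeVertex (l : Fin w.length) : flat w (braidlikeVertex w) l = none := if_pos rfl

theorem Col.eq_zero_row {N : ℕ} {u : Shape N n} (hu : ∀ l, u l = none) {ε : Point N n → Bool}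
    (hε : Col u ε) (h : Fin (N + 1)) (p : Fin n) : ε (h, p) = ε (0, p) := by
  induction h using Fin.induction with
  | zero => rfl
  | succ l ih => rw [← ih]; exact (congrFun (hε.layer (hu l)) p).symm

theorem circleAt_bijective :
    Function.Bijective fun p : Fin n => circleAt w (braidlikeVertex w) (0, p) := by
  have hS := isCycles_circleAt w (braidlikeVertex w)
  constructor
  · intro p q h
    have hc : Col (flat w (braidlikeVertex w)) fun r => decide (r.2 = p) := by
      refine ⟨fun l => ?_, rfl⟩
      rw [flat_braidlikeVertex]
      rfl
    have := ((inv_circPerm_iff _ _).2 hc).sameCycle ((hS.iff _ _).1 h)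
    have hqp : q = p := by simpa using this.symm
    exact hqp.symm
  · intro c
    induction c using Quot.inductionOn with
    | h q =>
      obtain ⟨h, p⟩ := q
      refine ⟨p, (hS.iff _ _).2 (sameCycle_iff.2 fun ε hε => ?_)⟩
      exact (((inv_circPerm_iff _ _).1 hε).eq_zero_row (flat_braidlikeVertex w) h p).symm

theorem toModel_canonicalCycle_braidlike {ε : Pt w → Bool}
    (hε : Col (flat w (braidlikeVertex w)) ε) :
    toModel w (canonicalCycle w) (braidlikeVertex w) ε =
      (∏ p : Fin n, ((if Even (p : ℕ) then (-1 : ℂ) else 1) + sg (ε (0, p)))) *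
        nrm (circPerm (flat w (braidlikeVertex w))) ε := by
  have hS := isCycles_circleAt w (braidlikeVertex w)
  obtain ⟨η, rfl⟩ := (hS.inv_iff ε).1 ((inv_circPerm_iff _ _).2 hε)
  rw [toModel_apply]
  simp only [hS.mono_eq, hS.labOf_tauOf]
  let e := Equiv.ofBijective _ (circleAt_bijective w)
  have h1 : ∀ g : Circle w (braidlikeVertex w) → ℂ, ∏ c, g c =
      ∏ p : Fin n, g (circleAt w (braidlikeVertex w) (0, p)) := fun g => (e.prod_comp g).symm
  simp only [← mul_assoc]
  rw [← Finset.sum_mul]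
  congr 1
  have h2 : ∀ lab : Circle w (braidlikeVertex w) → Bool,
      canonicalCycle w ⟨braidlikeVertex w, lab⟩ * chi lab η =
      ∏ c, ((if lab c = true ∧ Even (e.symm c : ℕ) then (-1 : ℂ) else 1) *
        if lab c then 1 else sg (η c)) := fun lab => by
    rw [Finset.prod_mul_distrib]
    congr 1
    rw [h1]
    unfold canonicalCycle
    rw [if_pos rfl]
    refine Finset.prod_congr rfl fun p _ => ?_
    have : e.symm (circleAt w (braidlikeVertex w) (0, p)) = p := e.symm_apply_apply p
    rw [this]
  simp only [h2]
  rw [← Fintype.prod_sum fun c b => (if b = true ∧ Even (e.symm c : ℕ) then (-1 : ℂ) else 1) *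
    if b then 1 else sg (η c), h1]
  refine Finset.prod_congr rfl fun p _ => ?_
  have : e.symm (circleAt w (braidlikeVertex w) (0, p)) = p := e.symm_apply_apply p
  rw [this]
  simp

theorem col_altCol {N : ℕ} {u : Shape N n} (hu : ∀ l, u l = none) : Col u (altCol N n) := by
  refine ⟨fun l => ?_, rfl⟩
  rw [hu]
  rfl

theorem exists_toModel_canonicalCycle : ∃ lam : ℂ, lam ≠ 0 ∧ ∀ S ε, Col (flat w S) ε →
    toModel w (canonicalCycle w) S ε = lam * canM (letters w) S ε := by
  refine ⟨toModel w (canonicalCycle w) (braidlikeVertex w) (altCol _ n), ?_, fun S ε hε => ?_⟩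
  · rw [toModel_canonicalCycle_braidlike w (col_altCol (flat_braidlikeVertex w))]
    refine mul_ne_zero (Finset.prod_ne_zero_iff.2 fun p _ => ?_) (nrm_ne_zero _ _)
    by_cases hp : Even (p : ℕ)
    · have : ¬ Odd (p : ℕ) := Nat.not_odd_iff_even.2 hp
      norm_num [hp, altCol, this, sg]
    · have : Odd (p : ℕ) := Nat.not_even_iff_odd.1 hp
      norm_num [hp, altCol, this, sg]
  · by_cases hS : S = braidlikeVertex w
    · subst hS
      by_cases he : ε = altCol _ n
      · subst he
        rw [canM, if_pos ⟨rfl, rfl⟩, mul_one]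
      · rw [canM, if_neg fun h => he h.2, mul_zero, toModel_canonicalCycle_braidlike w hε]
        have : ∃ p : Fin n, ε (0, p) ≠ decide (Odd (p : ℕ)) := by
          by_contra hc
          push Not at hc
          refine he (funext fun q => ?_)
          obtain ⟨h, p⟩ := q
          rw [hε.eq_zero_row (flat_braidlikeVertex w), hc]
          rfl
        obtain ⟨p, hp⟩ := this
        rw [Finset.prod_eq_zero (Finset.mem_univ p), zero_mul]
        by_cases hev : Even (p : ℕ)
        · have : ¬ Odd (p : ℕ) := Nat.not_odd_iff_even.2 hev
          have h2 : ε (0, p) = true := by simpa [this] using hp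
          simp [hev, h2, sg]
        · have : Odd (p : ℕ) := Nat.not_even_iff_odd.1 hev
          have h2 : ε (0, p) = false := by simpa [this] using hp
          simp [hev, h2, sg]
    · rw [canM, if_neg fun h => hS h.1, mul_zero, toModel_apply]
      refine Finset.sum_eq_zero fun lab _ => ?_
      rw [canonicalCycle, if_neg hS, zero_mul]

theorem Col.update_of_kap {N : ℕ} {L : Fin N → Letter n} {S : Vtx N} {l : Fin N}
    {ε : Point N n → Bool} (hε : Col (shape L S) ε)
    (hk : kap (L l).1 (row ε l.castSucc) (row ε l.succ) ≠ 0) (b : Bool) :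
    Col (shape L (Function.update S l b)) ε := by
  refine ⟨fun k => ?_, hε.2⟩
  by_cases hkl : k = l
  · subst hkl
    cases ho : (L k).1 with
    | none => rw [ho] at hk; exact absurd rfl hk
    | some i =>
      rw [ho, kap_some] at hk
      have hxy : row ε k.castSucc = row ε k.succ ∧ _ := of_not_not fun h => hk (if_neg h)
      obtain ⟨h1, h2⟩ := hxy
      simp only [shape, ho]
      split_ifs
      · exact h1
      · exact ⟨h2, by rw [← h1, h2], fun p _ _ => congrFun h1 p⟩
  · have : shape L (Function.update S l b) k = shape L S k := by
      simp [shape, Function.update_of_ne hkl]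
    rw [this]
    exact hε.1 k

theorem dM_congr {N : ℕ} {L : Fin N → Letter n} {f g : Ch N n}
    (h : ∀ S ε, Col (shape L S) ε → f S ε = g S ε) {S : Vtx N} {ε : Point N n → Bool}
    (hε : Col (shape L S) ε) : dM L f S ε = dM L g S ε := by
  unfold dM
  refine Finset.sum_congr rfl fun l _ => ?_
  unfold dTerm
  split_ifs
  · by_cases hk : kap (L l).1 (row ε l.castSucc) (row ε l.succ) = 0
    · rw [hk]; ring
    · rw [h _ _ (hε.update_of_kap hk false)]
  · rfl

theorem exists_mem_filtration (t : ℝ) (y : Chain w) : ∃ s, y ∈ filtration w t s := by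
  obtain ⟨s, hs⟩ := (Set.finite_range (jtGrading w t)).bddBelow
  exact ⟨s, fun e _ => hs ⟨e, rfl⟩⟩

/-- The filtration levels can be computed in the colour model. -/
theorem levels_eq (t : ℝ) : levels w t = levelsM (letters w) t := by
  obtain ⟨lam, hlam, hcan⟩ := exists_toModel_canonicalCycle w
  ext s
  constructor
  · rintro ⟨y, hy⟩
    obtain ⟨s₀, hs₀⟩ := exists_mem_filtration w t y
    refine ⟨lam⁻¹ • toModel w y, ⟨s₀, Submodule.smul_mem _ _ (toModel_mem w hs₀)⟩, ?_⟩
    refine FM_congr (Submodule.smul_mem _ lam⁻¹ (toModel_mem w hy)) fun S _ ε hε => ?_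
    rw [map_add, dM_smul]
    simp only [Pi.add_apply, Pi.smul_apply, smul_eq_mul]
    rw [hcan S ε hε, toModel_leeDifferential w y S hε]
    field_simp
  · rintro ⟨Y, ⟨s₀, hY⟩, h⟩
    obtain ⟨f, -, hf⟩ := exists_toModel_eq w hY
    refine ⟨lam • f, (mem_filtration_iff w).2 ?_⟩
    refine FM_congr (Submodule.smul_mem _ lam h) fun S _ ε hε => ?_
    rw [map_add, map_smul, map_smul]
    simp only [Pi.add_apply, Pi.smul_apply, smul_eq_mul]
    rw [hcan S ε hε, toModel_leeDifferential w f S hε, dM_congr hf hε]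
    ring

end BridgeLevels

section Words

variable {n : ℕ}

/-- The filtration levels of a padded word. -/
def levelsL (W : List (Letter n)) (t : ℝ) : Set ℝ := levelsM (fun k : Fin W.length => W[k]) t

theorem levelsL_eq_of {N : ℕ} {W : List (Letter n)} (hN : W.length = N) {L : Fin N → Letter n}
    (h : ∀ k : Fin N, W[(k : ℕ)]? = some (L k)) (t : ℝ) : levelsL W t = levelsM L t := by
  subst hN
  unfold levelsL
  congr 1
  funext k
  have := h k
  rw [List.getElem?_eq_getElem k.2] at this
  exact Option.some.inj this

/-- Two words that differ in a subword, as functions on the same index set. -/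
theorem exists_indexed (a z : List (Letter n)) {m m' : List (Letter n)}
    (hm : m'.length = m.length) :
    ∃ (N : ℕ) (L L' : Fin N → Letter n) (pos : Fin m.length → Fin N),
      (∀ t, levelsL (a ++ (m ++ z)) t = levelsM L t) ∧
      (∀ t, levelsL (a ++ (m' ++ z)) t = levelsM L' t) ∧
      (∀ i, (pos i : ℕ) = a.length + i) ∧ (∀ i : Fin m.length, m[(i : ℕ)]? = some (L (pos i))) ∧
      (∀ i : Fin m.length, m'[(i : ℕ)]? = some (L' (pos i))) ∧ ∀ k, (∀ i, k ≠ pos i) → L' k = L k := by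
  have hlen : (a ++ (m' ++ z)).length = (a ++ (m ++ z)).length := by simp [hm]
  have hL : ∀ k : Fin (a ++ (m ++ z)).length,
      (a ++ (m ++ z))[(k : ℕ)]? = some ((a ++ (m ++ z))[(k : ℕ)]) :=
    fun k => List.getElem?_eq_getElem k.2
  have hL' : ∀ k : Fin (a ++ (m ++ z)).length, (a ++ (m' ++ z))[(k : ℕ)]? =
      some ((a ++ (m' ++ z))[(k : ℕ)]'(by rw [hlen]; exact k.2)) := fun k => List.getElem?_eq_getElem _
  refine ⟨_, fun k => (a ++ (m ++ z))[k], fun k => (a ++ (m' ++ z))[(k : ℕ)]'(by rw [hlen]; exact k.2),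
    fun i => ⟨a.length + i, by have := i.2; simp; omega⟩, fun t => levelsL_eq_of rfl hL t,
    fun t => levelsL_eq_of hlen hL' t, fun i => rfl, fun i => ?_, fun i => ?_, fun k hk => ?_⟩
  · refine Eq.trans ?_ (hL _)
    have := i.2
    simp [List.getElem?_append_right, List.getElem?_append_left]
  · refine Eq.trans ?_ (hL' _)
    have := i.2
    simp [List.getElem?_append_right, List.getElem?_append_left, hm]
  · refine Option.some.inj ((hL' k).symm.trans (Eq.trans ?_ (hL k)))
    rcases lt_or_ge (k : ℕ) a.length with h | h
    · rw [List.getElem?_append_left h, List.getElem?_append_left h]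
    · rw [List.getElem?_append_right h, List.getElem?_append_right h]
      have : m.length ≤ (k : ℕ) - a.length := by
        by_contra hc
        exact hk ⟨(k : ℕ) - a.length, by omega⟩ (Fin.ext (by simp; omega))
      rw [List.getElem?_append_right this, List.getElem?_append_right (by omega), hm]

theorem levelsL_exchange (a z : List (Letter n)) {x y : Letter n} (h : Far x.1 y.1) (t : ℝ) :
    levelsL (a ++ ([x, y] ++ z)) t = levelsL (a ++ ([y, x] ++ z)) t := by
  obtain ⟨N, L, L', pos, h1, h2, hpos, hm, hm', hr⟩ :=
    exists_indexed a z (m := [x, y]) (m' := [y, x]) rfl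
  have e0 : x = L (pos 0) := Option.some.inj (hm 0)
  have e1 : y = L (pos 1) := Option.some.inj (hm 1)
  have e0' : y = L' (pos 0) := Option.some.inj (hm' 0)
  have e1' : x = L' (pos 1) := Option.some.inj (hm' 1)
  have hL : L' = L ∘ swap (pos 0) (pos 1) := by
    funext k
    by_cases k0 : k = pos 0
    · subst k0; rw [Function.comp_apply, Equiv.swap_apply_left, ← e1, e0']
    by_cases k1 : k = pos 1
    · subst k1; rw [Function.comp_apply, Equiv.swap_apply_right, ← e0, e1']
    rw [Function.comp_apply, Equiv.swap_apply_of_ne_of_ne k0 k1]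
    refine hr k fun i => ?_
    fin_cases i
    · exact k0
    · exact k1
  rw [h1, h2, hL, levelsM_exchange]
  · exact Fin.ext (by simp [hpos])
  · rw [← e0, ← e1]; exact h

theorem levelsL_idle (a z : List (Letter n)) (b : Bool) (t : ℝ) :
    levelsL (a ++ ((none, b) :: z)) t = levelsL (a ++ z) t := by
  induction z generalizing a with
  | nil =>
    rw [List.append_nil]
    refine Eq.trans (levelsL_eq_of (N := a.length + 1) (by simp)
      (L := fun k => (a ++ [(none, b)])[(k : ℕ)]'(by simpa using k.2))
      (fun k => List.getElem?_eq_getElem _) t) ?_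
    refine levelsM_snoc_idle (b := b) (fun l => ?_) ?_ t
    · simp
    · simp
  | cons x z ih =>
    have h1 := levelsL_exchange a z (x := (none, b)) (y := x) (far_none_left _) t
    have h2 := ih (a ++ [x])
    simp only [List.append_assoc, List.cons_append, List.nil_append] at h1 h2
    rw [h1, h2]

theorem levelsL_cancel (a z : List (Letter n)) (i : Fin (n - 1)) (c : Bool) {t : ℝ}
    (ht : t ∈ Set.Icc (0 : ℝ) 2) :
    levelsL (a ++ ([(some i, c), (some i, !c)] ++ z)) t = levelsL (a ++ z) t := by
  obtain ⟨N, L, L', pos, h1, h2, hpos, hm, hm', hr⟩ := exists_indexed a z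
    (m := [(some i, c), (some i, !c)]) (m' := [(none, c), (none, !c)]) rfl
  have hc : IsCancel L L' i (pos 0) (pos 1) c :=
    { adj := Fin.ext (by simp [hpos])
      left := (Option.some.inj (hm 0)).symm
      right := (Option.some.inj (hm 1)).symm
      left' := (Option.some.inj (hm' 0)).symm
      right' := (Option.some.inj (hm' 1)).symm
      rest := fun k k0 k1 => hr k fun j => by
        fin_cases j
        · exact k0
        · exact k1 }
  rw [h1, hc.levelsM_eq ht, ← h2]
  simp only [List.cons_append, List.nil_append]
  rw [levelsL_idle, levelsL_idle]

theorem levelsL_braid (a z : List (Letter n)) {i j : Fin (n - 1)} {t : ℝ}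
    (ht : t ∈ Set.Icc (0 : ℝ) 2) (hij : (i : ℕ) + 1 = j ∨ (j : ℕ) + 1 = i) :
    levelsL (a ++ ([(some i, true), (some j, true), (some i, true)] ++ z)) t =
      levelsL (a ++ ([(some j, true), (some i, true), (some j, true)] ++ z)) t := by
  obtain ⟨N, L, L', pos, h1, h2, hpos, hm, hm', hr⟩ := exists_indexed a z
    (m := [(some i, true), (some j, true), (some i, true)])
    (m' := [(some j, true), (some i, true), (some j, true)]) rfl
  have hc : IsBraidMove L L' i j (pos 0) (pos 1) (pos 2) :=
    { consec := ⟨Fin.ext (by simp [hpos]), Fin.ext (by simp [hpos])⟩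
      left := (Option.some.inj (hm 0)).symm
      mid := (Option.some.inj (hm 1)).symm
      right := (Option.some.inj (hm 2)).symm
      left' := (Option.some.inj (hm' 0)).symm
      mid' := (Option.some.inj (hm' 1)).symm
      right' := (Option.some.inj (hm' 2)).symm
      rest := fun k k0 k1 k2 => hr k fun j => by
        fin_cases j
        · exact k0
        · exact k1
        · exact k2 }
  rw [h1, h2, hc.levelsM_eq ht hij]

theorem levelsL_delete (a z : List (Letter n)) (i : Fin (n - 1)) (b : Bool) {t s : ℝ}
    (ht : t ∈ Set.Icc (0 : ℝ) 2) :
    (s ∈ levelsL (a ++ ([(some i, b)] ++ z)) t → s - 1 ∈ levelsL (a ++ z) t) ∧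
    (s ∈ levelsL (a ++ z) t → s - 1 ∈ levelsL (a ++ ([(some i, b)] ++ z)) t) := by
  obtain ⟨N, L, L', pos, h1, h2, hpos, hm, hm', hr⟩ := exists_indexed a z
    (m := [(some i, b)]) (m' := [(none, b)]) rfl
  have h3 : levelsL (a ++ z) t = levelsM L' t := by
    rw [← h2]; exact (levelsL_idle a z b t).symm
  rw [h3, h1]
  have e : L (pos 0) = (some i, b) := (Option.some.inj (hm 0)).symm
  have e' : L' (pos 0) = (none, b) := (Option.some.inj (hm' 0)).symm
  have hr' : ∀ k, k ≠ pos 0 → L' k = L k := fun k hk => hr k fun j => by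
    fin_cases j
    exact hk
  exact ⟨levelsM_to_idle ht (pos 0) hr' e e', levelsM_of_idle ht (pos 0) (fun k hk => (hr' k hk).symm) e' e⟩

end Words

section Braids

variable {n : ℕ}

/-- The letters of a braid word as a list. -/
def padded (w : BraidWord n) : List (Letter n) := w.map fun l => (some l.1, l.2)

@[simp] theorem padded_append (w w' : BraidWord n) : padded (w ++ w') = padded w ++ padded w' :=
  List.map_append

theorem levels_eq_padded (w : BraidWord n) (t : ℝ) : levels w t = levelsL (padded w) t := by
  rw [levels_eq]
  refine (levelsL_eq_of (by simp [padded]) (fun k => ?_) t).symm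
  have := k.2
  simp [padded, letters]

/-- Braid words that have the same filtration levels in every context. -/
def wordCon (n : ℕ) : Con (FreeMonoid (Fin (n - 1) × Bool)) where
  r w w' := ∀ a z : BraidWord n, ∀ t ∈ Set.Icc (0 : ℝ) 2,
    levels (a ++ (w.toList ++ z)) t = levels (a ++ (w'.toList ++ z)) t
  iseqv := ⟨fun _ _ _ _ _ => rfl, fun h a z t ht => (h a z t ht).symm,
    fun h h' a z t ht => (h a z t ht).trans (h' a z t ht)⟩
  mul' := fun {w x y z} h h' a b t ht => by
    have h1 := h a (y.toList ++ b) t ht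
    have h2 := h' (a ++ x.toList) b t ht
    simp only [FreeMonoid.toList_mul, List.append_assoc] at h1 h2 ⊢
    rw [h1, h2]

/-- The class of a braid word. -/
def wordClass (w : BraidWord n) : (wordCon n).Quotient := ((FreeMonoid.ofList w : _) : (wordCon n).Quotient)

theorem wordClass_eq_iff {w w' : BraidWord n} : wordClass w = wordClass w' ↔
    ∀ a z : BraidWord n, ∀ t ∈ Set.Icc (0 : ℝ) 2,
      levels (a ++ (w ++ z)) t = levels (a ++ (w' ++ z)) t :=
  Con.eq _

theorem wordClass_append (w w' : BraidWord n) :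
    wordClass (w ++ w') = wordClass w * wordClass w' := rfl

theorem wordClass_nil : wordClass ([] : BraidWord n) = 1 := rfl

theorem wordClass_cancel (i : Fin (n - 1)) (c : Bool) :
    wordClass [(i, c)] * wordClass [(i, !c)] = 1 := by
  rw [← wordClass_append, ← wordClass_nil, wordClass_eq_iff]
  intro a z t ht
  simp only [levels_eq_padded, padded_append]
  exact levelsL_cancel (padded a) (padded z) i c ht

theorem far_of_le {i j : Fin (n - 1)} (h : (i : ℕ) + 2 ≤ j) : Far (some i) (some j) := by
  rintro p ⟨k, hk, hp⟩ ⟨l, hl, hq⟩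
  cases hk
  cases hl
  rcases hp with rfl | rfl <;> rcases hq with hq | hq <;>
    simp only [leftPos, rightPos, Fin.mk.injEq] at hq <;> omega

theorem wordClass_far {i j : Fin (n - 1)} (h : (i : ℕ) + 2 ≤ j) :
    wordClass [(i, true)] * wordClass [(j, true)] =
      wordClass [(j, true)] * wordClass [(i, true)] := by
  rw [← wordClass_append, ← wordClass_append, wordClass_eq_iff]
  intro a z t _
  simp only [levels_eq_padded, padded_append]
  exact levelsL_exchange (padded a) (padded z) (far_of_le h) t

theorem wordClass_braid {i j : Fin (n - 1)} (h : (i : ℕ) + 1 = j) :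
    wordClass [(i, true)] * wordClass [(j, true)] * wordClass [(i, true)] =
      wordClass [(j, true)] * wordClass [(i, true)] * wordClass [(j, true)] := by
  simp only [← wordClass_append]
  rw [wordClass_eq_iff]
  intro a z t ht
  simp only [levels_eq_padded, padded_append]
  exact levelsL_braid (padded a) (padded z) ht (Or.inl h)

/-- The class of a generator as a unit. -/
def genUnit (i : Fin (n - 1)) : ((wordCon n).Quotient)ˣ where
  val := wordClass [(i, true)]
  inv := wordClass [(i, false)]
  val_inv := wordClass_cancel i true
  inv_val := wordClass_cancel i false

theorem lift_genUnit_rels : ∀ r ∈ braidRels n, FreeGroup.lift (genUnit (n := n)) r = 1 := by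
  rintro r (⟨i, j, h, rfl⟩ | ⟨i, j, h, rfl⟩)
  · have : genUnit i * genUnit j = genUnit j * genUnit i := Units.ext (wordClass_far h)
    simp only [map_mul, map_inv, FreeGroup.lift_apply_of]
    rw [this]
    group
  · have : genUnit i * genUnit j * genUnit i = genUnit j * genUnit i * genUnit j :=
      Units.ext (wordClass_braid h)
    simp only [map_mul, map_inv, FreeGroup.lift_apply_of]
    rw [this]
    group

/-- The classes of braid words, as a function on the braid group. -/
def braidClass : BraidGroup n →* ((wordCon n).Quotient)ˣ := PresentedGroup.toGroup lift_genUnit_rels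

theorem toBraid_append (w w' : BraidWord n) : toBraid (w ++ w') = toBraid w * toBraid w' := by
  simp [toBraid]

theorem braidClass_toBraid (w : BraidWord n) : (braidClass (toBraid w)).val = wordClass w := by
  induction w with
  | nil => simp [toBraid, wordClass_nil]
  | cons l w ih =>
    have h1 : toBraid (l :: w) = toBraid [l] * toBraid w := toBraid_append [l] w
    have h2 : wordClass (l :: w) = wordClass [l] * wordClass w := wordClass_append [l] w
    rw [h1, h2, map_mul, Units.val_mul, ih]
    congr 1
    obtain ⟨i, b⟩ := l
    have h3 : braidClass (artinGen i) = genUnit i := PresentedGroup.toGroup.of _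
    cases b
    · simp [toBraid, map_inv, h3, genUnit]
    · simp [toBraid, h3, genUnit]

/-- The filtration levels only depend on the braid. -/
theorem levels_eq_of_toBraid_eq {w w' : BraidWord n} (h : toBraid w = toBraid w') {t : ℝ}
    (ht : t ∈ Set.Icc (0 : ℝ) 2) : levels w t = levels w' t := by
  have h1 : wordClass w = wordClass w' := by
    rw [← braidClass_toBraid, ← braidClass_toBraid, h]
  have := wordClass_eq_iff.1 h1 [] [] t ht
  simpa using this

theorem exists_word (σ : BraidGroup n) : ∃ w : BraidWord n, toBraid w = σ := by
  obtain ⟨g, rfl⟩ := PresentedGroup.mk_surjective _ σ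
  induction g using FreeGroup.induction_on with
  | C1 => exact ⟨[], by simp [toBraid]⟩
  | of i => exact ⟨[(i, true)], by simp [toBraid, artinGen, PresentedGroup.of]⟩
  | inv_of i _ => exact ⟨[(i, false)], by simp [toBraid, artinGen, PresentedGroup.of]⟩
  | mul g g' h h' =>
    obtain ⟨w, hw⟩ := h
    obtain ⟨w', hw'⟩ := h'
    exact ⟨w ++ w', by rw [toBraid_append, hw, hw', map_mul]⟩

theorem levels_delete (a z : BraidWord n) (l : Fin (n - 1) × Bool) {t s : ℝ}
    (ht : t ∈ Set.Icc (0 : ℝ) 2) :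
    (s ∈ levels (a ++ ([l] ++ z)) t → s - 1 ∈ levels (a ++ z) t) ∧
    (s ∈ levels (a ++ z) t → s - 1 ∈ levels (a ++ ([l] ++ z)) t) := by
  simp only [levels_eq_padded, padded_append]
  exact levelsL_delete (padded a) (padded z) l.1 l.2 ht

theorem IsBand.exists_letter {β : BraidGroup n} (h : IsBand β) :
    ∃ (ω : BraidGroup n) (l : Fin (n - 1) × Bool), β = ω * toBraid [l] * ω⁻¹ := by
  obtain ⟨ω, i, h | h⟩ := h
  · exact ⟨ω, (i, true), by simpa [toBraid] using h⟩
  · exact ⟨ω, (i, false), by simpa [toBraid] using h⟩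

/-- Multiplication by a band moves the levels by at most `1`. -/
theorem levels_band {w w' : BraidWord n} {β : BraidGroup n} (hβ : IsBand β)
    (h : toBraid w = β * toBraid w') {t s : ℝ} (ht : t ∈ Set.Icc (0 : ℝ) 2) :
    (s ∈ levels w t → s - 1 ∈ levels w' t) ∧ (s ∈ levels w' t → s - 1 ∈ levels w t) := by
  obtain ⟨ω, l, rfl⟩ := hβ.exists_letter
  obtain ⟨a, rfl⟩ := exists_word ω
  obtain ⟨z, hz⟩ := exists_word ((toBraid a)⁻¹ * toBraid w')
  have h1 : levels w t = levels (a ++ ([l] ++ z)) t := levels_eq_of_toBraid_eq (by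
    rw [h, toBraid_append, toBraid_append, hz]; group) ht
  have h2 : levels w' t = levels (a ++ z) t := levels_eq_of_toBraid_eq (by
    rw [toBraid_append, hz]; group) ht
  rw [h1, h2]
  exact levels_delete a z l ht

theorem levels_bands (b : List (BraidGroup n)) (hb : ∀ β ∈ b, IsBand β) {w w' : BraidWord n}
    (h : toBraid w = b.prod * toBraid w') {t s : ℝ} (ht : t ∈ Set.Icc (0 : ℝ) 2) :
    (s ∈ levels w t → s - b.length ∈ levels w' t) ∧
      (s ∈ levels w' t → s - b.length ∈ levels w t) := by
  induction b generalizing w s with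
  | nil =>
    have : levels w t = levels w' t := levels_eq_of_toBraid_eq (by simpa using h) ht
    simp [this]
  | cons β b ih =>
    obtain ⟨v, hv⟩ := exists_word (b.prod * toBraid w')
    have h1 := fun s => levels_band (s := s) (hb β (by simp)) (w := w) (w' := v)
      (by rw [h, hv, List.prod_cons, mul_assoc]) ht
    have h2 := fun s => ih (s := s) (fun γ hγ => hb γ (by simp [hγ])) hv
    have hc : s - ((β :: b).length : ℝ) = s - 1 - b.length := by
      rw [List.length_cons]; push_cast; ring
    have hc' : s - ((β :: b).length : ℝ) = s - b.length - 1 := by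
      rw [List.length_cons]; push_cast; ring
    exact ⟨fun hs => hc ▸ (h2 _).1 ((h1 _).1 hs), fun hs => hc' ▸ (h1 _).2 ((h2 _).2 hs)⟩

theorem toBraid_mem_bands (w : BraidWord n) :
    ∃ b : Fin w.length → BraidGroup n, (∀ j, IsBand (b j)) ∧ toBraid w = (List.ofFn b).prod := by
  refine ⟨fun j => toBraid [w.get j], fun j => ⟨1, (w.get j).1, ?_⟩, ?_⟩
  · cases h : (w.get j).2
    · exact Or.inr (by simp [toBraid] at h ⊢; simp [h])
    · exact Or.inl (by simp [toBraid] at h ⊢; simp [h])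
  · have : List.ofFn (fun j => toBraid [w.get j]) =
        w.map fun l => if l.2 then artinGen l.1 else (artinGen l.1)⁻¹ := by
      refine List.ext_getElem (by simp) fun k _ _ => ?_
      simp [toBraid]
    rw [this]
    rfl

/-- The levels of a braid word and of the empty word differ by at most the band rank. -/
theorem levels_bandRank (w : BraidWord n) {t s : ℝ} (ht : t ∈ Set.Icc (0 : ℝ) 2) :
    (s ∈ levels w t → s - bandRank (toBraid w) ∈ levels ([] : BraidWord n) t) ∧
      (s ∈ levels ([] : BraidWord n) t → s - bandRank (toBraid w) ∈ levels w t) := by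
  obtain ⟨b, hb, hprod⟩ : bandRank (toBraid w) ∈ {c : ℕ | ∃ b : Fin c → BraidGroup n,
      (∀ j, IsBand (b j)) ∧ toBraid w = (List.ofFn b).prod} :=
    Nat.sInf_mem ⟨_, toBraid_mem_bands w⟩
  have := levels_bands (s := s) (List.ofFn b) (fun β hβ => by
    obtain ⟨j, rfl⟩ := List.mem_ofFn.1 hβ
    exact hb j) (w := w) (w' := []) (hprod.trans (by simp [toBraid])) ht
  rwa [List.length_ofFn] at this

end Braids

section Rasmussen

variable {n : ℕ} (w : BraidWord n)

/-- The canonical cycle is not a boundary. -/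
theorem canonicalCycle_add_ne_zero (y : Chain w) : canonicalCycle w + leeDifferential w y ≠ 0 := by
  intro h
  obtain ⟨lam, hlam, hcan⟩ := exists_toModel_canonicalCycle w
  have hc : Col (flat w (braidlikeVertex w)) (altCol w.length n) :=
    col_altCol (flat_braidlikeVertex w)
  have h1 := congrArg (fun f => toModel w f (braidlikeVertex w) (altCol w.length n)) h
  simp only [map_add, map_zero, Pi.add_apply, Pi.zero_apply] at h1
  rw [hcan _ _ hc, toModel_leeDifferential w y _ hc] at h1
  have h2 : canM (letters w) (braidlikeVertex w) (altCol w.length n) = 1 := if_pos ⟨rfl, rfl⟩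
  have h3 : dM (letters w) (toModel w y) (braidlikeVertex w) (altCol w.length n) = 0 := by
    refine Finset.sum_eq_zero fun l _ => ?_
    unfold dTerm letters
    rw [kap_altCol]
    simp
  rw [h2, h3] at h1
  simp [hlam] at h1

/-- The maximum in the definition of the annular Rasmussen invariant exists. -/
theorem isGreatest_annularRasmussen (t : ℝ) : IsGreatest (levels w t) (annularRasmussen w t) := by
  have key : ∀ s ∈ levels w t, ∃ e, jtGrading w t e ∈ levels w t ∧ s ≤ jtGrading w t e := by
    rintro s ⟨y, hy⟩
    obtain ⟨e₁, he₁⟩ := Function.ne_iff.1 (canonicalCycle_add_ne_zero w y)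
    obtain ⟨e, he, hmin⟩ := Finset.exists_min_image
      (Finset.univ.filter fun e => (canonicalCycle w + leeDifferential w y) e ≠ 0) (jtGrading w t)
      ⟨e₁, Finset.mem_filter.2 ⟨Finset.mem_univ _, he₁⟩⟩
    exact ⟨e, ⟨y, fun e' he' => hmin e' (Finset.mem_filter.2 ⟨Finset.mem_univ _, he'⟩)⟩,
      hy e (Finset.mem_filter.1 he).2⟩
  have hne : (Finset.univ.filter fun e => jtGrading w t e ∈ levels w t).Nonempty := by
    obtain ⟨s, hs⟩ := exists_mem_filtration w t (canonicalCycle w)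
    obtain ⟨e, he, -⟩ := key s ⟨0, by simpa using hs⟩
    exact ⟨e, Finset.mem_filter.2 ⟨Finset.mem_univ _, he⟩⟩
  obtain ⟨e, he, hmax⟩ := Finset.exists_max_image _ (jtGrading w t) hne
  have hg : IsGreatest (levels w t) (jtGrading w t e) := by
    refine ⟨(Finset.mem_filter.1 he).2, fun s hs => ?_⟩
    obtain ⟨e', he', hs'⟩ := key s hs
    exact hs'.trans (hmax e' (Finset.mem_filter.2 ⟨Finset.mem_univ _, he'⟩))
  rw [annularRasmussen, hg.csSup_eq]
  exact hg

theorem continuous_annularRasmussen : Continuous (annularRasmussen w) := by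
  obtain ⟨C, hC⟩ := (Set.finite_range fun e => |(kGrading w e : ℝ)|).bddAbove
  have hk : ∀ e, |(kGrading w e : ℝ)| ≤ max C 0 := fun e => (hC ⟨e, rfl⟩).trans (le_max_left _ _)
  refine (LipschitzWith.of_le_add_mul (Real.toNNReal (max C 0)) fun t t' => ?_).continuous
  rw [Real.coe_toNNReal _ (le_max_right _ _), ← sub_le_iff_le_add]
  refine (isGreatest_annularRasmussen w t').2 ?_
  obtain ⟨y, hy⟩ := (isGreatest_annularRasmussen w t).1
  refine ⟨y, fun e he => ?_⟩
  have h1 := hy e he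
  have h2 : jtGrading w t e - jtGrading w t' e ≤ max C 0 * dist t t' := by
    have : jtGrading w t e - jtGrading w t' e = -(kGrading w e : ℝ) * (t - t') := by
      unfold jtGrading; ring
    rw [this]
    refine (le_abs_self _).trans ?_
    rw [abs_mul, abs_neg, Real.dist_eq]
    exact mul_le_mul_of_nonneg_right (hk e) (abs_nonneg _)
  linarith

theorem isNontrivial_braidlike (c : Circle w (braidlikeVertex w)) :
    IsNontrivial w (braidlikeVertex w) c := by
  obtain ⟨p, hp⟩ := (circleAt_bijective w).2 c
  have : Nat.card {q : Fin n // circleAt w (braidlikeVertex w) (0, q) = c} = 1 := by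
    rw [Nat.card_eq_one_iff_exists]
    exact ⟨⟨p, hp⟩, fun q => Subtype.ext ((circleAt_bijective w).1 (q.2.trans hp.symm))⟩
  unfold IsNontrivial
  rw [this]
  exact odd_one

theorem jtGrading_nil (t : ℝ) (lab : Circle ([] : BraidWord n) (braidlikeVertex []) → Bool) :
    jtGrading ([] : BraidWord n) t ⟨braidlikeVertex [], lab⟩ =
      (1 - t) * ∑ p : Fin n, (labelDeg (lab (circleAt [] (braidlikeVertex []) (0, p))) : ℝ) := by
  have hk : kGrading ([] : BraidWord n) ⟨braidlikeVertex [], lab⟩ =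
      ∑ᶠ c : Circle ([] : BraidWord n) (braidlikeVertex []), labelDeg (lab c) :=
    finsum_congr fun c => if_pos (isNontrivial_braidlike _ c)
  have hh : height ([] : BraidWord n) (braidlikeVertex []) = 0 := by
    unfold height
    have : IsEmpty {l : Fin ([] : BraidWord n).length // braidlikeVertex [] l = true} :=
      ⟨fun l => l.1.elim0⟩
    exact Nat.card_of_isEmpty
  have hs : ∑ᶠ c : Circle ([] : BraidWord n) (braidlikeVertex []), labelDeg (lab c) =
      ∑ p : Fin n, labelDeg (lab (circleAt [] (braidlikeVertex []) (0, p))) := by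
    rw [finsum_eq_sum_of_fintype]
    exact ((circleAt_bijective ([] : BraidWord n)).sum_comp fun c => labelDeg (lab c)).symm
  unfold jtGrading jGrading
  rw [hk]
  simp only [hh, hs, posCrossings, negCrossings, List.countP_nil]
  push_cast
  ring

theorem canonicalCycle_nil_ne_zero (e : Gen ([] : BraidWord n)) :
    canonicalCycle ([] : BraidWord n) e ≠ 0 := by
  unfold canonicalCycle
  rw [if_pos (funext fun l => l.elim0)]
  refine Finset.prod_ne_zero_iff.2 fun p _ => ?_
  split_ifs <;> simp

theorem leeDifferential_nil (y : Chain ([] : BraidWord n)) : leeDifferential [] y = 0 := by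
  have : leeMatrix ([] : BraidWord n) = 0 := by
    ext e' e
    exact Finset.sum_eq_zero fun l _ => l.elim0
  unfold leeDifferential
  rw [this]
  simp

/-- The invariant of the trivial braid. -/
theorem annularRasmussen_nil (t : ℝ) :
    annularRasmussen ([] : BraidWord n) t = -|(n : ℝ) * (1 - t)| := by
  have hmem : ∀ s, s ∈ levels ([] : BraidWord n) t ↔ ∀ e, s ≤ jtGrading [] t e := fun s => by
    constructor
    · rintro ⟨y, hy⟩ e
      refine hy e ?_
      rw [leeDifferential_nil, add_zero]
      exact canonicalCycle_nil_ne_zero e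
    · intro h
      exact ⟨0, fun e _ => h e⟩
  refine (IsGreatest.csSup_eq (a := -|(n : ℝ) * (1 - t)|) ⟨(hmem _).2 fun e => ?_, fun s hs => ?_⟩)
  · obtain ⟨S, lab⟩ := e
    obtain rfl : S = braidlikeVertex [] := funext fun l => l.elim0
    rw [jtGrading_nil]
    refine le_trans (neg_le_neg ?_) (neg_abs_le _)
    rw [abs_mul, abs_mul, mul_comm, Nat.abs_cast]
    refine mul_le_mul_of_nonneg_right ((Finset.abs_sum_le_sum_abs _ _).trans ?_) (abs_nonneg _)
    refine (Finset.sum_le_card_nsmul _ _ 1 fun p _ => ?_).trans (by simp)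
    unfold labelDeg
    split_ifs <;> simp
  · rw [hmem] at hs
    have h := fun b => hs ⟨braidlikeVertex [], fun _ => b⟩
    simp only [jtGrading_nil, Finset.sum_const, Finset.card_univ, Fintype.card_fin, nsmul_eq_mul] at h
    have h1 := h true
    have h2 := h false
    simp only [labelDeg, if_true, Bool.false_eq_true, if_false] at h1 h2
    push_cast at h1 h2
    rcases abs_cases ((n : ℝ) * (1 - t)) with ⟨h3, -⟩ | ⟨h3, -⟩ <;> rw [h3] <;> linarith

theorem abs_annularRasmussen_sub_le {t : ℝ} (ht : t ∈ Set.Icc (0 : ℝ) 2) :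
    |annularRasmussen w t - annularRasmussen ([] : BraidWord n) t| ≤ bandRank (toBraid w) := by
  have h1 := isGreatest_annularRasmussen w t
  have h2 := isGreatest_annularRasmussen ([] : BraidWord n) t
  have h3 := h2.2 ((levels_bandRank w ht).1 h1.1)
  have h4 := h1.2 ((levels_bandRank w ht).2 h2.1)
  rw [abs_le]
  constructor <;> linarith

end Rasmussen

end AnnularLee

end

theorem corollary4p5 (n : ℕ) (σ : AnnularLee.BraidGroup n) (w : AnnularLee.BraidWord n)
    (hw : AnnularLee.toBraid w = σ) :
    (∀ t ∈ Set.Icc (0 : ℝ) 2,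
      IsGreatest (AnnularLee.levels w t) (AnnularLee.annularRasmussen w t)) ∧
    (∀ w' : AnnularLee.BraidWord n, AnnularLee.toBraid w' = σ → ∀ t ∈ Set.Icc (0 : ℝ) 2,
      AnnularLee.annularRasmussen w' t = AnnularLee.annularRasmussen w t) ∧
    (∀ t ∈ Set.Icc (0 : ℝ) 2,
      AnnularLee.annularRasmussen ([] : AnnularLee.BraidWord n) t = -|(n : ℝ) * (1 - t)|) ∧
    (∃ M : ℝ,
      IsGreatest ((fun t : ℝ => |AnnularLee.annularRasmussen w t -
        AnnularLee.annularRasmussen ([] : AnnularLee.BraidWord n) t|) '' Set.Icc (0 : ℝ) 2) M ∧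
      M ≤ (AnnularLee.bandRank σ : ℝ)) ∧
    (∃ M : ℝ,
      IsGreatest ((fun t : ℝ => |AnnularLee.annularRasmussen w t + (|(n : ℝ) * (1 - t)|)|) ''
        Set.Icc (0 : ℝ) 2) M ∧
      M ≤ (AnnularLee.bandRank σ : ℝ)) := by
  subst hw
  have hmax : ∃ M : ℝ,
      IsGreatest ((fun t : ℝ => |AnnularLee.annularRasmussen w t -
        AnnularLee.annularRasmussen ([] : AnnularLee.BraidWord n) t|) '' Set.Icc (0 : ℝ) 2) M ∧
      M ≤ (AnnularLee.bandRank (AnnularLee.toBraid w) : ℝ) := by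
    have hcont : Continuous fun t : ℝ => |AnnularLee.annularRasmussen w t -
        AnnularLee.annularRasmussen ([] : AnnularLee.BraidWord n) t| :=
      ((AnnularLee.continuous_annularRasmussen w).sub
        (AnnularLee.continuous_annularRasmussen [])).abs
    obtain ⟨M, hM⟩ := (isCompact_Icc.image hcont).exists_isGreatest
      ((Set.nonempty_Icc.2 zero_le_two).image _)
    refine ⟨M, hM, ?_⟩
    obtain ⟨t, ht, rfl⟩ := hM.1
    exact AnnularLee.abs_annularRasmussen_sub_le w ht
  refine ⟨fun t _ => AnnularLee.isGreatest_annularRasmussen w t, fun w' hw' t ht => ?_,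
    fun t _ => AnnularLee.annularRasmussen_nil t, hmax, ?_⟩
  · unfold AnnularLee.annularRasmussen
    rw [AnnularLee.levels_eq_of_toBraid_eq hw' ht]
  · simpa only [AnnularLee.annularRasmussen_nil, sub_neg_eq_add] using hmax
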